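/- **Setting.** Let $I\ge 1$ agents consider $$\min_{D\in\mathcal D,\;X_i\in\mathcal X_i}\ \sum_{i=1}^I f_i(D,X_i)+\sum_{i=1}^I g_i(X_i)+G(D),\qquad D\in\mathbb R^{M\times K},\ X_i\in\mathbb R^{K\times n_i},$$ and put $F(D,X)=\sum_i f_i(D,X_i)$. Let $\mathcal O\supseteq\mathcal D$, $\mathcal O_i\supseteq\mathcal X_i$ be open convex sets. Assume: each $f_i:\mathcal O\times\mathcal O_i\to\mathbb R$ is $C^2$, bounded below and biconvex; for $D\in\mathcal D$, $\nabla_{X_i}f_i(D,\cdot)$ is Lipschitz on $\mathcal X_i$ with constant $L_i(D)$, and $L_i$ is continuous on $\mathcal D$; $\mathcal D$ is compact and convex, each $\mathcal X_i$ is closed and convex; $G:\mathcal O\to\mathbb R$ is convex; and for each $i$ either $\mathcal X_i$ is compact and $g_i:\mathcal O_i\to\mathbb R$ is convex, or $g_i:\mathcal O_i\to\mathbb R$ is strongly convex. Norms $\|\cdot\|$ and inner products are Frobenius; $\|A\|_{\infty,\infty}=\max_{p,q}|A_{pq}|$. **Algorithm (D$^4$L).** Let $\mathcal E^\nu$, $\nu\ge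 0$, be directed edge sets on $\{1,\dots,I\}$ ($(j,i)\in\mathcal E^\nu$: a link from $j$ to $i$), $N_i^\nu=\{j:(j,i)\in\mathcal E^\nu\}\cup\{i\}$, and suppose that for some integer $B>0$ the digraph with edge set $\bigcup_{t=kB}^{(k+1)B-1}\mathcal E^t$ is strongly connected for every $k\ge 0$. Let the weights satisfy, for some $\kappa>0$ and all $\nu$: $a_{ii}^\nu\ge\kappa$; $a_{ij}^\nu\ge\kappa$ if $(j,i)\in\mathcal E^\nu$; $a_{ij}^\nu=0$ if $i\neq j$ and $(j,i)\notin\mathcal E^\nu$; $\sum_i a_{ij}^\nu=1$ for all $j$. Start from $\phi_i^0=1$, $D_{(i)}^0\in\mathcal D$, $X_i^0\in\mathcal X_i$, $\Theta_{(i)}^0=\nabla_Df_i(D_{(i)}^0,X_i^0)$ and iterate, for all $i$: $$\widetilde D_{(i)}^\nu=\operatorname*{argmin}_{D\in\mathcal D}\ \tilde f_i(D;D_{(i)}^\nu,X_i^\nu)+\langle I\,\Theta_{(i)}^\nu-\nabla_Df_i(D_{(i)}^\nu,X_i^\nu),D-D_{(i)}^\nu\rangle+G(D),$$ $$U_{(i)}^\nu=D_{(i)}^\nu+\gamma^\nu(\widetilde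 D_{(i)}^\nu-D_{(i)}^\nu),\qquad X_i^{\nu+1}=\operatorname*{argmin}_{X_i\in\mathcal X_i}\ \tilde h_i(X_i;U_{(i)}^\nu,X_i^\nu)+g_i(X_i),$$ $$\phi_i^{\nu+1}=\sum_{j\in N_i^\nu}a_{ij}^\nu\phi_j^\nu,\qquad D_{(i)}^{\nu+1}=\frac1{\phi_i^{\nu+1}}\sum_{j\in N_i^\nu}a_{ij}^\nu\phi_j^\nu U_{(j)}^\nu,$$ $$\Theta_{(i)}^{\nu+1}=\frac1{\phi_i^{\nu+1}}\sum_{j\in N_i^\nu}a_{ij}^\nu\phi_j^\nu\Theta_{(j)}^\nu+\frac1{\phi_i^{\nu+1}}\bigl(\nabla_Df_i(D_{(i)}^{\nu+1},X_i^{\nu+1})-\nabla_Df_i(D_{(i)}^\nu,X_i^\nu)\bigr).$$ Here, at each iteration, $\tilde f_i(D;D_{(i)}^\nu,X_i^\nu)$ is either $f_i(D,X_i^\nu)$ or $\langle\nabla_Df_i(D_{(i)}^\nu,X_i^\nu),D-D_{(i)}^\nu\rangle$, plus $\frac{\tau_{D,i}^\nu}{2}\|D-D_{(i)}^\nu\|^2$;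 and $\tilde h_i(X_i;U_{(i)}^\nu,X_i^\nu)$ is either $f_i(U_{(i)}^\nu,X_i)$ or $\langle\nabla_{X_i}f_i(U_{(i)}^\nu,X_i^\nu),X_i-X_i^\nu\rangle$, plus $\frac{\tau_{X,i}^\nu}{2}\|X_i-X_i^\nu\|^2$. For every $i$: $0<\inf_\nu\tau_{D,i}^\nu\le\sup_\nu\tau_{D,i}^\nu<\infty$, $\tau_{X,i}^\nu>0$, $\sup_\nu\tau_{X,i}^\nu<\infty$, and for some $\epsilon_0>0$, $\tau_{X,i}^\nu\ge\frac12L_i(U_{(i)}^\nu)+\epsilon_0$ for all $\nu\ge 1$. The step size satisfies $\gamma^\nu\in(0,1]$, $\sum_\nu\gamma^\nu=\infty$, $\sum_\nu(\gamma^\nu)^2<\infty$, and is non-increasing. **Error measures.** Put $\overline D^\nu=\frac1I\sum_iD_{(i)}^\nu$, $e^\nu=\max_i\|D_{(i)}^\nu-\overline D^\nu\|_{\infty,\infty}$ and, for fixed $\hat\tau_D,\hat\tau_X>0$, $$\widehat D(D,X)=\operatorname*{argmin}_{D'\in\mathcal D}\langle\nabla_DF(D,X),D'-D\rangle+\tfrac{\hat\tau_D}2\|D'-D\|^2+G(D'),$$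 $$\widehat X_i(D,X_i)=\operatorname*{argmin}_{X_i'\in\mathcal X_i}\langle\nabla_{X_i}f_i(D,X_i),X_i'-X_i\rangle+\tfrac{\hat\tau_X}2\|X_i'-X_i\|^2+g_i(X_i'),$$ $\Delta_D(D,X)=\|\widehat D(D,X)-D\|_{\infty,\infty}$, $\Delta_X(D,X)=\max_i\|\widehat X_i(D,X_i)-X_i\|_{\infty,\infty}$. For $\epsilon>0$ let $T_{D,\epsilon}$ and $T_{X,\epsilon}$ be the least $\nu\ge 0$ with $\Delta_D(\overline D^\nu,X^\nu)\le\epsilon$ and with $\Delta_X(\overline D^\nu,X^\nu)\le\epsilon$, respectively. **Theorem.** (a) If $\gamma^\nu$ decays more slowly than every geometric sequence, i.e. $\rho^\nu=o(\gamma^\nu)$ for every $\rho\in(0,1)$ (as for all the usual diminishing rules), then $e^\nu=O(\gamma^{\lceil\theta\nu\rceil})$ as $\nu\to\infty$, for every $\theta\in(0,1)$. (b) $T_{X,\epsilon}$ exists for every $\epsilon>0$, and $T_{X,\epsilon}\le C/\epsilon^{2}$ with a constant $C$ independent of $\epsilon$. If moreover $\gamma^\nu=k/\nu^p$ for all $\nu\ge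 1$, with some $k>0$ and $p\in(1/2,1)$, then $T_{D,\epsilon}$ exists for every $\epsilon>0$, and $T_{D,\epsilon}\le C'/\epsilon^{2/(1-p)}$ with a constant $C'$ independent of $\epsilon$. -/

import Mathlib

open Filter Topology Asymptotics
open scoped NNReal

noncomputable section

namespace D4L

/-- Real `r × c` matrices, as the Euclidean space of their entries: the norm is the Frobenius norm
and the inner product is `⟪A, B⟫ = tr (Aᵀ B)`. -/
abbrev Mat (r c : ℕ) : Type := EuclideanSpace ℝ (Fin r × Fin c)

/-- The `L_{∞,∞}` norm `max_{p,q} |A_{pq}|`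
(the norm of the underlying function is the sup norm). -/
def maxNorm {r c : ℕ} (A : Mat r c) : ℝ := ‖WithLp.ofLp A‖

/-- `x` is a minimizer of `h` over `s`. -/
def IsArgmin {E : Type*} (s : Set E) (h : E → ℝ) (x : E) : Prop :=
  x ∈ s ∧ IsMinOn h s x

/-- A minimizer of `h` over `s` (arbitrary if there is none). -/
def argmin {E : Type*} [Nonempty E] (s : Set E) (h : E → ℝ) : E :=
  Classical.epsilon (IsArgmin s h)

/-- The data of the problem
`min_{D, X_1, …, X_I}  ∑ i, f_i (D, X_i) + ∑ i, g_i (X_i) + G (D)`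
subject to `D ∈ setD` and `X_i ∈ setX i`, where `D` is `M × K` and `X_i` is `K × n_i`.
The functions `f_i`, `g_i`, `G` matter only on the open sets
`domD × domX i`, `domX i`, `domD`. -/
structure Problem (I M K : ℕ) (n : Fin I → ℕ) where
  domD : Set (Mat M K)
  domX : ∀ i : Fin I, Set (Mat K (n i))
  setD : Set (Mat M K)
  setX : ∀ i : Fin I, Set (Mat K (n i))
  f : ∀ i : Fin I, Mat M K → Mat K (n i) → ℝ
  g : ∀ i : Fin I, Mat K (n i) → ℝ
  G : Mat M K → ℝ

variable {I M K : ℕ} {n : Fin I → ℕ}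

namespace Problem

/-- `∇_D f_i (D, X_i)`. -/
def gradD (P : Problem I M K n) (i : Fin I) (D : Mat M K) (X : Mat K (n i)) : Mat M K :=
  gradient (fun D' => P.f i D' X) D

/-- `∇_{X_i} f_i (D, X_i)`. -/
def gradX (P : Problem I M K n) (i : Fin I) (D : Mat M K) (X : Mat K (n i)) : Mat K (n i) :=
  gradient (fun X' => P.f i D X') X

/-- `F (D, X) = ∑ i, f_i (D, X_i)`. -/
def F (P : Problem I M K n) (D : Mat M K) (X : ∀ i, Mat K (n i)) : ℝ :=
  ∑ i, P.f i D (X i)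

/-- `∇_D F (D, X)`. -/
def gradDF (P : Problem I M K n) (D : Mat M K) (X : ∀ i, Mat K (n i)) : Mat M K :=
  gradient (fun D' => P.F D' X) D

/-- The standing assumptions on the problem; `L i D` is the Lipschitz constant
of `∇_{X_i} f_i (D, ·)` on `setX i`. -/
structure Standing (P : Problem I M K n) (L : Fin I → Mat M K → ℝ≥0) : Prop where
  isOpen_domD : IsOpen P.domD
  convex_domD : Convex ℝ P.domD
  setD_subset : P.setD ⊆ P.domD
  isOpen_domX : ∀ i, IsOpen (P.domX i)
  convex_domX : ∀ i, Convex ℝ (P.domX i)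
  setX_subset : ∀ i, P.setX i ⊆ P.domX i
  /- each `f_i` is `C²`, bounded below and biconvex -/
  contDiff_f : ∀ i, ContDiffOn ℝ 2
    (fun p : Mat M K × Mat K (n i) => P.f i p.1 p.2) (P.domD ×ˢ P.domX i)
  bddBelow_f : ∀ i, ∃ c : ℝ, ∀ D ∈ P.domD, ∀ X ∈ P.domX i, c ≤ P.f i D X
  convex_f_left : ∀ i, ∀ X ∈ P.domX i, ConvexOn ℝ P.domD (fun D => P.f i D X)
  convex_f_right : ∀ i, ∀ D ∈ P.domD, ConvexOn ℝ (P.domX i) (fun X => P.f i D X)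
  /- Lipschitz continuity of the partial gradient in `X_i` -/
  lipschitz_gradX : ∀ i, ∀ D ∈ P.setD, LipschitzOnWith (L i D) (P.gradX i D) (P.setX i)
  continuous_L : ∀ i, ContinuousOn (L i) P.setD
  /- feasible sets -/
  isCompact_setD : IsCompact P.setD
  convex_setD : Convex ℝ P.setD
  isClosed_setX : ∀ i, IsClosed (P.setX i)
  convex_setX : ∀ i, Convex ℝ (P.setX i)
  /- nonsmooth terms -/
  convex_G : ConvexOn ℝ P.domD P.G
  compact_or_strongConvex : ∀ i,
    (IsCompact (P.setX i) ∧ ConvexOn ℝ (P.domX i) (P.g i)) ∨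
      ∃ μ : ℝ, 0 < μ ∧ StrongConvexOn (P.domX i) μ (P.g i)

end Problem

/-- The two admissible kinds of surrogates: the original function plus a proximal term,
or the linearized function plus a proximal term. -/
inductive Surrogate
  | proximal
  | linearized

/-- Surrogate of `f_i (·, X_i)` at `(D₀, X₀)`, with proximal weight `τ`. -/
def surrogateD (P : Problem I M K n) (s : Surrogate) (i : Fin I) (τ : ℝ)
    (D₀ : Mat M K) (X₀ : Mat K (n i)) (D : Mat M K) : ℝ :=
  match s with
  | .proximal => P.f i D X₀ + τ / 2 * ‖D - D₀‖ ^ 2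
  | .linearized => inner ℝ (P.gradD i D₀ X₀) (D - D₀) + τ / 2 * ‖D - D₀‖ ^ 2

/-- Surrogate of `f_i (U, ·)` at `(U, X₀)`, with proximal weight `τ`. -/
def surrogateX (P : Problem I M K n) (s : Surrogate) (i : Fin I) (τ : ℝ)
    (U : Mat M K) (X₀ : Mat K (n i)) (X : Mat K (n i)) : ℝ :=
  match s with
  | .proximal => P.f i U X + τ / 2 * ‖X - X₀‖ ^ 2
  | .linearized => inner ℝ (P.gradX i U X₀) (X - X₀) + τ / 2 * ‖X - X₀‖ ^ 2

/-- A time-varying digraph on the agents: `E ν i j` means that at time `ν` there is a link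
from `i` to `j`. -/
abbrev DigraphSeq (I : ℕ) : Type := ℕ → Fin I → Fin I → Prop

/-- In-neighborhood of agent `i` at time `ν`, including `i` itself. -/
def inNeighbors (E : DigraphSeq I) (ν : ℕ) (i : Fin I) : Finset (Fin I) :=
  open Classical in Finset.univ.filter (fun j => E ν j i ∨ j = i)

/-- `B`-strong connectivity: for all `k`, the digraph with edge set
`⋃_{t = kB}^{(k+1)B - 1} E t` is strongly connected. -/
def StronglyConnected (E : DigraphSeq I) (B : ℕ) : Prop :=
  ∀ (k : ℕ) (i j : Fin I),
    Relation.ReflTransGen (fun a b => ∃ t, k * B ≤ t ∧ t < (k + 1) * B ∧ E t a b) i j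

/-- Assumptions on the consensus weights `A ν i j = a_{ij}^ν`. -/
structure AdmissibleWeights (E : DigraphSeq I) (A : ℕ → Matrix (Fin I) (Fin I) ℝ) (κ : ℝ) :
    Prop where
  pos : 0 < κ
  diag : ∀ ν i, κ ≤ A ν i i
  edge : ∀ ν i j, E ν j i → κ ≤ A ν i j
  nonedge : ∀ ν i j, i ≠ j → ¬ E ν j i → A ν i j = 0
  colStochastic : ∀ ν j, ∑ i, A ν i j = 1

/-- The free parameters of the algorithm: step size, proximal weights, kinds of surrogates
(free at each iteration and for each agent), digraphs and consensus weights. -/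
structure Parameters (I : ℕ) where
  γ : ℕ → ℝ
  τD : ℕ → Fin I → ℝ
  τX : ℕ → Fin I → ℝ
  kindD : ℕ → Fin I → Surrogate
  kindX : ℕ → Fin I → Surrogate
  E : DigraphSeq I
  A : ℕ → Matrix (Fin I) (Fin I) ℝ

/-- The sequences generated by the algorithm; `Dt` stands for `D̃`. -/
structure Iterates (I M K : ℕ) (n : Fin I → ℕ) where
  D : ℕ → Fin I → Mat M K
  X : ℕ → ∀ i : Fin I, Mat K (n i)
  Θ : ℕ → Fin I → Mat M K
  φ : ℕ → Fin I → ℝ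
  Dt : ℕ → Fin I → Mat M K
  U : ℕ → Fin I → Mat M K

/-- `T` is generated by the D⁴L algorithm on problem `P` with parameters `S`. -/
structure IsGenerated (P : Problem I M K n) (S : Parameters I) (T : Iterates I M K n) :
    Prop where
  /- initialization -/
  init_φ : ∀ i, T.φ 0 i = 1
  init_D : ∀ i, T.D 0 i ∈ P.setD
  init_X : ∀ i, T.X 0 i ∈ P.setX i
  init_Θ : ∀ i, T.Θ 0 i = P.gradD i (T.D 0 i) (T.X 0 i)
  /- local optimization -/
  step_Dt : ∀ ν i, IsArgmin P.setD
    (fun D => surrogateD P (S.kindD ν i) i (S.τD ν i) (T.D ν i) (T.X ν i) D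
      + inner ℝ ((I : ℝ) • T.Θ ν i - P.gradD i (T.D ν i) (T.X ν i)) (D - T.D ν i)
      + P.G D) (T.Dt ν i)
  step_U : ∀ ν i, T.U ν i = T.D ν i + S.γ ν • (T.Dt ν i - T.D ν i)
  step_X : ∀ ν i, IsArgmin (P.setX i)
    (fun X => surrogateX P (S.kindX ν i) i (S.τX ν i) (T.U ν i) (T.X ν i) X + P.g i X)
    (T.X (ν + 1) i)
  /- local communications -/
  step_φ : ∀ ν i, T.φ (ν + 1) i = ∑ j ∈ inNeighbors S.E ν i, S.A ν i j * T.φ ν j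
  step_D : ∀ ν i, T.D (ν + 1) i =
    (1 / T.φ (ν + 1) i) • ∑ j ∈ inNeighbors S.E ν i, (S.A ν i j * T.φ ν j) • T.U ν j
  step_Θ : ∀ ν i, T.Θ (ν + 1) i =
    (1 / T.φ (ν + 1) i) • ∑ j ∈ inNeighbors S.E ν i, (S.A ν i j * T.φ ν j) • T.Θ ν j
      + (1 / T.φ (ν + 1) i) •
        (P.gradD i (T.D (ν + 1) i) (T.X (ν + 1) i) - P.gradD i (T.D ν i) (T.X ν i))

/-- Assumptions on the proximal weights (they involve the iterates `U`). -/
structure AdmissibleProx (L : Fin I → Mat M K → ℝ≥0) (S : Parameters I)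
    (T : Iterates I M K n) : Prop where
  τX_pos : ∀ ν i, 0 < S.τX ν i
  τD_lower : ∀ i, ∃ c : ℝ, 0 < c ∧ ∀ ν, c ≤ S.τD ν i
  τD_upper : ∀ i, ∃ c : ℝ, ∀ ν, S.τD ν i ≤ c
  τX_upper : ∀ i, ∃ c : ℝ, ∀ ν, S.τX ν i ≤ c
  τX_lower : ∃ ε : ℝ, 0 < ε ∧
    ∀ ν, 1 ≤ ν → ∀ i, (1 / 2 : ℝ) * (L i (T.U ν i) : ℝ) + ε ≤ S.τX ν i

/-- The diminishing step-size rule. -/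
structure AdmissibleStep (γ : ℕ → ℝ) : Prop where
  pos : ∀ ν, 0 < γ ν
  le_one : ∀ ν, γ ν ≤ 1
  sum_eq_top : Tendsto (fun N => ∑ ν ∈ Finset.range N, γ ν) atTop atTop
  summable_sq : Summable (fun ν => γ ν ^ 2)

namespace Iterates

/-- The average `D̄^ν = (1/I) ∑ i, D_(i)^ν`. -/
def avgD (T : Iterates I M K n) (ν : ℕ) : Mat M K :=
  (1 / (I : ℝ)) • ∑ i, T.D ν i

/-- Consensus error `e^ν`: the largest entry, in absolute value, of `D_(i)^ν - D̄^ν` over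
all agents `i`. -/
def consensusError (T : Iterates I M K n) (ν : ℕ) : ℝ :=
  ⨆ i, maxNorm (T.D ν i - T.avgD ν)

end Iterates

/-- `D̂ (D, X)`. -/
def hatD (P : Problem I M K n) (τ : ℝ) (D : Mat M K) (X : ∀ i, Mat K (n i)) : Mat M K :=
  argmin P.setD (fun D' =>
    inner ℝ (P.gradDF D X) (D' - D) + τ / 2 * ‖D' - D‖ ^ 2 + P.G D')

/-- `X̂_i (D, X_i)`. -/
def hatX (P : Problem I M K n) (τ : ℝ) (i : Fin I) (D : Mat M K) (X : Mat K (n i)) :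
    Mat K (n i) :=
  argmin (P.setX i) (fun X' =>
    inner ℝ (P.gradX i D X) (X' - X) + τ / 2 * ‖X' - X‖ ^ 2 + P.g i X')

/-- The merit function `Δ_D`. -/
def meritD (P : Problem I M K n) (τ : ℝ) (D : Mat M K) (X : ∀ i, Mat K (n i)) : ℝ :=
  maxNorm (hatD P τ D X - D)

/-- The merit function `Δ_X`; the maximum over `i` is the `L_{∞,∞}` norm of the concatenation
of the blocks. -/
def meritX (P : Problem I M K n) (τ : ℝ) (D : Mat M K) (X : ∀ i, Mat K (n i)) : ℝ :=
  ⨆ i, maxNorm (hatX P τ i D (X i) - X i)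

end D4L

end

noncomputable section

namespace D4L

/-! ### Convexity and first-order tools on inner product spaces. -/

section ConvexAnalysis

variable {E : Type*} [NormedAddCommGroup E] [InnerProductSpace ℝ E]

/-! Everything rests on a potential that decreases up to summable errors. Column stochasticity makes
averages weighted by the push-sum masses `φ` invariant under communication (`sum_φ_smul_mixing`). So
`weightedD` moves only through the local updates, and the `φ`-weighted sum of the `Θ`s is exactly
the sum of the local gradients (`sum_φ_smul_Θ`). Hence `I • Θ` of any agent equals `∇_D F` up to the
disagreement among the agents (`RunBounds.tracking_le`). The potential is `F` at `weightedD`, plus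
the `g`-terms, plus the `φ`-average of the values of `G` at the agents' dictionaries. One iteration
lowers it by a multiple of `changeX` and of `γ * changeD`, at the price of errors of order `γ *
spread Θ`, `γ * spread D`, `γ ^ 2` and `(spread D) ^ 2` (`RunBounds.potential_succ_le`), apart from
one finite defect at the first iteration.

Disagreement is handled by one statement about perturbed consensus. In the row-stochastic form
`mixing`, products over `I` windows of length `B` have entries bounded away from zero, so they
contract the spread. The spread is therefore at most a geometric filter of the perturbations
(`exists_spread_le_geomFilter`), and such a filter maps square-summable sequences to square-summable
ones. For `D` the perturbation is of order `γ`. For `Θ` it also contains the change of the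
coefficients, which is not yet known to be summable; the resulting bound is relative to the sum of
`changeX`. Young's inequality with a small weight lets the decrease absorb that term, and then
`changeX`, `γ * changeD` and both squared spreads have bounded partial sums
(`RunBounds.exists_sum_bounds`).

The rates follow. The squared merit functions are bounded by these quantities, plus `γ ^ 2` in the
case of `X`, because the best responses `hatX`, `hatD` and the algorithm's own updates solve
neighbouring variational inequalities. If a weighted sum of squares stays below `Q`, then the total
weight before the first time the sequence is at most `ε` is at most `Q / ε ^ 2`; the weights are `1`
for `X` and `γ` for `D`. For the consensus error, the filter is split at time `⌈θ * ν⌉`: the past is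
geometrically small, and the later perturbations are at most a multiple of the step size at the
split.

A separate difficulty is that the coefficients must stay bounded when a feasible set is not compact.
With proximal weight at least half the Lipschitz constant, the forward gradient step is nonexpansive
along the feasible set (`inner_gradient_step_le`), and strong convexity of `g` then gives an
invariant ball (`exists_X_bound`). -/

lemma deriv_nonneg_of_eventually_le {φ : ℝ → ℝ} {d a : ℝ} (h : HasDerivAt φ d a)
    (hle : ∀ᶠ t in 𝓝[>] (0 : ℝ), φ a ≤ φ (a + t)) : 0 ≤ d := by
  refine ge_of_tendsto h.tendsto_slope_zero_right ?_
  filter_upwards [hle, self_mem_nhdsWithin] with t ht h0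
  have h0 : 0 < t := h0
  exact mul_nonneg (inv_nonneg.2 h0.le) (sub_nonneg.2 ht)

lemma eventually_mem_Ioc_zero_one : ∀ᶠ t in 𝓝[>] (0 : ℝ), 0 < t ∧ t ≤ 1 :=
  Ioc_mem_nhdsGT one_pos

/-- A strongly convex function on an open set grows quadratically, up to a linear term. -/
lemma _root_.StrongConvexOn.exists_le [FiniteDimensional ℝ E] {s : Set E} (hs : IsOpen s) {μ : ℝ}
    {g : E → ℝ} (hg : StrongConvexOn s μ g) {y : E} (hy : y ∈ s) :
    ∃ c : ℝ, 0 ≤ c ∧ ∀ x ∈ s, g y - c * ‖x - y‖ + μ / 2 * ‖x - y‖ ^ 2 ≤ g x := by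
  rw [strongConvexOn_iff_convex] at hg
  set k : E → ℝ := fun x => g x - μ / 2 * ‖x‖ ^ 2 with hk
  obtain ⟨K, t, ht, hKt⟩ := hg.locallyLipschitzOn hs hy
  have htn : t ∈ 𝓝 y := by rwa [hs.nhdsWithin_eq hy] at ht
  obtain ⟨r, hr, hrt⟩ := Metric.nhds_basis_closedBall.mem_iff.1 (inter_mem htn (hs.mem_nhds hy))
  have key : ∀ x ∈ s, k y - K * ‖x - y‖ ≤ k x := by
    intro x hx
    rcases eq_or_ne x y with rfl | hne
    · simp
    have hpos : 0 < ‖x - y‖ := norm_pos_iff.2 (sub_ne_zero.2 hne)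
    -- The point `y + l • (x - y)` stays in the ball where `k` is `K`-Lipschitz; convexity along the
    -- segment carries the slope bound from there out to `x`.
    obtain ⟨l, hl0, hl1, hlr⟩ : ∃ l : ℝ, 0 < l ∧ l ≤ 1 ∧ l * ‖x - y‖ ≤ r :=
      ⟨min 1 (r / ‖x - y‖), lt_min one_pos (div_pos hr hpos), min_le_left _ _,
        (le_div_iff₀ hpos).1 (min_le_right _ _)⟩
    have hz := hg.2 hy hx (sub_nonneg.2 hl1) hl0.le (by ring)
    have e : (1 - l) • y + l • x = y + l • (x - y) := by module
    have hn : ‖l • (x - y)‖ = l * ‖x - y‖ := by rw [norm_smul, Real.norm_of_nonneg hl0.le]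
    have hzt : y + l • (x - y) ∈ t := (hrt (by simpa [hn] using hlr)).1
    have hd := hKt.dist_le_mul _ hzt _ (mem_of_mem_nhds htn)
    rw [Real.dist_eq, dist_eq_norm, add_sub_cancel_left, hn] at hd
    rw [e] at hz
    simp only [smul_eq_mul] at hz
    have := neg_abs_le (k (y + l • (x - y)) - k y)
    have h3 : l * (k y - K * ‖x - y‖) ≤ l * k x := by
      simp only [hk] at *
      nlinarith
    exact le_of_mul_le_mul_left h3 hl0
  refine ⟨K + |μ| * ‖y‖, by positivity, fun x hx => ?_⟩
  have h1 := key x hx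
  have e : ‖x‖ ^ 2 = ‖x - y‖ ^ 2 + 2 * inner ℝ (x - y) y + ‖y‖ ^ 2 := by
    rw [← norm_add_sq_real, sub_add_cancel]
  have h2 : -(|μ| * (‖x - y‖ * ‖y‖)) ≤ μ * inner ℝ (x - y) y := by
    have := abs_real_inner_le_norm (x - y) y
    have h3 := neg_abs_le (μ * inner ℝ (x - y) y)
    rw [abs_mul] at h3
    nlinarith [abs_nonneg μ]
  simp only [hk, e] at h1
  nlinarith

/-- A proximal subproblem with a convex term on an open set has a solution. -/
lemma exists_isArgmin_prox [FiniteDimensional ℝ E] {s O : Set E} (hs : IsClosed s) (hO : IsOpen O)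
    (hsO : s ⊆ O) {g : E → ℝ} (hg : ConvexOn ℝ O g) {τ : ℝ} (hτ : 0 < τ) (c : E) {x₀ : E}
    (hx₀ : x₀ ∈ s) :
    ∃ x, IsArgmin s (fun x => inner ℝ c (x - x₀) + τ / 2 * ‖x - x₀‖ ^ 2 + g x) x := by
  have hcont : ContinuousOn (fun x => inner ℝ c (x - x₀) + τ / 2 * ‖x - x₀‖ ^ 2 + g x) s := by
    refine ContinuousOn.add (by fun_prop) ((hg.continuousOn hO).mono hsO)
  obtain ⟨b, hb, hb'⟩ := (strongConvexOn_zero.2 hg).exists_le hO (hsO hx₀)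
  refine hcont.exists_isMinOn' hs hx₀ ?_
  rw [eventually_inf_principal]
  -- Beyond this radius the quadratic term dominates both linear ones, with coefficients `‖c‖` and
  -- `b`, so the objective exceeds its value at `x₀`.
  have := (tendsto_norm_cocompact_atTop (E := E)).eventually
    (eventually_ge_atTop (‖x₀‖ + 2 * (‖c‖ + b) / τ))
  filter_upwards [this] with x hx hxs
  have h1 := hb' x (hsO hxs)
  have h2 := abs_le.1 (abs_real_inner_le_norm c (x - x₀))
  have h3 : 2 * (‖c‖ + b) / τ ≤ ‖x - x₀‖ := by linarith [norm_sub_norm_le x x₀]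
  rw [div_le_iff₀ hτ] at h3
  simp only [sub_self, inner_zero_right, norm_zero]
  nlinarith [norm_nonneg (x - x₀)]

variable [CompleteSpace E]

lemma hasDerivAt_line {h : E → ℝ} {h' x v : E} {t : ℝ} (hh : HasGradientAt h h' (x + t • v)) :
    HasDerivAt (fun s : ℝ => h (x + s • v)) (inner ℝ h' v) t := by
  have h1 : HasDerivAt (fun s : ℝ => x + s • v) v t := by
    simpa using ((hasDerivAt_id t).smul_const v).const_add x
  have := hh.hasFDerivAt.comp_hasDerivAt t h1
  simpa [Function.comp_def] using this

/-- The gap between the chord and the function vanishes at the left end and is nonnegative just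
after it, so its derivative there is nonnegative. -/
lemma _root_.ConvexOn.inner_gradient_le {s : Set E} {h : E → ℝ} {x y h' : E}
    (hc : ConvexOn ℝ s h) (hx : x ∈ s) (hy : y ∈ s) (hh : HasGradientAt h h' x) :
    inner ℝ h' (y - x) ≤ h y - h x := by
  have h1 : HasDerivAt (fun t : ℝ => t * (h y - h x) - h (x + t • (y - x)))
      ((h y - h x) - inner ℝ h' (y - x)) 0 := by
    have := hasDerivAt_line (x := x) (v := y - x) (t := 0) (h := h) (h' := h') (by simpa using hh)
    simpa using ((hasDerivAt_id (0 : ℝ)).mul_const (h y - h x)).fun_sub this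
  have := deriv_nonneg_of_eventually_le h1 (by
    filter_upwards [eventually_mem_Ioc_zero_one] with t ht
    have := hc.2 hx hy (sub_nonneg.2 ht.2) ht.1.le (by ring)
    have e : x + t • (y - x) = (1 - t) • x + t • y := by module
    simp only [zero_add, e, zero_smul, add_zero, smul_eq_mul, zero_mul] at this ⊢
    linarith)
  linarith

/-- First-order optimality for the sum of a differentiable and a convex function. -/
lemma _root_.IsMinOn.variational_inequality {s : Set E} {h g : E → ℝ} {x y h' : E}
    (hmin : IsMinOn (fun z => h z + g z) s x) (hg : ConvexOn ℝ s g) (hx : x ∈ s) (hy : y ∈ s)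
    (hh : HasGradientAt h h' x) : 0 ≤ inner ℝ h' (y - x) + (g y - g x) := by
  -- The convex term is replaced by its chord, an upper bound that is exact at `t = 0`; no
  -- differentiability of `g` is needed.
  have h1 : HasDerivAt (fun t : ℝ => h (x + t • (y - x)) + t * (g y - g x))
      (inner ℝ h' (y - x) + (g y - g x)) 0 := by
    have := hasDerivAt_line (x := x) (v := y - x) (t := 0) (h := h) (h' := h') (by simpa using hh)
    simpa using this.fun_add ((hasDerivAt_id (0 : ℝ)).mul_const (g y - g x))
  refine deriv_nonneg_of_eventually_le h1 ?_
  filter_upwards [eventually_mem_Ioc_zero_one] with t ht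
  have hc := hg.2 hx hy (sub_nonneg.2 ht.2) ht.1.le (by ring)
  have e : x + t • (y - x) = (1 - t) • x + t • y := by module
  have hm : (1 - t) • x + t • y ∈ s := hg.1 hx hy (sub_nonneg.2 ht.2) ht.1.le (by ring)
  have := hmin hm
  simp only [Set.mem_ofPred_eq, zero_add, e, zero_smul, add_zero, smul_eq_mul, zero_mul] at this hc ⊢
  linarith

/-- The descent lemma. -/
lemma _root_.Convex.descent {s : Set E} (hs : Convex ℝ s) {h : E → ℝ} {h' : E → E} {L : ℝ}
    {x y : E} (hh : ∀ z ∈ s, HasGradientAt h (h' z) z) (hL : ∀ z ∈ s, ‖h' z - h' x‖ ≤ L * ‖z - x‖)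
    (hx : x ∈ s) (hy : y ∈ s) :
    h y ≤ h x + inner ℝ (h' x) (y - x) + L / 2 * ‖y - x‖ ^ 2 := by
  set v := y - x with hv
  have hmem : ∀ t ∈ Set.Icc (0 : ℝ) 1, x + t • v ∈ s := fun t ht => by
    have := hs hx hy (sub_nonneg.2 ht.2) ht.1 (by ring)
    convert this using 1
    rw [hv]; module
  -- With the linear and quadratic terms of the claim subtracted, the function is antitone along the
  -- segment; comparing the endpoints gives the inequality.
  have hd : ∀ t ∈ Set.Icc (0 : ℝ) 1, HasDerivAt
      (fun t : ℝ => h (x + t • v) - t * inner ℝ (h' x) v - L / 2 * t ^ 2 * ‖v‖ ^ 2)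
      (inner ℝ (h' (x + t • v)) v - inner ℝ (h' x) v - L * t * ‖v‖ ^ 2) t := fun t ht => by
    have h1 := hasDerivAt_line (hh _ (hmem t ht))
    have h2 := (hasDerivAt_id t).mul_const (inner ℝ (h' x) v)
    have h3 := (((hasDerivAt_id t).fun_pow 2).const_mul (L / 2)).mul_const (‖v‖ ^ 2)
    refine ((h1.fun_sub h2).fun_sub h3).congr_deriv ?_
    simp only [id]; ring
  have ha : AntitoneOn
      (fun t : ℝ => h (x + t • v) - t * inner ℝ (h' x) v - L / 2 * t ^ 2 * ‖v‖ ^ 2)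
      (Set.Icc 0 1) := by
    refine antitoneOn_of_deriv_nonpos (convex_Icc 0 1)
      (fun t ht => (hd t ht).continuousAt.continuousWithinAt)
      (fun t ht => (hd t (interior_subset ht)).differentiableAt.differentiableWithinAt) ?_
    intro t ht
    have ht := interior_subset ht
    rw [(hd t ht).deriv, ← inner_sub_left]
    have h1 := real_inner_le_norm (h' (x + t • v) - h' x) v
    have h2 := hL _ (hmem t ht)
    rw [add_sub_cancel_left, norm_smul, Real.norm_of_nonneg ht.1] at h2
    nlinarith [norm_nonneg v]
  have := ha (Set.left_mem_Icc.2 zero_le_one) (Set.right_mem_Icc.2 zero_le_one) zero_le_one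
  simp only [one_smul, zero_smul, add_zero, hv, add_sub_cancel, one_mul, zero_mul] at this ⊢
  norm_num at this
  linarith

/-- A uniformly bounded gradient makes a function Lipschitz on a convex set. -/
lemma _root_.Convex.abs_sub_le_of_gradient {s : Set E} (hs : Convex ℝ s) {h : E → ℝ} {h' : E → E}
    {C : ℝ} (hh : ∀ z ∈ s, HasGradientAt h (h' z) z) (hC : ∀ z ∈ s, ‖h' z‖ ≤ C) {x y : E}
    (hx : x ∈ s) (hy : y ∈ s) : |h y - h x| ≤ C * ‖y - x‖ :=
  hs.norm_image_sub_le_of_norm_hasFDerivWithin_le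
    (fun z hz => (hh z hz).hasFDerivAt.hasFDerivWithinAt) (fun z hz => by simpa using hC z hz) hx hy

end ConvexAnalysis

/-! ### Nonexpansiveness of the forward gradient step. -/

section ForwardStep

variable {E : Type*} [NormedAddCommGroup E] [InnerProductSpace ℝ E]

/-- Polarization for a symmetric form that is bounded between `0` and `2 τ` on a plane. -/
lemma sub_bilinear_le_of_quadratic (B : E →L[ℝ] E →L[ℝ] ℝ) {τ : ℝ} {v w : E}
    (hsymm : B v w = B w v) (h0 : ∀ a b : ℝ, 0 ≤ B (a • v + b • w) (a • v + b • w))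
    (h1 : ∀ a b : ℝ, B (a • v + b • w) (a • v + b • w) ≤ 2 * τ * ‖a • v + b • w‖ ^ 2) :
    τ * inner ℝ v w - B v w ≤ τ * (‖v‖ * ‖w‖) := by
  rcases eq_or_ne v 0 with rfl | hv
  · simp
  rcases eq_or_ne w 0 with rfl | hw
  · simp
  have hvp := norm_pos_iff.2 hv
  have hwp := norm_pos_iff.2 hw
  have exp : ∀ a b : ℝ, ‖a • v + b • w‖ ^ 2
      = a ^ 2 * ‖v‖ ^ 2 + 2 * (a * b * inner ℝ v w) + b ^ 2 * ‖w‖ ^ 2 := fun a b => by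
    rw [norm_add_sq_real, norm_smul, norm_smul, real_inner_smul_left, real_inner_smul_right,
      mul_pow, mul_pow, Real.norm_eq_abs, Real.norm_eq_abs, sq_abs, sq_abs, mul_assoc a b]
  -- The coefficients give both vectors the same length. In the difference of the two bounds the
  -- diagonal terms `B v v` and `B w w` cancel.
  have p0 := h0 ‖w‖ ‖v‖
  have p1 := h1 ‖w‖ (-‖v‖)
  rw [exp] at p1
  simp only [map_add, map_smul, add_apply, smul_apply,
    smul_eq_mul, hsymm] at p0 p1
  have hpos := mul_pos hvp hwp
  have : (‖v‖ * ‖w‖) * (τ * inner ℝ v w - B v w) ≤ (‖v‖ * ‖w‖) * (τ * (‖v‖ * ‖w‖)) := by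
    rw [hsymm]
    nlinarith
  exact le_of_mul_le_mul_left this hpos

variable [CompleteSpace E]

/-- The forward step `z ↦ z - τ⁻¹ • ∇ h z` of a convex `C²` function whose gradient is
`2 τ`-Lipschitz on a convex set (which may have empty interior) is nonexpansive in the directions
of that set. -/
lemma inner_gradient_step_le {O s : Set E} (hO : IsOpen O) (hsO : s ⊆ O) (hs : Convex ℝ s)
    {h : E → ℝ} (hh : ContDiffOn ℝ 2 h O) (hc : ConvexOn ℝ O h) {L τ : ℝ}
    (hL : ∀ z ∈ s, ∀ z' ∈ s, ‖gradient h z - gradient h z'‖ ≤ L * ‖z - z'‖) (hτ : L ≤ 2 * τ)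
    {x y p : E} (hx : x ∈ s) (hy : y ∈ s) (hp : p ∈ s) :
    inner ℝ (τ • (x - y) - (gradient h x - gradient h y)) (p - y) ≤
      τ * (‖x - y‖ * ‖p - y‖) := by
  have hCD : ∀ z ∈ O, ContDiffAt ℝ 2 h z := fun z hz => hh.contDiffAt (hO.mem_nhds hz)
  have hgrad : ∀ z ∈ O, HasGradientAt h (gradient h z) z := fun z hz =>
    ((hCD z hz).differentiableAt (by norm_num)).hasGradientAt
  have hCD1 : ∀ z ∈ O, ContDiffAt ℝ 1 (fderiv ℝ h) z := fun z hz =>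
    (hCD z hz).fderiv_right (by norm_num)
  set H : E → E →L[ℝ] E →L[ℝ] ℝ := fun z => fderiv ℝ (fderiv ℝ h) z with hH
  have hHcont : ∀ z ∈ O, ContinuousAt H z := fun z hz =>
    ((hCD1 z hz).fderiv_right (m := 0) (by norm_num)).continuousAt
  have hline : ∀ (z u w : E) (t : ℝ), z + t • u ∈ O →
      HasDerivAt (fun t : ℝ => fderiv ℝ h (z + t • u) w) (H (z + t • u) u w) t := by
    intro z u w t hz
    have h1 : HasDerivAt (fun s : ℝ => z + s • u) u t := by
      simpa using ((hasDerivAt_id t).smul_const u).const_add z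
    have h2 := ((hCD1 _ hz).differentiableAt (by norm_num)).hasFDerivAt.comp_hasDerivAt t h1
    simpa [Function.comp_def] using h2.clm_apply (hasDerivAt_const t w)
  have hnonneg : ∀ z ∈ O, ∀ u, 0 ≤ H z u u := by
    intro z hz u
    have h1 := hline z u u 0 (by simpa using hz)
    simp only [zero_smul, add_zero] at h1
    refine deriv_nonneg_of_eventually_le h1 ?_
    have hcont : ContinuousAt (fun t : ℝ => z + t • u) 0 := by fun_prop
    have hmem : ∀ᶠ t in 𝓝[>] (0 : ℝ), z + t • u ∈ O :=
      (hcont.eventually_mem (hO.mem_nhds (by simpa using hz))).filter_mono nhdsWithin_le_nhds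
    filter_upwards [hmem, self_mem_nhdsWithin] with t ht ht0
    have ht0 : 0 < t := ht0
    have m1 := hc.inner_gradient_le hz ht (hgrad z hz)
    have m2 := hc.inner_gradient_le ht hz (hgrad _ ht)
    rw [add_sub_cancel_left, inner_smul_right, inner_gradient_left] at m1
    rw [sub_add_cancel_left, inner_neg_right, inner_smul_right, inner_gradient_left] at m2
    simp only [zero_smul, add_zero, zero_add]
    nlinarith
  have hupper : ∀ z ∈ s, ∀ u, (∀ᶠ t in 𝓝[>] (0 : ℝ), z + t • u ∈ s) →
      H z u u ≤ L * ‖u‖ ^ 2 := by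
    intro z hz u hu
    have h1 := hline z u u 0 (by simpa using hsO hz)
    have h2 := ((hasDerivAt_id (0 : ℝ)).const_mul (L * ‖u‖ ^ 2)).fun_sub h1
    simp only [zero_smul, add_zero, mul_one] at h2
    refine sub_nonneg.1 (deriv_nonneg_of_eventually_le h2 ?_)
    filter_upwards [hu, self_mem_nhdsWithin] with t ht ht0
    have ht0 : 0 < t := ht0
    have h3 := hL _ ht _ hz
    rw [add_sub_cancel_left, norm_smul, Real.norm_of_nonneg ht0.le] at h3
    have h4 := real_inner_le_norm (gradient h (z + t • u) - gradient h z) u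
    rw [inner_sub_left, inner_gradient_left, inner_gradient_left] at h4
    simp only [zero_smul, add_zero, zero_add, id]
    nlinarith [norm_nonneg u]
  set v := x - y with hv
  set w := p - y with hw
  have hbary : ∀ a b : ℝ, 0 ≤ a → 0 ≤ b → a + b ≤ 1 → y + (a • v + b • w) ∈ s := by
    intro a b ha hb hab
    have : y + (a • v + b • w) = (1 - a - b) • y + a • x + b • p := by
      rw [hv, hw]; module
    rw [this]
    have := hs.sum_mem (t := Finset.univ) (w := ![1 - a - b, a, b]) (z := ![y, x, p])
      (by intro i _; fin_cases i <;> simp <;> linarith) (by simp [Fin.sum_univ_three]; ring)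
      (by intro i _; fin_cases i <;> simp [*])
    simpa [Fin.sum_univ_three] using this
  -- The Lipschitz bound controls the second derivative only in directions that stay in `s`, and at
  -- a point of the edge from `y` to `x` not all combinations of `v` and `w` do. At `y + (1 - d) * t
  -- • v + d • w`, where all three barycentric weights in the triangle `y, x, p` are positive, they
  -- all do; the edge is reached by continuity as `d → 0`.
  have hedge : ∀ t ∈ Set.Ioo (0 : ℝ) 1, ∀ a b : ℝ,
      H (y + t • v) (a • v + b • w) (a • v + b • w) ≤ L * ‖a • v + b • w‖ ^ 2 := by
    intro t ht a b
    set u := a • v + b • w with hu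
    have htO : y + t • v ∈ O := hsO (by simpa using hbary t 0 ht.1.le le_rfl (by linarith [ht.2]))
    have hpath : ContinuousAt (fun d : ℝ => y + (((1 - d) * t) • v + d • w)) 0 := by fun_prop
    have hlim : Tendsto (fun d : ℝ => H (y + (((1 - d) * t) • v + d • w)) u u) (𝓝[>] 0)
        (𝓝 (H (y + t • v) u u)) := by
      have h1 : ContinuousAt (fun d : ℝ => H (y + (((1 - d) * t) • v + d • w))) 0 :=
        ContinuousAt.comp (g := H) (hHcont _ (by simpa using htO)) hpath
      have h2 := (h1.clm_apply (continuousAt_const (y := u))).clm_apply (continuousAt_const (y := u))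
      have h3 := h2.tendsto.mono_left (nhdsWithin_le_nhds (s := Set.Ioi (0 : ℝ)))
      simpa using h3
    refine le_of_tendsto hlim ?_
    filter_upwards [Ioo_mem_nhdsGT (one_pos (α := ℝ))] with d hd
    have hd0 : 0 < (1 - d) * t := mul_pos (by linarith [hd.2]) ht.1
    have hd1 : (1 - d) * t + d < 1 := by nlinarith [hd.1, hd.2, ht.1, ht.2]
    refine hupper _ (hbary _ _ hd0.le hd.1.le hd1.le) u ?_
    have e1 : ∀ᶠ r in 𝓝 (0 : ℝ), 0 < (1 - d) * t + r * a :=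
      continuousAt_const.eventually_lt (f := fun _ => (0 : ℝ)) (by fun_prop) (by simpa using hd0)
    have e2 : ∀ᶠ r in 𝓝 (0 : ℝ), 0 < d + r * b :=
      continuousAt_const.eventually_lt (f := fun _ => (0 : ℝ)) (by fun_prop) (by simpa using hd.1)
    have e3 : ∀ᶠ r in 𝓝 (0 : ℝ), ((1 - d) * t + r * a) + (d + r * b) < 1 :=
      ContinuousAt.eventually_lt (by fun_prop) continuousAt_const (by simpa using hd1)
    filter_upwards [(e1.and (e2.and e3)).filter_mono nhdsWithin_le_nhds] with r hr
    have := hbary _ _ hr.1.le hr.2.1.le hr.2.2.le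
    convert this using 1
    rw [hu]; module
  have hxv : y + (1 : ℝ) • v = x := by rw [hv]; module
  have hseg : ∀ t ∈ Set.Icc (0 : ℝ) 1, y + t • v ∈ O := fun t ht =>
    hsO (by simpa using hbary t 0 ht.1 le_rfl (by linarith [ht.2]))
  -- The mean value theorem turns the gradient difference, tested against `w`, into a single value
  -- `H z v w` on the edge, to which polarization applies.
  obtain ⟨t, ht, hmv⟩ := exists_hasDerivAt_eq_slope (fun t : ℝ => fderiv ℝ h (y + t • v) w)
    (fun t => H (y + t • v) v w) zero_lt_one
    (fun t ht => (hline y v w t (hseg t ht)).continuousAt.continuousWithinAt)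
    (fun t ht => hline y v w t (hseg t (Set.Ioo_subset_Icc_self ht)))
  have htO : y + t • v ∈ O := hseg t (Set.Ioo_subset_Icc_self ht)
  simp only [hxv, zero_smul, add_zero, sub_zero, div_one] at hmv
  have hpol := sub_bilinear_le_of_quadratic (H (y + t • v)) (τ := τ) (v := v) (w := w)
    (((hCD _ htO).isSymmSndFDerivAt (by simp)).eq v w)
    (fun a b => hnonneg _ htO _)
    (fun a b => (hedge t ht a b).trans (by gcongr))
  rw [inner_sub_left, inner_sub_left, real_inner_smul_left, inner_gradient_left,
    inner_gradient_left, ← hmv]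
  exact hpol

end ForwardStep

/-! ### Spread of a family under row-stochastic matrices. -/

section Consensus

variable {ι : Type*} [Fintype ι] {E : Type*} [NormedAddCommGroup E]

/-- The largest distance between two members of a family. -/
def spread (x : ι → E) : ℝ := ‖fun p : ι × ι => x p.1 - x p.2‖

lemma spread_nonneg (x : ι → E) : 0 ≤ spread x := norm_nonneg _

lemma norm_sub_le_spread (x : ι → E) (i j : ι) : ‖x i - x j‖ ≤ spread x :=
  norm_le_pi_norm (fun p : ι × ι => x p.1 - x p.2) (i, j)

lemma spread_le {x : ι → E} {r : ℝ} (hr : 0 ≤ r) (h : ∀ i j, ‖x i - x j‖ ≤ r) : spread x ≤ r :=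
  (pi_norm_le_iff_of_nonneg hr).2 fun p => h p.1 p.2

lemma spread_le_two_mul {x : ι → E} {r : ℝ} (hr : 0 ≤ r) (h : ∀ i, ‖x i‖ ≤ r) :
    spread x ≤ 2 * r :=
  spread_le (by positivity) fun i j => (norm_sub_le _ _).trans (by linarith [h i, h j])

lemma spread_add_le (x y : ι → E) : spread (x + y) ≤ spread x + spread y :=
  spread_le (add_nonneg (spread_nonneg _) (spread_nonneg _)) fun i j => by
    have : (x + y) i - (x + y) j = (x i - x j) + (y i - y j) := by simp only [Pi.add_apply]; abel
    rw [this]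
    exact (norm_add_le _ _).trans (add_le_add (norm_sub_le_spread x i j) (norm_sub_le_spread y i j))

variable [NormedSpace ℝ E]

/-- Product coupling: `σ` times the difference equals the double sum of `(p i * q j) • (x i - x j)`,
whose total weight is `σ ^ 2`. -/
lemma norm_sum_smul_sub_sum_smul_le {p q : ι → ℝ} {σ R : ℝ} {x : ι → E} (hp : ∀ i, 0 ≤ p i)
    (hq : ∀ i, 0 ≤ q i) (hpσ : ∑ i, p i = σ) (hqσ : ∑ i, q i = σ)
    (hx : ∀ i j, ‖x i - x j‖ ≤ R) : ‖∑ i, p i • x i - ∑ i, q i • x i‖ ≤ σ * R := by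
  have hσ : 0 ≤ σ := hpσ ▸ Finset.sum_nonneg fun i _ => hp i
  rcases hσ.eq_or_lt with h0 | hpos
  · have h1 : ∀ i, p i = 0 := fun i =>
      (Finset.sum_eq_zero_iff_of_nonneg fun i _ => hp i).1 (hpσ.trans h0.symm) i (Finset.mem_univ i)
    have h2 : ∀ i, q i = 0 := fun i =>
      (Finset.sum_eq_zero_iff_of_nonneg fun i _ => hq i).1 (hqσ.trans h0.symm) i (Finset.mem_univ i)
    simp [h1, h2, ← h0]
  · have e : σ • (∑ i, p i • x i - ∑ i, q i • x i) = ∑ i, ∑ j, (p i * q j) • (x i - x j) := by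
      simp only [smul_sub, Finset.sum_sub_distrib]
      congr 1
      · rw [Finset.smul_sum]
        refine Finset.sum_congr rfl fun i _ => ?_
        rw [← Finset.sum_smul, ← Finset.mul_sum, hqσ, smul_smul, mul_comm]
      · rw [Finset.sum_comm, Finset.smul_sum]
        refine Finset.sum_congr rfl fun i _ => ?_
        rw [← Finset.sum_smul, ← Finset.sum_mul, hpσ, smul_smul]
    have hle : σ * ‖∑ i, p i • x i - ∑ i, q i • x i‖ ≤ σ * (σ * R) := by
      calc σ * ‖∑ i, p i • x i - ∑ i, q i • x i‖
          = ‖∑ i, ∑ j, (p i * q j) • (x i - x j)‖ := by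
            rw [← e, norm_smul, Real.norm_of_nonneg hσ]
        _ ≤ ∑ i, ∑ j, p i * q j * R := by
            refine norm_sum_le_of_le _ fun i _ => norm_sum_le_of_le _ fun j _ => ?_
            rw [norm_smul, Real.norm_of_nonneg (mul_nonneg (hp i) (hq j))]
            exact mul_le_mul_of_nonneg_left (hx i j) (mul_nonneg (hp i) (hq j))
        _ = σ * (σ * R) := by
            simp only [← Finset.sum_mul, ← Finset.mul_sum, hpσ, hqσ]; ring
    exact le_of_mul_le_mul_left hle hpos

/-- A point is at most `R` away from an average of points that are `R`-close to it. -/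
lemma norm_sub_average_le {p : ι → ℝ} {R : ℝ} {x : ι → E} {z : E} (hp : ∀ i, 0 ≤ p i)
    (hpσ : ∑ i, p i = 1) (hx : ∀ i, ‖z - x i‖ ≤ R) : ‖z - ∑ i, p i • x i‖ ≤ R := by
  have e : z - ∑ i, p i • x i = ∑ i, p i • (z - x i) := by
    simp only [smul_sub, Finset.sum_sub_distrib, ← Finset.sum_smul, hpσ, one_smul]
  rw [e]
  calc ‖∑ i, p i • (z - x i)‖ ≤ ∑ i, p i * R := norm_sum_le_of_le _ fun i _ => by
        rw [norm_smul, Real.norm_of_nonneg (hp i)]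
        exact mul_le_mul_of_nonneg_left (hx i) (hp i)
    _ = R := by rw [← Finset.sum_mul, hpσ, one_mul]

/-- The action of a matrix of scalars on a family of vectors. -/
def act (P : Matrix ι ι ℝ) (x : ι → E) : ι → E := fun i => ∑ j, P i j • x j

lemma act_mul (P Q : Matrix ι ι ℝ) (x : ι → E) : act (P * Q) x = act P (act Q x) := by
  funext i
  simp only [act, Matrix.mul_apply, Finset.sum_smul, Finset.smul_sum, smul_smul]
  exact Finset.sum_comm

lemma act_add (P : Matrix ι ι ℝ) (x y : ι → E) : act P (x + y) = act P x + act P y := by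
  funext i
  simp [act, smul_add, Finset.sum_add_distrib]

lemma act_one [DecidableEq ι] (x : ι → E) : act (1 : Matrix ι ι ℝ) x = x := by
  funext i
  simp [act, Matrix.one_apply]

/-- Dobrushin's argument: any two rows share mass `β` in every column. This common part cancels in
the difference and leaves mass `1 - card * β` to be compared. The case `β = 0` is nonexpansiveness.
-/
lemma spread_act_le {P : Matrix ι ι ℝ} {β : ℝ} (hβ : ∀ i j, β ≤ P i j) (hP : ∀ i, ∑ j, P i j = 1)
    (hc : Fintype.card ι * β ≤ 1) (x : ι → E) :
    spread (act P x) ≤ (1 - Fintype.card ι * β) * spread x := by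
  refine spread_le (mul_nonneg (sub_nonneg.2 hc) (spread_nonneg x)) fun i j => ?_
  have h := norm_sum_smul_sub_sum_smul_le (x := x) (p := fun k => P i k - β)
    (q := fun k => P j k - β) (σ := 1 - Fintype.card ι * β) (fun k => sub_nonneg.2 (hβ i k))
    (fun k => sub_nonneg.2 (hβ j k)) (by simp [Finset.sum_sub_distrib, hP])
    (by simp [Finset.sum_sub_distrib, hP]) (norm_sub_le_spread x)
  simpa only [act, sub_smul, Finset.sum_sub_distrib, sub_sub_sub_cancel_right] using h

variable [DecidableEq ι]

/-- The product `M (s + t - 1) * ⋯ * M s`. -/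
def transition (M : ℕ → Matrix ι ι ℝ) (s : ℕ) : ℕ → Matrix ι ι ℝ
  | 0 => 1
  | t + 1 => M (s + t) * transition M s t

lemma transition_nonneg {M : ℕ → Matrix ι ι ℝ} (h : ∀ ν i j, 0 ≤ M ν i j) (s t : ℕ) (i j : ι) :
    0 ≤ transition M s t i j := by
  induction t generalizing i with
  | zero => simp only [transition, Matrix.one_apply]; split <;> norm_num
  | succ t ih =>
    rw [transition, Matrix.mul_apply]
    exact Finset.sum_nonneg fun k _ => mul_nonneg (h _ _ _) (ih k)

lemma transition_row_sum {M : ℕ → Matrix ι ι ℝ} (h : ∀ ν i, ∑ j, M ν i j = 1) (s t : ℕ) (i : ι) :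
    ∑ j, transition M s t i j = 1 := by
  induction t generalizing i with
  | zero => simp [transition, Matrix.one_apply]
  | succ t ih =>
    simp only [transition, Matrix.mul_apply]
    rw [Finset.sum_comm]
    simp only [← Finset.mul_sum, ih, mul_one, h]

lemma act_transition {M : ℕ → Matrix ι ι ℝ} {x : ℕ → ι → E} (hx : ∀ ν, x (ν + 1) = act (M ν) (x ν))
    (s t : ℕ) : x (s + t) = act (transition M s t) (x s) := by
  induction t with
  | zero => simp [transition, act_one]
  | succ t ih => rw [← add_assoc, hx, ih, transition, act_mul]

/-- Each perturbation is transported by later stochastic matrices, which do not enlarge its spread,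
so the contributions simply add up. -/
lemma exists_act_transition_add {M : ℕ → Matrix ι ι ℝ} (hM : ∀ ν i j, 0 ≤ M ν i j)
    (hM1 : ∀ ν i, ∑ j, M ν i j = 1) {x v : ℕ → ι → E}
    (hx : ∀ ν, x (ν + 1) = act (M ν) (x ν) + v ν) (s t : ℕ) :
    ∃ y, x (s + t) = act (transition M s t) (x s) + y ∧
      spread y ≤ ∑ r ∈ Finset.range t, spread (v (s + r)) := by
  induction t with
  | zero => exact ⟨0, by simp [transition, act_one], by simp [spread, ← Pi.zero_def]⟩
  | succ t ih =>
    obtain ⟨y, h1, h2⟩ := ih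
    refine ⟨act (M (s + t)) y + v (s + t), ?_, ?_⟩
    · rw [← add_assoc, hx, h1, act_add, transition, act_mul, add_assoc]
    · rw [Finset.sum_range_succ]
      have h3 := spread_act_le (β := 0) (hM (s + t)) (hM1 (s + t)) (by simp) y
      refine (spread_add_le _ _).trans (add_le_add_left (h3.trans ?_) _)
      simpa using h2

end Consensus

/-! ### Positivity of long products from window-wise strong connectivity. -/

section Connectivity

variable {I : ℕ}

/-- Over `I` consecutive windows of length `B` the product of the matrices becomes positive. -/
lemma pow_le_transition {Ed : DigraphSeq I} {B : ℕ} (hconn : StronglyConnected Ed B)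
    {M : ℕ → Matrix (Fin I) (Fin I) ℝ} {κ : ℝ} (hκ : 0 < κ)
    (hM : ∀ ν i j, 0 ≤ M ν i j) (hdiag : ∀ ν i, κ ≤ M ν i i)
    (hedge : ∀ ν i j, Ed ν j i → κ ≤ M ν i j) (k : ℕ) (i j : Fin I) :
    κ ^ (I * B) ≤ transition M (k * B) (I * B) i j := by
  classical
  -- The nodes that information from `j` reaches in `t` steps with weight at least `κ ^ t`; the
  -- diagonal weights make this set monotone in `t`.
  set S : ℕ → Finset (Fin I) := fun t => {i | κ ^ t ≤ transition M (k * B) t i j} with hS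
  have hstep : ∀ t a b, a ∈ S t → κ ≤ M (k * B + t) b a → b ∈ S (t + 1) := by
    intro t a b ha hab
    simp only [hS, Finset.mem_filter, Finset.mem_univ, true_and] at ha ⊢
    rw [transition, Matrix.mul_apply, pow_succ']
    refine (mul_le_mul hab ha (by positivity) (hM _ _ _)).trans
      (Finset.single_le_sum (f := fun l => M (k * B + t) b l * transition M (k * B) t l j)
        (fun l _ => mul_nonneg (hM _ _ _) (transition_nonneg hM _ _ _ _)) (Finset.mem_univ a))
  have hmono : Monotone S := monotone_nat_of_le_succ fun t a ha => hstep t a a ha (hdiag _ _)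
  have hj : ∀ t, j ∈ S t := fun t => hmono (Nat.zero_le t) (by simp [hS, transition])
  have hgrow : ∀ r : ℕ, r + 1 ≤ (S (r * B)).card ∨ S (r * B) = Finset.univ := by
    intro r
    induction r with
    | zero => exact Or.inl (Finset.card_pos.2 ⟨j, by simpa using hj 0⟩)
    | succ r ih =>
      have hle : S (r * B) ⊆ S ((r + 1) * B) := hmono (Nat.mul_le_mul_right _ (Nat.le_succ r))
      rcases ih with ih | ih
      · by_cases hu : S (r * B) = Finset.univ
        · exact Or.inr (Finset.univ_subset_iff.1 (hu ▸ hle))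
        obtain ⟨l, hl⟩ : ∃ l, l ∉ S (r * B) := by
          by_contra! hall
          exact hu (Finset.eq_univ_iff_forall.2 hall)
        -- If no edge of the window left the set, every path from `j` would stay inside, although
        -- some path ends at `l` outside. Thus each window adds a node until the set is full.
        obtain ⟨a, b, ⟨t, ht1, ht2, hab⟩, ha, hb⟩ : ∃ a b,
            (∃ t, (k + r) * B ≤ t ∧ t < (k + r + 1) * B ∧ Ed t a b) ∧
              a ∈ S (r * B) ∧ b ∉ S (r * B) := by
          by_contra! hall
          have := hconn (k + r) j l
          clear hu
          revert hl
          refine not_not.2 ?_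
          induction this with
          | refl => exact hj _
          | tail _ hab ih => exact hall _ _ hab ih
        obtain ⟨d, rfl⟩ : ∃ d, t = k * B + d :=
          Nat.exists_eq_add_of_le (by nlinarith)
        have hd1 : r * B ≤ d := by nlinarith
        have hd2 : d + 1 ≤ (r + 1) * B := by nlinarith
        have hbS : b ∈ S ((r + 1) * B) :=
          hmono hd2 (hstep d a b (hmono hd1 ha) (hedge _ _ _ hab))
        refine Or.inl (lt_of_le_of_lt ih (Finset.card_lt_card ?_))
        exact (Finset.ssubset_iff_of_subset hle).2 ⟨b, hbS, hb⟩
      · exact Or.inr (Finset.univ_subset_iff.1 (ih ▸ hle))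
  have huniv : S (I * B) = Finset.univ := by
    rcases hgrow I with h | h
    · have := (S (I * B)).card_le_univ
      rw [Fintype.card_fin] at this
      omega
    · exact h
  have : i ∈ S (I * B) := huniv ▸ Finset.mem_univ i
  simpa [hS] using this

/-- Mass bound for the push-sum weights. -/
lemma exists_pos_le_pushSum (hI : 0 < I) {Ed : DigraphSeq I} {B : ℕ} (hB : 0 < B)
    (hconn : StronglyConnected Ed B)
    {M : ℕ → Matrix (Fin I) (Fin I) ℝ} {κ : ℝ} (hκ : 0 < κ) (hκ1 : κ ≤ 1)
    (hM : ∀ ν i j, 0 ≤ M ν i j) (hdiag : ∀ ν i, κ ≤ M ν i i)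
    (hedge : ∀ ν i j, Ed ν j i → κ ≤ M ν i j) {φ : ℕ → Fin I → ℝ} (h0 : ∀ i, φ 0 i = 1)
    (hφ : ∀ ν i, φ (ν + 1) i = ∑ j, M ν i j * φ ν j) (hsum : ∀ ν, ∑ i, φ ν i = I) :
    ∃ c : ℝ, 0 < c ∧ ∀ ν i, c ≤ φ ν i := by
  have hact : ∀ ν, φ (ν + 1) = act (M ν) (φ ν) := fun ν => by
    funext i; simp [act, hφ]
  have hnn : ∀ ν i, 0 ≤ φ ν i := by
    intro ν
    induction ν with
    | zero => intro i; simp [h0]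
    | succ ν ih =>
      intro i; rw [hφ]; exact Finset.sum_nonneg fun j _ => mul_nonneg (hM _ _ _) (ih j)
  have hI1 : (1 : ℝ) ≤ I := by exact_mod_cast hI
  have hblock : ∀ k i, κ ^ (I * B) ≤ φ (k * (I * B)) i := by
    intro k i
    cases k with
    | zero => simpa [h0] using pow_le_one₀ hκ.le hκ1
    | succ k =>
      have e : (k + 1) * (I * B) = (k * I) * B + I * B := by ring
      rw [e, act_transition hact]
      simp only [act, smul_eq_mul]
      calc κ ^ (I * B) ≤ ∑ j, κ ^ (I * B) * φ (k * I * B) j := by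
            rw [← Finset.mul_sum, hsum]
            exact le_mul_of_one_le_right (by positivity) hI1
        _ ≤ _ := Finset.sum_le_sum fun j _ => mul_le_mul_of_nonneg_right
            (pow_le_transition hconn hκ hM hdiag hedge _ _ _) (hnn _ _)
  have hself : ∀ ν r i, κ ^ r * φ ν i ≤ φ (ν + r) i := by
    intro ν r
    induction r with
    | zero => simp
    | succ r ih =>
      intro i
      rw [← add_assoc, hφ]
      refine le_trans ?_ (Finset.single_le_sum (f := fun j => M (ν + r) i j * φ (ν + r) j)
        (fun j _ => mul_nonneg (hM _ _ _) (hnn _ _)) (Finset.mem_univ i))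
      rw [pow_succ', mul_assoc]
      exact mul_le_mul (hdiag _ _) (ih i) (mul_nonneg (by positivity) (hnn _ _)) (hM _ _ _)
  -- One factor bounds the mass at multiples of `I * B`, where the total mass `I ≥ 1` has been
  -- spread to every node. The other pays for the fewer than `I * B` remaining steps, each of which
  -- retains at least a fraction `κ`.
  refine ⟨κ ^ (I * B) * κ ^ (I * B), by positivity, fun ν i => ?_⟩
  have hm : 0 < I * B := Nat.mul_pos hI hB
  have e : ν / (I * B) * (I * B) + ν % (I * B) = ν := Nat.div_add_mod' ν (I * B)
  rw [← e]
  refine le_trans ?_ (hself _ _ i)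
  exact mul_le_mul (pow_le_pow_of_le_one hκ.le hκ1 (Nat.mod_lt _ hm).le) (hblock _ _)
    (by positivity) (by positivity)

end Connectivity

/-! ### Geometric filters. -/

section Geometric

/-- The solution of `b (ν + 1) = ρ * b ν + u ν` with `b 0 = r`. -/
def geomFilter (ρ r : ℝ) (u : ℕ → ℝ) : ℕ → ℝ
  | 0 => r
  | ν + 1 => ρ * geomFilter ρ r u ν + u ν

lemma geomFilter_nonneg {ρ r : ℝ} {u : ℕ → ℝ} (hρ : 0 ≤ ρ) (hr : 0 ≤ r) (hu : ∀ ν, 0 ≤ u ν)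
    (ν : ℕ) : 0 ≤ geomFilter ρ r u ν := by
  induction ν with
  | zero => exact hr
  | succ ν ih => exact add_nonneg (mul_nonneg hρ ih) (hu ν)

/-- Convexity of the square gives `(ρ * b + u) ^ 2 ≤ ρ * b ^ 2 + u ^ 2 / (1 - ρ)`; summing this
recursion leaves `1 - ρ` times the sum of `b ^ 2` on the left. -/
lemma sum_geomFilter_sq_le {ρ r : ℝ} {u : ℕ → ℝ} (hρ : 0 < ρ) (hρ1 : ρ < 1) (N : ℕ) :
    ∑ ν ∈ Finset.range N, geomFilter ρ r u ν ^ 2 ≤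
      r ^ 2 / (1 - ρ) + (∑ ν ∈ Finset.range N, u ν ^ 2) / (1 - ρ) ^ 2 := by
  have h1 : 0 < 1 - ρ := by linarith
  have key : (1 - ρ) * ∑ ν ∈ Finset.range N, geomFilter ρ r u ν ^ 2 + geomFilter ρ r u N ^ 2 ≤
      r ^ 2 + (∑ ν ∈ Finset.range N, u ν ^ 2) / (1 - ρ) := by
    induction N with
    | zero => simp [geomFilter]
    | succ N ih =>
      rw [Finset.sum_range_succ, Finset.sum_range_succ, add_div, mul_add]
      have : geomFilter ρ r u (N + 1) ^ 2 ≤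
          ρ * geomFilter ρ r u N ^ 2 + u N ^ 2 / (1 - ρ) := by
        rw [geomFilter, ← sub_nonneg]
        have : ρ * geomFilter ρ r u N ^ 2 + u N ^ 2 / (1 - ρ) - (ρ * geomFilter ρ r u N + u N) ^ 2
            = ρ * ((1 - ρ) * geomFilter ρ r u N - u N) ^ 2 / (1 - ρ) := by
          field_simp; ring
        rw [this]; positivity
      linarith
  have h2 : (1 - ρ) * ∑ ν ∈ Finset.range N, geomFilter ρ r u ν ^ 2 ≤
      r ^ 2 + (∑ ν ∈ Finset.range N, u ν ^ 2) / (1 - ρ) := by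
    linarith [sq_nonneg (geomFilter ρ r u N)]
  rw [← le_div_iff₀' h1] at h2
  refine h2.trans (le_of_eq ?_)
  field_simp

/-- `U / (1 - ρ)` is the fixed point of `b ↦ ρ * b + U`. The bound on `u` is required only from time
`m` on, so the filter can be restarted at any moment. -/
lemma geomFilter_add_le {ρ r U : ℝ} {u : ℕ → ℝ} (hρ : 0 < ρ) (hρ1 : ρ < 1) {m : ℕ}
    (hU : ∀ ν, m ≤ ν → u ν ≤ U) (hU0 : 0 ≤ U) (t : ℕ) :
    geomFilter ρ r u (m + t) ≤ ρ ^ t * geomFilter ρ r u m + U / (1 - ρ) := by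
  have h1 : 0 < 1 - ρ := by linarith
  induction t with
  | zero => simp; positivity
  | succ t ih =>
    rw [← add_assoc, geomFilter, pow_succ']
    have e : U / (1 - ρ) = ρ * (U / (1 - ρ)) + U := by field_simp; ring
    rw [e]
    nlinarith [hU (m + t) (Nat.le_add_right _ _), mul_le_mul_of_nonneg_left ih hρ.le]

/-- Contraction is available only over complete blocks, whereas the filter discounts at every step,
by `ρ` with `q ≤ ρ ^ m`. One factor `ρ ^ m` compensates for the discount of the perturbations within
a block, the second for the incomplete last block. -/
lemma le_geomFilter_of_blocks {m : ℕ} (hm : 0 < m) {q ρ : ℝ} (hρ : 0 < ρ) (hρ1 : ρ < 1)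
    (hq : q ≤ ρ ^ m) {r u : ℕ → ℝ} (hr0 : ∀ ν, 0 ≤ r ν) (hu0 : ∀ ν, 0 ≤ u ν)
    (hr : ∀ s t, r (s + t) ≤ r s + ∑ l ∈ Finset.range t, u (s + l))
    (hblock : ∀ k, r (k * m + m) ≤ q * r (k * m) + ∑ l ∈ Finset.range m, u (k * m + l)) (ν : ℕ) :
    r ν ≤ ((ρ ^ m) ^ 2)⁻¹ * geomFilter ρ (r 0) u ν := by
  set b := geomFilter ρ (r 0) u with hb
  have hb0 : ∀ ν, 0 ≤ b ν := geomFilter_nonneg hρ.le (hr0 0) hu0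
  have hc : 0 < ρ ^ m := by positivity
  have hc1 : ρ ^ m ≤ 1 := pow_le_one₀ hρ.le hρ1.le
  have hsum0 : ∀ s t, 0 ≤ ∑ l ∈ Finset.range t, u (s + l) := fun s t =>
    Finset.sum_nonneg fun l _ => hu0 _
  have hgrow : ∀ s t, ρ ^ t * (b s + ∑ l ∈ Finset.range t, u (s + l)) ≤ b (s + t) := by
    intro s t
    induction t with
    | zero => simp
    | succ t ih =>
      rw [Finset.sum_range_succ, ← add_assoc, ← add_assoc, hb, geomFilter, ← hb, pow_succ']
      have : ρ * ρ ^ t * u (s + t) ≤ 1 * u (s + t) := by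
        refine mul_le_mul_of_nonneg_right ?_ (hu0 _)
        rw [← pow_succ']
        exact pow_le_one₀ hρ.le hρ1.le
      nlinarith [mul_le_mul_of_nonneg_left ih hρ.le]
  have hgrow' : ∀ s t, t ≤ m → ρ ^ m * (b s + ∑ l ∈ Finset.range t, u (s + l)) ≤ b (s + t) :=
    fun s t ht => (mul_le_mul_of_nonneg_right (pow_le_pow_of_le_one hρ.le hρ1.le ht)
      (add_nonneg (hb0 _) (hsum0 _ _))).trans (hgrow s t)
  have hmul : ∀ k, ρ ^ m * r (k * m) ≤ b (k * m) := by
    intro k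
    induction k with
    | zero => simpa [hb, geomFilter] using mul_le_of_le_one_left (hr0 0) hc1
    | succ k ih =>
      have e : (k + 1) * m = k * m + m := by ring
      rw [e]
      have h1 := mul_le_mul_of_nonneg_left (hblock k) hc.le
      have h2 := hgrow' (k * m) m le_rfl
      have h3 : q * (ρ ^ m * r (k * m)) ≤ ρ ^ m * b (k * m) :=
        (mul_le_mul_of_nonneg_right hq (mul_nonneg hc.le (hr0 _))).trans
          (mul_le_mul_of_nonneg_left ih hc.le)
      nlinarith
  rw [← div_eq_inv_mul, le_div_iff₀' (by positivity)]
  have e : ν / m * m + ν % m = ν := Nat.div_add_mod' ν m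
  rw [← e]
  have h1 := hr (ν / m * m) (ν % m)
  have h2 := hgrow' (ν / m * m) (ν % m) (Nat.mod_lt _ hm).le
  have h3 := hmul (ν / m)
  have h4 := hsum0 (ν / m * m) (ν % m)
  have h5 : (ρ ^ m) ^ 2 * r (ν / m * m + ν % m) ≤ ρ ^ m * (ρ ^ m * r (ν / m * m)) +
      ρ ^ m * (ρ ^ m * ∑ l ∈ Finset.range (ν % m), u (ν / m * m + l)) := by
    have := mul_le_mul_of_nonneg_left h1 (sq_nonneg (ρ ^ m))
    nlinarith
  have h6 := mul_le_mul_of_nonneg_left h3 hc.le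
  have h7 : ρ ^ m * (ρ ^ m * ∑ l ∈ Finset.range (ν % m), u (ν / m * m + l)) ≤
      1 * (ρ ^ m * ∑ l ∈ Finset.range (ν % m), u (ν / m * m + l)) :=
    mul_le_mul_of_nonneg_right hc1 (mul_nonneg hc.le h4)
  nlinarith

end Geometric

/-- Perturbed consensus: the disagreement is a geometrically filtered perturbation. -/
theorem exists_spread_le_geomFilter {I : ℕ} (hI : 0 < I) {Ed : DigraphSeq I} {B : ℕ} (hB : 0 < B)
    (hconn : StronglyConnected Ed B) {W : ℕ → Matrix (Fin I) (Fin I) ℝ} {η : ℝ} (hη : 0 < η)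
    (hW : ∀ ν i j, 0 ≤ W ν i j) (hW1 : ∀ ν i, ∑ j, W ν i j = 1) (hdiag : ∀ ν i, η ≤ W ν i i)
    (hedge : ∀ ν i j, Ed ν j i → η ≤ W ν i j)
    (E : Type*) [NormedAddCommGroup E] [NormedSpace ℝ E] :
    ∃ C ρ : ℝ, 0 < C ∧ 0 < ρ ∧ ρ < 1 ∧ ∀ x v : ℕ → Fin I → E,
      (∀ ν, x (ν + 1) = act (W ν) (x ν) + v ν) →
        ∀ ν, spread (x ν) ≤ C * geomFilter ρ (spread (x 0)) (fun ν => spread (v ν)) ν := by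
  have hη1 : η ≤ 1 := (hdiag 0 ⟨0, hI⟩).trans <| (hW1 0 ⟨0, hI⟩) ▸
    Finset.single_le_sum (f := fun j => W 0 ⟨0, hI⟩ j) (fun j _ => hW _ _ _) (Finset.mem_univ _)
  set m := I * B with hm
  have hm0 : 0 < m := Nat.mul_pos hI hB
  set β := η ^ m with hβ
  have hβ0 : 0 < β := by positivity
  have hI0 : (0 : ℝ) < I := by exact_mod_cast hI
  have hlow : ∀ k i j, β ≤ transition W (k * m) m i j := fun k i j => by
    have e : k * m = (k * I) * B := by rw [hm]; ring
    rw [e]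
    exact pow_le_transition hconn hη hW hdiag hedge _ _ _
  have hc : (Fintype.card (Fin I) : ℝ) * β ≤ 1 := by
    rw [← transition_row_sum hW1 (0 * m) m ⟨0, hI⟩]
    calc _ = ∑ j : Fin I, β := by simp
      _ ≤ _ := Finset.sum_le_sum fun j _ => hlow 0 _ j
  have hm1 : (1 : ℝ) ≤ m := by exact_mod_cast hm0
  -- Chosen for Bernoulli's inequality: `(1 - y) ^ m ≥ 1 - m * y = 1 - I * β / 2`, which is at least
  -- the block contraction factor `1 - I * β`.
  set y := (I : ℝ) * β / (2 * m) with hy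
  have hy0 : 0 < y := by positivity
  rw [Fintype.card_fin] at hc
  have hy1 : y ≤ 1 / 2 := by
    rw [hy, div_le_div_iff₀ (by positivity) (by norm_num)]
    nlinarith
  have hq : 1 - (I : ℝ) * β ≤ (1 - y) ^ m := by
    have h1 := one_add_mul_le_pow (a := -y) (by linarith) m
    have h2 : (m : ℝ) * y = I * β / 2 := by rw [hy]; field_simp
    rw [← sub_eq_add_neg] at h1
    have : 0 < (I : ℝ) * β := by positivity
    linarith
  refine ⟨(((1 - y) ^ m) ^ 2)⁻¹, 1 - y, ?_, by linarith, by linarith, fun x v hx ν => ?_⟩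
  · have : 0 < 1 - y := by linarith
    positivity
  refine le_geomFilter_of_blocks hm0 (by linarith) (by linarith) hq (fun ν => spread_nonneg _)
    (fun ν => spread_nonneg _) (fun s t => ?_) (fun k => ?_) ν
  · obtain ⟨z, h1, h2⟩ := exists_act_transition_add hW hW1 hx s t
    rw [h1]
    refine (spread_add_le _ _).trans (add_le_add ?_ h2)
    simpa using spread_act_le (β := 0) (transition_nonneg hW s t) (transition_row_sum hW1 s t)
      (by simp) (x s)
  · obtain ⟨z, h1, h2⟩ := exists_act_transition_add hW hW1 hx (k * m) m
    rw [h1]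
    refine (spread_add_le _ _).trans (add_le_add ?_ h2)
    simpa using spread_act_le (hlow k) (transition_row_sum hW1 _ _) (by simpa using hc) (x (k * m))

variable {I M K : ℕ} {n : Fin I → ℕ} {P : Problem I M K n} {L : Fin I → Mat M K → ℝ≥0}

/-! ### Partial gradients of the objective. -/

namespace Problem.Standing

lemma contDiffAt (hP : P.Standing L) {i : Fin I} {D : Mat M K} {X : Mat K (n i)}
    (hD : D ∈ P.domD) (hX : X ∈ P.domX i) :
    ContDiffAt ℝ 2 (fun p : Mat M K × Mat K (n i) => P.f i p.1 p.2) (D, X) :=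
  (hP.contDiff_f i).contDiffAt ((hP.isOpen_domD.prod (hP.isOpen_domX i)).mem_nhds ⟨hD, hX⟩)

lemma contDiffOn_right (hP : P.Standing L) {i : Fin I} {D : Mat M K} (hD : D ∈ P.domD) :
    ContDiffOn ℝ 2 (P.f i D) (P.domX i) :=
  (hP.contDiff_f i).comp (t := P.domD ×ˢ P.domX i) (f := fun X => (D, X))
    (contDiff_const.prodMk contDiff_id).contDiffOn fun _ hX => ⟨hD, hX⟩

lemma hasFDerivAt_left (hP : P.Standing L) {i : Fin I} {D : Mat M K} {X : Mat K (n i)}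
    (hD : D ∈ P.domD) (hX : X ∈ P.domX i) :
    HasFDerivAt (fun D' => P.f i D' X)
      ((fderiv ℝ (fun p : Mat M K × Mat K (n i) => P.f i p.1 p.2) (D, X)).comp
        (ContinuousLinearMap.inl ℝ _ _)) D :=
  HasFDerivAt.comp (g := fun p : Mat M K × Mat K (n i) => P.f i p.1 p.2) (f := fun D' => (D', X)) D
    ((hP.contDiffAt hD hX).differentiableAt (by norm_num)).hasFDerivAt
    (hasFDerivAt_prodMk_left D X)

lemma hasFDerivAt_right (hP : P.Standing L) {i : Fin I} {D : Mat M K} {X : Mat K (n i)}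
    (hD : D ∈ P.domD) (hX : X ∈ P.domX i) :
    HasFDerivAt (P.f i D)
      ((fderiv ℝ (fun p : Mat M K × Mat K (n i) => P.f i p.1 p.2) (D, X)).comp
        (ContinuousLinearMap.inr ℝ _ _)) X :=
  HasFDerivAt.comp (g := fun p : Mat M K × Mat K (n i) => P.f i p.1 p.2) (f := fun X' => (D, X')) X
    ((hP.contDiffAt hD hX).differentiableAt (by norm_num)).hasFDerivAt
    (hasFDerivAt_prodMk_right D X)

lemma toDual_gradD (hP : P.Standing L) {i : Fin I} {D : Mat M K} {X : Mat K (n i)}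
    (hD : D ∈ P.domD) (hX : X ∈ P.domX i) :
    InnerProductSpace.toDual ℝ _ (P.gradD i D X) =
      (fderiv ℝ (fun p : Mat M K × Mat K (n i) => P.f i p.1 p.2) (D, X)).comp
        (ContinuousLinearMap.inl ℝ _ _) := by
  rw [Problem.gradD, toDual_gradient]
  exact (hP.hasFDerivAt_left hD hX).fderiv

lemma toDual_gradX (hP : P.Standing L) {i : Fin I} {D : Mat M K} {X : Mat K (n i)}
    (hD : D ∈ P.domD) (hX : X ∈ P.domX i) :
    InnerProductSpace.toDual ℝ _ (P.gradX i D X) =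
      (fderiv ℝ (fun p : Mat M K × Mat K (n i) => P.f i p.1 p.2) (D, X)).comp
        (ContinuousLinearMap.inr ℝ _ _) := by
  rw [Problem.gradX, toDual_gradient]
  exact (hP.hasFDerivAt_right hD hX).fderiv

lemma hasGradientAt_left (hP : P.Standing L) {i : Fin I} {D : Mat M K} {X : Mat K (n i)}
    (hD : D ∈ P.domD) (hX : X ∈ P.domX i) :
    HasGradientAt (fun D' => P.f i D' X) (P.gradD i D X) D :=
  (hP.hasFDerivAt_left hD hX).differentiableAt.hasGradientAt

lemma hasGradientAt_right (hP : P.Standing L) {i : Fin I} {D : Mat M K} {X : Mat K (n i)}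
    (hD : D ∈ P.domD) (hX : X ∈ P.domX i) :
    HasGradientAt (P.f i D) (P.gradX i D X) X :=
  (hP.hasFDerivAt_right hD hX).differentiableAt.hasGradientAt

lemma gradDF_eq (hP : P.Standing L) {D : Mat M K} {X : ∀ i, Mat K (n i)}
    (hD : D ∈ P.domD) (hX : ∀ i, X i ∈ P.domX i) :
    P.gradDF D X = ∑ i, P.gradD i D (X i) := by
  refine HasGradientAt.gradient ?_
  rw [hasGradientAt_iff_hasFDerivAt, map_sum]
  exact HasFDerivAt.fun_sum fun i _ => (hP.hasGradientAt_left hD (hX i)).hasFDerivAt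

lemma hasGradientAt_F (hP : P.Standing L) {D : Mat M K} {X : ∀ i, Mat K (n i)}
    (hD : D ∈ P.domD) (hX : ∀ i, X i ∈ P.domX i) :
    HasGradientAt (fun D' => P.F D' X) (P.gradDF D X) D := by
  rw [hP.gradDF_eq hD hX, hasGradientAt_iff_hasFDerivAt, map_sum]
  exact HasFDerivAt.fun_sum fun i _ => (hP.hasGradientAt_left hD (hX i)).hasFDerivAt

/-- The partial gradients are Lipschitz on compact convex sets. -/
lemma exists_lipschitz_grad (hP : P.Standing L) (i : Fin I) {s : Set (Mat K (n i))}
    (hs : IsCompact s) (hsc : Convex ℝ s) (hsd : s ⊆ P.domX i) :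
    ∃ Λ : ℝ, 0 ≤ Λ ∧ ∀ D ∈ P.setD, ∀ D' ∈ P.setD, ∀ X ∈ s, ∀ X' ∈ s,
      ‖P.gradD i D X - P.gradD i D' X'‖ ≤ Λ * (‖D - D'‖ + ‖X - X'‖) ∧
      ‖P.gradX i D X - P.gradX i D' X'‖ ≤ Λ * (‖D - D'‖ + ‖X - X'‖) := by
  set p : Mat M K × Mat K (n i) → ℝ := fun p => P.f i p.1 p.2 with hp
  have hsub : ∀ z ∈ P.setD ×ˢ s, ContDiffAt ℝ 1 (fderiv ℝ p) z := fun z hz =>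
    (hP.contDiffAt (hP.setD_subset hz.1) (hsd hz.2)).fderiv_right (by norm_num)
  have hcont : ContinuousOn (fderiv ℝ (fderiv ℝ p)) (P.setD ×ˢ s) := fun z hz =>
    ((hsub z hz).fderiv_right (m := 0) (by norm_num)).continuousAt.continuousWithinAt
  obtain ⟨C, hC⟩ := (hP.isCompact_setD.prod hs).exists_bound_of_continuousOn
    (f := fderiv ℝ (fderiv ℝ p)) hcont
  -- Mean value inequality for the full derivative, whose own derivative is bounded on the compact
  -- convex product.
  have hlip : ∀ z ∈ P.setD ×ˢ s, ∀ z' ∈ P.setD ×ˢ s,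
      ‖fderiv ℝ p z - fderiv ℝ p z'‖ ≤ max C 0 * ‖z - z'‖ := fun z hz z' hz' =>
    (hP.convex_setD.prod hsc).norm_image_sub_le_of_norm_hasFDerivWithin_le
      (fun y hy => ((hsub y hy).differentiableAt (by norm_num)).hasFDerivAt.hasFDerivWithinAt)
      (fun y hy => (hC y hy).trans (le_max_left _ _)) hz' hz
  refine ⟨max C 0, le_max_right _ _, fun D hD D' hD' X hX X' hX' => ?_⟩
  have h1 := hlip (D, X) ⟨hD, hX⟩ (D', X') ⟨hD', hX'⟩
  have h2 : ‖(D, X) - (D', X')‖ ≤ ‖D - D'‖ + ‖X - X'‖ := by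
    rw [Prod.mk_sub_mk, Prod.norm_mk]
    exact max_le_add_of_nonneg (norm_nonneg _) (norm_nonneg _)
  have h3 := h1.trans (mul_le_mul_of_nonneg_left h2 (le_max_right C 0))
  constructor
  · rw [← (InnerProductSpace.toDual ℝ _).norm_map, map_sub,
      hP.toDual_gradD (hP.setD_subset hD) (hsd hX), hP.toDual_gradD (hP.setD_subset hD') (hsd hX'),
      ← ContinuousLinearMap.sub_comp]
    refine (ContinuousLinearMap.opNorm_comp_le _ _).trans (le_trans ?_ h3)
    exact mul_le_of_le_one_right (norm_nonneg _) (ContinuousLinearMap.norm_inl_le_one ℝ _ _)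
  · rw [← (InnerProductSpace.toDual ℝ _).norm_map, map_sub,
      hP.toDual_gradX (hP.setD_subset hD) (hsd hX), hP.toDual_gradX (hP.setD_subset hD') (hsd hX'),
      ← ContinuousLinearMap.sub_comp]
    refine (ContinuousLinearMap.opNorm_comp_le _ _).trans (le_trans ?_ h3)
    exact mul_le_of_le_one_right (norm_nonneg _) (ContinuousLinearMap.norm_inr_le_one ℝ _ _)

lemma convex_g (hP : P.Standing L) (i : Fin I) : ConvexOn ℝ (P.domX i) (P.g i) := by
  rcases hP.compact_or_strongConvex i with h | ⟨μ, hμ, h⟩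
  · exact h.2
  · exact strongConvexOn_zero.1 (h.mono hμ.le)

end Problem.Standing

/-! ### Optimality and descent for the surrogate subproblems. -/

section Surrogates

lemma hasGradientAt_prox {E : Type*} [NormedAddCommGroup E] [InnerProductSpace ℝ E]
    [CompleteSpace E] (τ : ℝ) (x₀ x : E) :
    HasGradientAt (fun x => τ / 2 * ‖x - x₀‖ ^ 2) (τ • (x - x₀)) x := by
  rw [hasGradientAt_iff_hasFDerivAt]
  have h := (((hasFDerivAt_id (𝕜 := ℝ) x).sub_const x₀).norm_sq).const_mul (τ / 2)
  refine h.congr_fderiv ?_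
  ext v
  simp
  ring

lemma hasGradientAt_inner_sub {E : Type*} [NormedAddCommGroup E] [InnerProductSpace ℝ E]
    [CompleteSpace E] (c x₀ x : E) : HasGradientAt (fun x => inner ℝ c (x - x₀)) c x := by
  rw [hasGradientAt_iff_hasFDerivAt]
  exact (InnerProductSpace.toDual ℝ E c).hasFDerivAt.comp x ((hasFDerivAt_id x).sub_const x₀)

lemma _root_.HasGradientAt.fun_add {E : Type*} [NormedAddCommGroup E] [InnerProductSpace ℝ E]
    [CompleteSpace E] {f g : E → ℝ} {f' g' x : E} (hf : HasGradientAt f f' x)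
    (hg : HasGradientAt g g' x) : HasGradientAt (fun x => f x + g x) (f' + g') x := by
  rw [hasGradientAt_iff_hasFDerivAt, map_add]
  exact hf.hasFDerivAt.fun_add hg.hasFDerivAt

/-- The gradient at `D` of the surrogate of `f_i (·, X₀)` at `D₀`, without its proximal part. -/
def slopeD (P : Problem I M K n) (s : Surrogate) (i : Fin I) (D₀ : Mat M K) (X₀ : Mat K (n i))
    (D : Mat M K) : Mat M K :=
  match s with
  | .proximal => P.gradD i D X₀
  | .linearized => P.gradD i D₀ X₀

/-- The gradient at `X` of the surrogate of `f_i (U, ·)` at `X₀`, without its proximal part. -/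
def slopeX (P : Problem I M K n) (s : Surrogate) (i : Fin I) (U : Mat M K) (X₀ X : Mat K (n i)) :
    Mat K (n i) :=
  match s with
  | .proximal => P.gradX i U X
  | .linearized => P.gradX i U X₀

lemma hasGradientAt_surrogateD (hP : P.Standing L) (s : Surrogate) {i : Fin I} (τ : ℝ)
    (D₀ : Mat M K) {D : Mat M K} {X₀ : Mat K (n i)} (hD : D ∈ P.domD) (hX₀ : X₀ ∈ P.domX i) :
    HasGradientAt (surrogateD P s i τ D₀ X₀) (slopeD P s i D₀ X₀ D + τ • (D - D₀)) D := by
  cases s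
  · exact (hP.hasGradientAt_left hD hX₀).fun_add (hasGradientAt_prox τ D₀ D)
  · exact (hasGradientAt_inner_sub _ D₀ D).fun_add (hasGradientAt_prox τ D₀ D)

lemma hasGradientAt_surrogateX (hP : P.Standing L) (s : Surrogate) {i : Fin I} (τ : ℝ)
    {U : Mat M K} (X₀ : Mat K (n i)) {X : Mat K (n i)} (hU : U ∈ P.domD) (hX : X ∈ P.domX i) :
    HasGradientAt (surrogateX P s i τ U X₀) (slopeX P s i U X₀ X + τ • (X - X₀)) X := by
  cases s
  · exact (hP.hasGradientAt_right hU hX).fun_add (hasGradientAt_prox τ X₀ X)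
  · exact (hasGradientAt_inner_sub _ X₀ X).fun_add (hasGradientAt_prox τ X₀ X)

/-- Optimality condition for the local dictionary update. -/
lemma surrogateD_optimality (hP : P.Standing L) {s : Surrogate} {i : Fin I} {τ : ℝ}
    {D₀ Dt c : Mat M K} {X₀ : Mat K (n i)} (hX₀ : X₀ ∈ P.setX i)
    (h : IsArgmin P.setD
      (fun D => surrogateD P s i τ D₀ X₀ D + inner ℝ c (D - D₀) + P.G D) Dt)
    {y : Mat M K} (hy : y ∈ P.setD) :
    0 ≤ inner ℝ (slopeD P s i D₀ X₀ Dt + τ • (Dt - D₀) + c) (y - Dt) + (P.G y - P.G Dt) :=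
  h.2.variational_inequality (h := fun D => surrogateD P s i τ D₀ X₀ D + inner ℝ c (D - D₀))
    (hP.convex_G.subset hP.setD_subset hP.convex_setD) h.1 hy
    ((hasGradientAt_surrogateD hP s τ D₀ (hP.setD_subset h.1) (hP.setX_subset i hX₀)).fun_add
      (hasGradientAt_inner_sub c D₀ Dt))

/-- Optimality condition for the local coefficient update. -/
lemma surrogateX_optimality (hP : P.Standing L) {s : Surrogate} {i : Fin I} {τ : ℝ}
    {U : Mat M K} {X₀ Xp : Mat K (n i)} (hU : U ∈ P.setD)
    (h : IsArgmin (P.setX i) (fun X => surrogateX P s i τ U X₀ X + P.g i X) Xp)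
    {y : Mat K (n i)} (hy : y ∈ P.setX i) :
    0 ≤ inner ℝ (slopeX P s i U X₀ Xp + τ • (Xp - X₀)) (y - Xp) + (P.g i y - P.g i Xp) :=
  h.2.variational_inequality ((hP.convex_g i).subset (hP.setX_subset i) (hP.convex_setX i)) h.1 hy
    (hasGradientAt_surrogateX hP s τ X₀ (hP.setD_subset hU) (hP.setX_subset i h.1))

lemma gradD_monotone (hP : P.Standing L) {i : Fin I} {D D' : Mat M K} {X : Mat K (n i)}
    (hD : D ∈ P.domD) (hD' : D' ∈ P.domD) (hX : X ∈ P.domX i) :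
    0 ≤ inner ℝ (P.gradD i D X - P.gradD i D' X) (D - D') := by
  have h1 := (hP.convex_f_left i X hX).inner_gradient_le hD hD' (hP.hasGradientAt_left hD hX)
  have h2 := (hP.convex_f_left i X hX).inner_gradient_le hD' hD (hP.hasGradientAt_left hD' hX)
  rw [← neg_sub, inner_neg_right] at h1
  rw [inner_sub_left]
  linarith

lemma gradX_monotone (hP : P.Standing L) {i : Fin I} {U : Mat M K} {X X' : Mat K (n i)}
    (hU : U ∈ P.domD) (hX : X ∈ P.domX i) (hX' : X' ∈ P.domX i) :
    0 ≤ inner ℝ (P.gradX i U X - P.gradX i U X') (X - X') := by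
  have h1 := (hP.convex_f_right i U hU).inner_gradient_le hX hX' (hP.hasGradientAt_right hU hX)
  have h2 := (hP.convex_f_right i U hU).inner_gradient_le hX' hX (hP.hasGradientAt_right hU hX')
  rw [← neg_sub, inner_neg_right] at h1
  rw [inner_sub_left]
  linarith

lemma norm_gradX_sub_le (hP : P.Standing L) {i : Fin I} {U : Mat M K} (hU : U ∈ P.setD)
    {X X' : Mat K (n i)} (hX : X ∈ P.setX i) (hX' : X' ∈ P.setX i) :
    ‖P.gradX i U X - P.gradX i U X'‖ ≤ L i U * ‖X - X'‖ := by
  simpa [dist_eq_norm] using (hP.lipschitz_gradX i U hU).dist_le_mul X hX X' hX'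

/-- Keeps the new point `p` from being much farther from the reference `y` than the old point `x`.
The proximal surrogate needs only monotonicity of the gradient; the linearized one needs the
nonexpansive forward step, hence `L ≤ 2 * τ`. -/
lemma slopeX_inner_ge (hP : P.Standing L) (s : Surrogate) {i : Fin I} {U : Mat M K} {τ : ℝ}
    (hU : U ∈ P.setD) (hτ : (L i U : ℝ) ≤ 2 * τ) {x y p : Mat K (n i)} (hx : x ∈ P.setX i)
    (hy : y ∈ P.setX i) (hp : p ∈ P.setX i) :
    τ * ‖p - y‖ ^ 2 - τ * (‖x - y‖ * ‖p - y‖) - ‖P.gradX i U y‖ * ‖p - y‖ ≤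
      inner ℝ (slopeX P s i U x p + τ • (p - x)) (p - y) := by
  have hτ0 : 0 ≤ τ := by have := (L i U).coe_nonneg; linarith
  have h1 := abs_le.1 (abs_real_inner_le_norm (P.gradX i U y) (p - y))
  have e : p - x = (p - y) - (x - y) := by abel
  cases s
  · have h2 := gradX_monotone hP (hP.setD_subset hU) (hP.setX_subset i hp) (hP.setX_subset i hy)
    have h3 := mul_le_mul_of_nonneg_left (real_inner_le_norm (x - y) (p - y)) hτ0
    simp only [slopeX]
    rw [e, inner_add_left, real_inner_smul_left, inner_sub_left, real_inner_self_eq_norm_sq]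
    rw [inner_sub_left] at h2
    linarith [h1.1]
  · have h2 := inner_gradient_step_le (hP.isOpen_domX i) (hP.setX_subset i) (hP.convex_setX i)
      (hP.contDiffOn_right (hP.setD_subset hU)) (hP.convex_f_right i U (hP.setD_subset hU))
      (fun z hz z' hz' => norm_gradX_sub_le hP hU hz hz') hτ hx hy hp
    change inner ℝ (τ • (x - y) - (P.gradX i U x - P.gradX i U y)) (p - y) ≤ _ at h2
    simp only [slopeX]
    rw [e, inner_add_left, real_inner_smul_left, inner_sub_left, real_inner_self_eq_norm_sq]
    rw [inner_sub_left, inner_sub_left, real_inner_smul_left] at h2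
    linarith [h1.1]

/-- For the proximal surrogate this is the tangent inequality at the new point, and the quadratic
term is slack; for the linearized one it is the descent lemma. -/
lemma f_sub_le_slopeX (hP : P.Standing L) (s : Surrogate) {i : Fin I} {U : Mat M K}
    (hU : U ∈ P.setD) {x p : Mat K (n i)} (hx : x ∈ P.setX i) (hp : p ∈ P.setX i) :
    P.f i U p - P.f i U x ≤ inner ℝ (slopeX P s i U x p) (p - x) + L i U / 2 * ‖p - x‖ ^ 2 := by
  cases s
  · have h1 := (hP.convex_f_right i U (hP.setD_subset hU)).inner_gradient_le
      (hP.setX_subset i hp) (hP.setX_subset i hx)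
      (hP.hasGradientAt_right (hP.setD_subset hU) (hP.setX_subset i hp))
    rw [← neg_sub, inner_neg_right] at h1
    simp only [slopeX]
    have : 0 ≤ (L i U : ℝ) / 2 * ‖p - x‖ ^ 2 := by positivity
    linarith
  · have h1 := (hP.convex_setX i).descent (h := P.f i U) (h' := P.gradX i U) (L := L i U)
      (fun z hz => hP.hasGradientAt_right (hP.setD_subset hU) (hP.setX_subset i hz))
      (fun z hz => norm_gradX_sub_le hP hU hz hx) hx hp
    simp only [slopeX]
    linarith

/-- Sufficient decrease of a coefficient update. -/
lemma coefficient_descent (hP : P.Standing L) {s : Surrogate} {i : Fin I} {τ : ℝ}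
    {U : Mat M K} {X₀ Xp : Mat K (n i)} (hU : U ∈ P.setD) (hX₀ : X₀ ∈ P.setX i)
    (h : IsArgmin (P.setX i) (fun X => surrogateX P s i τ U X₀ X + P.g i X) Xp) :
    P.f i U Xp + P.g i Xp ≤ P.f i U X₀ + P.g i X₀ - (τ - L i U / 2) * ‖Xp - X₀‖ ^ 2 := by
  have h1 := surrogateX_optimality hP hU h hX₀
  have h2 := f_sub_le_slopeX hP s hU hX₀ h.1
  rw [← neg_sub Xp X₀, inner_neg_right, inner_add_left, real_inner_smul_left,
    real_inner_self_eq_norm_sq] at h1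
  linarith

end Surrogates

variable {S : Parameters I} {T : Iterates I M K n} {κ : ℝ}

/-! ### Push-sum masses, mixing matrices and conserved averages. -/

section Weights

lemma AdmissibleWeights.nonneg {Ed : DigraphSeq I} {A : ℕ → Matrix (Fin I) (Fin I) ℝ}
    (hA : AdmissibleWeights Ed A κ) (ν : ℕ) (i j : Fin I) : 0 ≤ A ν i j := by
  rcases eq_or_ne i j with rfl | h
  · exact hA.pos.le.trans (hA.diag ν i)
  · by_cases he : Ed ν j i
    · exact hA.pos.le.trans (hA.edge ν i j he)
    · exact (hA.nonedge ν i j h he).ge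

lemma AdmissibleWeights.le_one {Ed : DigraphSeq I} {A : ℕ → Matrix (Fin I) (Fin I) ℝ}
    (hA : AdmissibleWeights Ed A κ) (hI : 0 < I) : κ ≤ 1 := by
  refine (hA.diag 0 ⟨0, hI⟩).trans ((hA.colStochastic 0 ⟨0, hI⟩) ▸ ?_)
  exact Finset.single_le_sum (f := fun i => A 0 i ⟨0, hI⟩) (fun i _ => hA.nonneg _ _ _)
    (Finset.mem_univ _)

lemma AdmissibleWeights.eq_zero {Ed : DigraphSeq I} {A : ℕ → Matrix (Fin I) (Fin I) ℝ}
    (hA : AdmissibleWeights Ed A κ) {ν : ℕ} {i j : Fin I} (h : j ∉ inNeighbors Ed ν i) :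
    A ν i j = 0 := by
  simp only [inNeighbors, Finset.mem_filter, Finset.mem_univ, true_and, not_or] at h
  exact hA.nonedge ν i j (Ne.symm h.2) h.1

namespace IsGenerated

lemma φ_succ (hT : IsGenerated P S T) (hA : AdmissibleWeights S.E S.A κ) (ν : ℕ) (i : Fin I) :
    T.φ (ν + 1) i = ∑ j, S.A ν i j * T.φ ν j := by
  rw [hT.step_φ]
  exact Finset.sum_subset (Finset.subset_univ _) fun j _ hj => by simp [hA.eq_zero hj]

lemma sum_φ (hT : IsGenerated P S T) (hA : AdmissibleWeights S.E S.A κ) (ν : ℕ) :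
    ∑ i, T.φ ν i = I := by
  induction ν with
  | zero => simp [hT.init_φ]
  | succ ν ih =>
    simp only [hT.φ_succ hA]
    rw [Finset.sum_comm]
    simp only [← Finset.sum_mul, hA.colStochastic, one_mul, ih]

lemma exists_pos_le_φ (hI : 0 < I) (hT : IsGenerated P S T) (hA : AdmissibleWeights S.E S.A κ)
    {B : ℕ} (hB : 0 < B) (hconn : StronglyConnected S.E B) :
    ∃ c : ℝ, 0 < c ∧ ∀ ν i, c ≤ T.φ ν i :=
  exists_pos_le_pushSum hI hB hconn hA.pos (hA.le_one hI) hA.nonneg hA.diag hA.edge hT.init_φ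
    (hT.φ_succ hA) (hT.sum_φ hA)

end IsGenerated

/-- The row-stochastic matrix by which the agents mix their local variables. -/
def mixing (S : Parameters I) (T : Iterates I M K n) (ν : ℕ) : Matrix (Fin I) (Fin I) ℝ :=
  fun i j => S.A ν i j * T.φ ν j / T.φ (ν + 1) i

lemma mixing_nonneg (hA : AdmissibleWeights S.E S.A κ) (hφ : ∀ ν i, 0 < T.φ ν i) (ν : ℕ)
    (i j : Fin I) : 0 ≤ mixing S T ν i j :=
  div_nonneg (mul_nonneg (hA.nonneg _ _ _) (hφ _ _).le) (hφ _ _).le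

lemma mixing_row_sum (hT : IsGenerated P S T) (hA : AdmissibleWeights S.E S.A κ)
    (hφ : ∀ ν i, 0 < T.φ ν i) (ν : ℕ) (i : Fin I) : ∑ j, mixing S T ν i j = 1 := by
  simp only [mixing, ← Finset.sum_div, ← hT.φ_succ hA]
  exact div_self (hφ _ _).ne'

/-- Masses are at least `c`, and none exceeds the conserved total `I`; lower bounds on `A` therefore
pass to the normalized matrix. -/
lemma le_mixing (hT : IsGenerated P S T) (hA : AdmissibleWeights S.E S.A κ) {c : ℝ} (hc : 0 < c)
    (hφ : ∀ ν i, c ≤ T.φ ν i) {ν : ℕ} {i j : Fin I} (h : κ ≤ S.A ν i j) :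
    κ * c / I ≤ mixing S T ν i j := by
  have hle : T.φ (ν + 1) i ≤ I := by
    rw [← hT.sum_φ hA (ν + 1)]
    exact Finset.single_le_sum (f := fun i => T.φ (ν + 1) i) (fun i _ => hc.le.trans (hφ _ i))
      (Finset.mem_univ i)
  have := hφ (ν + 1) i
  exact div_le_div₀ (mul_nonneg (hA.nonneg _ _ _) (hc.le.trans (hφ _ _)))
    (mul_le_mul h (hφ _ _) hc.le (hA.nonneg _ _ _)) (by linarith) hle

lemma smul_sum_inNeighbors {E : Type*} [AddCommGroup E] [Module ℝ E]
    (hA : AdmissibleWeights S.E S.A κ) (ν : ℕ) (i : Fin I) (y : Fin I → E) :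
    (1 / T.φ (ν + 1) i) • ∑ j ∈ inNeighbors S.E ν i, (S.A ν i j * T.φ ν j) • y j =
      ∑ j, mixing S T ν i j • y j := by
  rw [Finset.sum_subset (Finset.subset_univ _) fun j _ hj => by simp [hA.eq_zero hj],
    Finset.smul_sum]
  refine Finset.sum_congr rfl fun j _ => ?_
  rw [smul_smul, mixing, one_div_mul_eq_div]

lemma D_succ (hT : IsGenerated P S T) (hA : AdmissibleWeights S.E S.A κ) (ν : ℕ) :
    T.D (ν + 1) = act (mixing S T ν) (T.U ν) := by
  funext i
  rw [hT.step_D, smul_sum_inNeighbors hA]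
  rfl

/-- The innovation of the gradient-tracking recursion. -/
def innovation (P : Problem I M K n) (T : Iterates I M K n) (ν : ℕ) (i : Fin I) : Mat M K :=
  (1 / T.φ (ν + 1) i) •
    (P.gradD i (T.D (ν + 1) i) (T.X (ν + 1) i) - P.gradD i (T.D ν i) (T.X ν i))

lemma Θ_succ (hT : IsGenerated P S T) (hA : AdmissibleWeights S.E S.A κ) (ν : ℕ) :
    T.Θ (ν + 1) = act (mixing S T ν) (T.Θ ν) + innovation P T ν := by
  funext i
  rw [hT.step_Θ, smul_sum_inNeighbors hA]
  rfl

/-- Multiplying by the new mass undoes the normalization of the rows, and the columns of `A` sum to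
one. This conservation law dictates the weights in `weightedD` and `averageG`. -/
lemma sum_φ_smul_mixing {E : Type*} [AddCommGroup E] [Module ℝ E] (hA : AdmissibleWeights S.E S.A κ)
    (hφ : ∀ ν i, 0 < T.φ ν i) (ν : ℕ) (y : Fin I → E) :
    ∑ i, T.φ (ν + 1) i • ∑ j, mixing S T ν i j • y j = ∑ j, T.φ ν j • y j := by
  simp only [Finset.smul_sum, smul_smul]
  rw [Finset.sum_comm]
  refine Finset.sum_congr rfl fun j _ => ?_
  rw [← Finset.sum_smul]
  congr 1
  have : ∀ i, T.φ (ν + 1) i * mixing S T ν i j = S.A ν i j * T.φ ν j := fun i =>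
    mul_div_cancel₀ _ (hφ _ _).ne'
  simp only [this, ← Finset.sum_mul, hA.colStochastic, one_mul]

/-- The gradient-tracking invariant: mixing conserves the weighted sum, and the factor `1 / φ` of
the innovation cancels, so the gradient increments telescope. -/
lemma sum_φ_smul_Θ (hT : IsGenerated P S T) (hA : AdmissibleWeights S.E S.A κ)
    (hφ : ∀ ν i, 0 < T.φ ν i) (ν : ℕ) :
    ∑ i, T.φ ν i • T.Θ ν i = ∑ i, P.gradD i (T.D ν i) (T.X ν i) := by
  induction ν with
  | zero => simp [hT.init_φ, hT.init_Θ]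
  | succ ν ih =>
    simp only [Θ_succ hT hA, Pi.add_apply, act, smul_add, Finset.sum_add_distrib]
    rw [sum_φ_smul_mixing hA hφ, ih, ← Finset.sum_add_distrib]
    refine Finset.sum_congr rfl fun i _ => ?_
    rw [innovation, smul_smul, mul_one_div_cancel (hφ _ _).ne', one_smul]
    abel

end Weights

/-! ### Feasibility and boundedness of the iterates. -/

section Feasibility

lemma Dt_mem (hT : IsGenerated P S T) (ν : ℕ) (i : Fin I) : T.Dt ν i ∈ P.setD := (hT.step_Dt ν i).1

lemma X_mem (hT : IsGenerated P S T) (ν : ℕ) (i : Fin I) : T.X ν i ∈ P.setX i := by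
  cases ν with
  | zero => exact hT.init_X i
  | succ ν => exact (hT.step_X ν i).1

lemma U_eq (hT : IsGenerated P S T) (ν : ℕ) (i : Fin I) :
    T.U ν i = (1 - S.γ ν) • T.D ν i + S.γ ν • T.Dt ν i := by
  rw [hT.step_U]; module

lemma U_mem_of_D_mem (hP : P.Standing L) (hT : IsGenerated P S T) (hγ : AdmissibleStep S.γ)
    {ν : ℕ} {i : Fin I} (hD : T.D ν i ∈ P.setD) : T.U ν i ∈ P.setD := by
  rw [U_eq hT]
  exact hP.convex_setD hD (Dt_mem hT ν i) (sub_nonneg.2 (hγ.le_one ν)) (hγ.pos ν).le (by ring)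

lemma D_mem (hP : P.Standing L) (hT : IsGenerated P S T) (hγ : AdmissibleStep S.γ)
    (hA : AdmissibleWeights S.E S.A κ) (hφ : ∀ ν i, 0 < T.φ ν i) (ν : ℕ) (i : Fin I) :
    T.D ν i ∈ P.setD := by
  induction ν generalizing i with
  | zero => exact hT.init_D i
  | succ ν ih =>
    rw [D_succ hT hA]
    exact hP.convex_setD.sum_mem (fun j _ => mixing_nonneg hA hφ ν i j)
      (mixing_row_sum hT hA hφ ν i) fun j _ => U_mem_of_D_mem hP hT hγ (ih j)

lemma U_mem (hP : P.Standing L) (hT : IsGenerated P S T) (hγ : AdmissibleStep S.γ)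
    (hA : AdmissibleWeights S.E S.A κ) (hφ : ∀ ν i, 0 < T.φ ν i) (ν : ℕ) (i : Fin I) :
    T.U ν i ∈ P.setD :=
  U_mem_of_D_mem hP hT hγ (D_mem hP hT hγ hA hφ ν i)

lemma exists_diam_bound (hP : P.Standing L) :
    ∃ d : ℝ, 0 ≤ d ∧ ∀ D ∈ P.setD, ∀ D' ∈ P.setD, ‖D - D'‖ ≤ d :=
  ⟨Metric.diam P.setD, Metric.diam_nonneg, fun D hD D' hD' => by
    rw [← dist_eq_norm]
    exact Metric.dist_le_diam_of_mem hP.isCompact_setD.isBounded hD hD'⟩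

/-- The coefficient iterates stay bounded. -/
lemma exists_X_bound (hP : P.Standing L) (hT : IsGenerated P S T)
    (hU : ∀ ν i, T.U ν i ∈ P.setD) (hτ : AdmissibleProx L S T) (i : Fin I) :
    ∃ R : ℝ, ∀ ν, ‖T.X ν i‖ ≤ R := by
  rcases hP.compact_or_strongConvex i with ⟨hc, -⟩ | ⟨μ, hμ, hg⟩
  · obtain ⟨R, hR⟩ := hc.isBounded.exists_norm_le
    exact ⟨R, fun ν => hR _ (X_mem hT ν i)⟩
  obtain ⟨d, hd0, hd⟩ := exists_diam_bound hP
  obtain ⟨ε, hε, hτε⟩ := hτ.τX_lower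
  set y := T.X 0 i with hy
  have hyX : y ∈ P.setX i := hT.init_X i
  obtain ⟨c, hc0, hc⟩ := hg.exists_le (hP.isOpen_domX i) (hP.setX_subset i hyX)
  obtain ⟨Λ, hΛ0, hΛ⟩ := hP.exists_lipschitz_grad i (isCompact_singleton (x := y))
    (convex_singleton y) (Set.singleton_subset_iff.2 (hP.setX_subset i hyX))
  set G := ‖P.gradX i (T.U 0 i) y‖ + Λ * d with hG
  have hG' : ∀ ν, ‖P.gradX i (T.U ν i) y‖ ≤ G := fun ν => by
    have h1 := (hΛ _ (hU ν i) _ (hU 0 i) y rfl y rfl).2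
    rw [sub_self, norm_zero, add_zero] at h1
    have h2 := mul_le_mul_of_nonneg_left (hd _ (hU ν i) _ (hU 0 i)) hΛ0
    have h3 := norm_sub_norm_le (P.gradX i (T.U ν i) y) (P.gradX i (T.U 0 i) y)
    linarith
  set R := max ‖T.X 1 i - y‖ (2 * (c + G) / μ) with hR
  have hR2 : c + G ≤ μ / 2 * R := by
    have := le_max_right ‖T.X 1 i - y‖ (2 * (c + G) / μ)
    rw [div_le_iff₀ hμ] at this
    linarith
  have hstep : ∀ ν, ‖T.X (ν + 1) i - y‖ ≤ R := by
    intro ν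
    induction ν with
    | zero => exact le_max_left _ _
    | succ ν ih =>
      have hτν := hτε (ν + 1) (by omega) i
      have hτpos := hτ.τX_pos (ν + 1) i
      have h1 := surrogateX_optimality hP (hU (ν + 1) i) (hT.step_X (ν + 1) i) hyX
      have h2 := slopeX_inner_ge hP (S.kindX (ν + 1) i) (τ := S.τX (ν + 1) i) (hU (ν + 1) i)
        (by linarith) (X_mem hT (ν + 1) i) hyX (X_mem hT (ν + 1 + 1) i)
      have h3 := hc _ (hP.setX_subset i (X_mem hT (ν + 1 + 1) i))
      have h4 := hG' (ν + 1)
      rw [← neg_sub (T.X (ν + 1 + 1) i) y, inner_neg_right] at h1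
      set r := ‖T.X (ν + 1 + 1) i - y‖ with hr
      have hr0 : 0 ≤ r := norm_nonneg _
      have h5 : S.τX (ν + 1) i * (‖T.X (ν + 1) i - y‖ * r) ≤ S.τX (ν + 1) i * (R * r) := by gcongr
      have h6 : ‖P.gradX i (T.U (ν + 1) i) y‖ * r ≤ G * r := by gcongr
      by_contra! hlt
      have hrpos : 0 < r := lt_of_le_of_lt ((norm_nonneg _).trans (le_max_left _ _)) hlt
      have h7 : (S.τX (ν + 1) i + μ / 2) * r * r ≤ (S.τX (ν + 1) i * R + (c + G)) * r := by
        nlinarith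
      have h8 := le_of_mul_le_mul_right h7 hrpos
      nlinarith
  refine ⟨‖y‖ + R, fun ν => ?_⟩
  cases ν with
  | zero => exact le_add_of_nonneg_right ((norm_nonneg _).trans (le_max_left _ _))
  | succ ν => linarith [hstep ν, norm_sub_norm_le (T.X (ν + 1) i) y]

/-- The coefficient iterates live in compact convex subsets of the feasible sets. -/
lemma exists_compact_convex (hP : P.Standing L) (hT : IsGenerated P S T)
    (hU : ∀ ν i, T.U ν i ∈ P.setD) (hτ : AdmissibleProx L S T) (i : Fin I) :
    ∃ s ⊆ P.setX i, IsCompact s ∧ Convex ℝ s ∧ ∀ ν, T.X ν i ∈ s := by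
  obtain ⟨R, hR⟩ := exists_X_bound hP hT hU hτ i
  exact ⟨P.setX i ∩ Metric.closedBall 0 R, Set.inter_subset_left,
    (isCompact_closedBall 0 R).inter_left (hP.isClosed_setX i),
    (hP.convex_setX i).inter (convex_closedBall 0 R),
    fun ν => ⟨X_mem hT ν i, by simpa using hR ν⟩⟩

end Feasibility

/-! ### Uniform estimates along a run. -/

/-- Uniform constants along a run of the algorithm. -/
structure RunBounds (P : Problem I M K n) (S : Parameters I) (T : Iterates I M K n) where
  /-- compact sets that contain the coefficient iterates -/
  s : ∀ i, Set (Mat K (n i))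
  c : ℝ
  Λ : ℝ
  d : ℝ
  ε : ℝ
  τ₀ : ℝ
  τ₁ : ℝ
  τ₂ : ℝ
  c_pos : 0 < c
  φ_ge : ∀ ν i, c ≤ T.φ ν i
  Λ_nonneg : 0 ≤ Λ
  s_subset : ∀ i, s i ⊆ P.setX i
  s_compact : ∀ i, IsCompact (s i)
  gradD_lip : ∀ i, ∀ D ∈ P.setD, ∀ D' ∈ P.setD, ∀ X ∈ s i, ∀ X' ∈ s i,
    ‖P.gradD i D X - P.gradD i D' X'‖ ≤ Λ * (‖D - D'‖ + ‖X - X'‖)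
  gradX_lip : ∀ i, ∀ D ∈ P.setD, ∀ D' ∈ P.setD, ∀ X ∈ s i, ∀ X' ∈ s i,
    ‖P.gradX i D X - P.gradX i D' X'‖ ≤ Λ * (‖D - D'‖ + ‖X - X'‖)
  d_nonneg : 0 ≤ d
  diam : ∀ D ∈ P.setD, ∀ D' ∈ P.setD, ‖D - D'‖ ≤ d
  D_mem : ∀ ν i, T.D ν i ∈ P.setD
  U_mem : ∀ ν i, T.U ν i ∈ P.setD
  X_mem : ∀ ν i, T.X ν i ∈ s i
  τ₀_pos : 0 < τ₀
  τD_ge : ∀ ν i, τ₀ ≤ S.τD ν i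
  τD_le : ∀ ν i, S.τD ν i ≤ τ₁
  τX_pos : ∀ ν i, 0 < S.τX ν i
  τX_le : ∀ ν i, S.τX ν i ≤ τ₂
  ε_pos : 0 < ε
  decrease : ∀ ν, 1 ≤ ν → ∀ i, P.f i (T.U ν i) (T.X (ν + 1) i) + P.g i (T.X (ν + 1) i) ≤
    P.f i (T.U ν i) (T.X ν i) + P.g i (T.X ν i) - ε * ‖T.X (ν + 1) i - T.X ν i‖ ^ 2

lemma nonempty_runBounds (hI : 0 < I) (hP : P.Standing L) (hT : IsGenerated P S T)
    (hA : AdmissibleWeights S.E S.A κ) {B : ℕ} (hB : 0 < B) (hconn : StronglyConnected S.E B)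
    (hτ : AdmissibleProx L S T) (hγ : AdmissibleStep S.γ) : Nonempty (RunBounds P S T) := by
  have : Nonempty (Fin I) := ⟨⟨0, hI⟩⟩
  obtain ⟨c, hc, hφ⟩ := hT.exists_pos_le_φ hI hA hB hconn
  have hφ0 : ∀ ν i, 0 < T.φ ν i := fun ν i => hc.trans_le (hφ ν i)
  have hU := U_mem hP hT hγ hA hφ0
  choose s hs hsc hsconv hsX using exists_compact_convex hP hT hU hτ
  choose Λ hΛ0 hΛ using fun i => hP.exists_lipschitz_grad i (hsc i) (hsconv i)
    ((hs i).trans (hP.setX_subset i))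
  obtain ⟨iΛ, hiΛ⟩ := Finite.exists_max Λ
  obtain ⟨d, hd0, hd⟩ := exists_diam_bound hP
  obtain ⟨ε, hε, hτε⟩ := hτ.τX_lower
  choose t0 ht0 ht0' using hτ.τD_lower
  choose t1 ht1 using hτ.τD_upper
  choose t2 ht2 using hτ.τX_upper
  obtain ⟨i0, hi0⟩ := Finite.exists_min t0
  obtain ⟨i1, hi1⟩ := Finite.exists_max t1
  obtain ⟨i2, hi2⟩ := Finite.exists_max t2
  exact ⟨{ s := s, c := c, Λ := Λ iΛ, d := d, ε := ε, τ₀ := t0 i0, τ₁ := t1 i1, τ₂ := t2 i2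
           c_pos := hc
           φ_ge := hφ
           Λ_nonneg := hΛ0 iΛ
           s_subset := hs
           s_compact := hsc
           gradD_lip := fun i D hD D' hD' X hX X' hX' => (hΛ i D hD D' hD' X hX X' hX').1.trans
             (mul_le_mul_of_nonneg_right (hiΛ i) (by positivity))
           gradX_lip := fun i D hD D' hD' X hX X' hX' => (hΛ i D hD D' hD' X hX X' hX').2.trans
             (mul_le_mul_of_nonneg_right (hiΛ i) (by positivity))
           d_nonneg := hd0
           diam := hd
           D_mem := D_mem hP hT hγ hA hφ0
           U_mem := hU
           X_mem := fun ν i => hsX i ν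
           τ₀_pos := ht0 i0
           τD_ge := fun ν i => (hi0 i).trans (ht0' i ν)
           τD_le := fun ν i => (ht1 i ν).trans (hi1 i)
           τX_pos := hτ.τX_pos
           τX_le := fun ν i => (ht2 i ν).trans (hi2 i)
           ε_pos := hε
           decrease := fun ν hν i => by
             have h1 := coefficient_descent hP (hU ν i) (X_mem hT ν i) (hT.step_X ν i)
             have h2 := hτε ν hν i
             have h3 : ε * ‖T.X (ν + 1) i - T.X ν i‖ ^ 2 ≤
                 (S.τX ν i - L i (T.U ν i) / 2) * ‖T.X (ν + 1) i - T.X ν i‖ ^ 2 := by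
               gcongr; linarith
             linarith }⟩

/-- The average of the dictionaries, weighted by the push-sum masses. -/
def weightedD (T : Iterates I M K n) (ν : ℕ) : Mat M K := ∑ i, (T.φ ν i / I) • T.D ν i

/-- The total squared change of the coefficients in one iteration. -/
def changeX (T : Iterates I M K n) (ν : ℕ) : ℝ := ∑ i, ‖T.X (ν + 1) i - T.X ν i‖ ^ 2

/-- The total squared length of the local dictionary directions. -/
def changeD (T : Iterates I M K n) (ν : ℕ) : ℝ := ∑ i, ‖T.Dt ν i - T.D ν i‖ ^ 2

lemma changeX_nonneg (T : Iterates I M K n) (ν : ℕ) : 0 ≤ changeX T ν :=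
  Finset.sum_nonneg fun _ _ => sq_nonneg _

lemma changeD_nonneg (T : Iterates I M K n) (ν : ℕ) : 0 ≤ changeD T ν :=
  Finset.sum_nonneg fun _ _ => sq_nonneg _

lemma norm_X_sub_le_sqrt (T : Iterates I M K n) (ν : ℕ) (i : Fin I) :
    ‖T.X (ν + 1) i - T.X ν i‖ ≤ √(changeX T ν) :=
  Real.le_sqrt_of_sq_le (Finset.single_le_sum (f := fun i => ‖T.X (ν + 1) i - T.X ν i‖ ^ 2)
    (fun _ _ => sq_nonneg _) (Finset.mem_univ i))

lemma norm_Dt_sub_le_sqrt (T : Iterates I M K n) (ν : ℕ) (i : Fin I) :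
    ‖T.Dt ν i - T.D ν i‖ ≤ √(changeD T ν) :=
  Real.le_sqrt_of_sq_le (Finset.single_le_sum (f := fun i => ‖T.Dt ν i - T.D ν i‖ ^ 2)
    (fun _ _ => sq_nonneg _) (Finset.mem_univ i))

namespace RunBounds

lemma φ_pos (b : RunBounds P S T) (ν : ℕ) (i : Fin I) : 0 < T.φ ν i := b.c_pos.trans_le (b.φ_ge ν i)

lemma weight_nonneg (b : RunBounds P S T) (ν : ℕ) (i : Fin I) : 0 ≤ T.φ ν i / I :=
  div_nonneg (b.φ_pos ν i).le (Nat.cast_nonneg _)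

lemma sum_weight (hI : 0 < I) (hT : IsGenerated P S T) (hA : AdmissibleWeights S.E S.A κ) (ν : ℕ) :
    ∑ i, T.φ ν i / I = 1 := by
  rw [← Finset.sum_div, hT.sum_φ hA, div_self (by exact_mod_cast hI.ne')]

lemma Dt_sub_le (b : RunBounds P S T) (hT : IsGenerated P S T) (ν : ℕ) (i : Fin I) :
    ‖T.Dt ν i - T.D ν i‖ ≤ b.d := b.diam _ (Dt_mem hT ν i) _ (b.D_mem ν i)

lemma U_sub_D_le (b : RunBounds P S T) (hT : IsGenerated P S T) (hγ : AdmissibleStep S.γ)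
    (ν : ℕ) (i : Fin I) : ‖T.U ν i - T.D ν i‖ ≤ S.γ ν * b.d := by
  rw [hT.step_U, add_sub_cancel_left, norm_smul, Real.norm_of_nonneg (hγ.pos ν).le]
  exact mul_le_mul_of_nonneg_left (b.Dt_sub_le hT ν i) (hγ.pos ν).le

lemma weightedD_mem (b : RunBounds P S T) (hI : 0 < I) (hP : P.Standing L)
    (hT : IsGenerated P S T) (hA : AdmissibleWeights S.E S.A κ) (ν : ℕ) :
    weightedD T ν ∈ P.setD :=
  hP.convex_setD.sum_mem (fun i _ => b.weight_nonneg ν i) (sum_weight hI hT hA ν)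
    fun i _ => b.D_mem ν i

lemma D_sub_weightedD_le (b : RunBounds P S T) (hI : 0 < I) (hT : IsGenerated P S T)
    (hA : AdmissibleWeights S.E S.A κ) (ν : ℕ) (i : Fin I) :
    ‖T.D ν i - weightedD T ν‖ ≤ spread (T.D ν) :=
  norm_sub_average_le (b.weight_nonneg ν) (sum_weight hI hT hA ν) fun j =>
    norm_sub_le_spread (T.D ν) i j

lemma avgD_eq (T : Iterates I M K n) (ν : ℕ) : T.avgD ν = ∑ i, (1 / (I : ℝ)) • T.D ν i := by
  rw [Iterates.avgD, Finset.smul_sum]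

lemma avgD_mem (b : RunBounds P S T) (hI : 0 < I) (hP : P.Standing L) (ν : ℕ) :
    T.avgD ν ∈ P.setD := by
  have : (I : ℝ) ≠ 0 := by exact_mod_cast hI.ne'
  rw [avgD_eq]
  exact hP.convex_setD.sum_mem (fun i _ => by positivity) (by simp [this]) fun i _ => b.D_mem ν i

lemma D_sub_avgD_le (hI : 0 < I) (T : Iterates I M K n) (ν : ℕ) (i : Fin I) :
    ‖T.D ν i - T.avgD ν‖ ≤ spread (T.D ν) := by
  have : (I : ℝ) ≠ 0 := by exact_mod_cast hI.ne'
  rw [avgD_eq]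
  exact norm_sub_average_le (fun _ => by positivity) (by simp [this]) fun j =>
    norm_sub_le_spread (T.D ν) i j

lemma sum_weight_succ {E : Type*} [AddCommGroup E] [Module ℝ E] (b : RunBounds P S T)
    (hA : AdmissibleWeights S.E S.A κ) (ν : ℕ) (y : Fin I → E) :
    ∑ i, (T.φ (ν + 1) i / I) • ∑ j, mixing S T ν i j • y j = ∑ j, (T.φ ν j / I) • y j := by
  have h := congrArg (fun z => (I : ℝ)⁻¹ • z) (sum_φ_smul_mixing hA b.φ_pos ν y)
  simpa only [Finset.smul_sum (r := (I : ℝ)⁻¹), smul_smul ((I : ℝ)⁻¹), ← div_eq_inv_mul] using h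

lemma weightedD_succ (b : RunBounds P S T) (hT : IsGenerated P S T)
    (hA : AdmissibleWeights S.E S.A κ) (ν : ℕ) :
    weightedD T (ν + 1) - weightedD T ν =
      ∑ j, (T.φ ν j / I) • (S.γ ν • (T.Dt ν j - T.D ν j)) := by
  have h := b.sum_weight_succ hA ν (T.U ν)
  have h' : weightedD T (ν + 1) = ∑ j, (T.φ ν j / I) • T.U ν j := by
    rw [← h, weightedD, D_succ hT hA]
    rfl
  rw [h', weightedD, ← Finset.sum_sub_distrib]
  refine Finset.sum_congr rfl fun j _ => ?_
  rw [hT.step_U, ← smul_sub, add_sub_cancel_left]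

lemma weightedD_succ_sub_le (b : RunBounds P S T) (hI : 0 < I) (hT : IsGenerated P S T)
    (hA : AdmissibleWeights S.E S.A κ) (hγ : AdmissibleStep S.γ) (ν : ℕ) :
    ‖weightedD T (ν + 1) - weightedD T ν‖ ≤ S.γ ν * b.d := by
  rw [b.weightedD_succ hT hA]
  calc _ ≤ ∑ j, T.φ ν j / I * (S.γ ν * b.d) := norm_sum_le_of_le _ fun j _ => by
        rw [norm_smul, norm_smul, Real.norm_of_nonneg (b.weight_nonneg ν j),
          Real.norm_of_nonneg (hγ.pos ν).le]
        exact mul_le_mul_of_nonneg_left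
          (mul_le_mul_of_nonneg_left (b.Dt_sub_le hT ν j) (hγ.pos ν).le) (b.weight_nonneg ν j)
    _ = _ := by rw [← Finset.sum_mul, sum_weight hI hT hA, one_mul]

lemma D_succ_sub_le (b : RunBounds P S T) (hT : IsGenerated P S T)
    (hA : AdmissibleWeights S.E S.A κ) (hγ : AdmissibleStep S.γ) (ν : ℕ) (i : Fin I) :
    ‖T.D (ν + 1) i - T.D ν i‖ ≤ spread (T.D ν) + S.γ ν * b.d := by
  rw [norm_sub_rev, D_succ hT hA]
  refine norm_sub_average_le (mixing_nonneg hA b.φ_pos ν i) (mixing_row_sum hT hA b.φ_pos ν i)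
    fun j => ?_
  have e : T.D ν i - T.U ν j = (T.D ν i - T.D ν j) - (T.U ν j - T.D ν j) := by abel
  rw [e]
  exact (norm_sub_le _ _).trans
    (add_le_add (norm_sub_le_spread (T.D ν) i j) (b.U_sub_D_le hT hγ ν j))

lemma X_mem_domX (b : RunBounds P S T) (hP : P.Standing L) (ν : ℕ) (i : Fin I) :
    T.X ν i ∈ P.domX i := hP.setX_subset i (b.s_subset i (b.X_mem ν i))

lemma norm_gradDF_sub_le (b : RunBounds P S T) (hP : P.Standing L) (ν : ℕ) {D D' : Mat M K}
    (hD : D ∈ P.setD) (hD' : D' ∈ P.setD) :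
    ‖P.gradDF D (T.X ν) - P.gradDF D' (T.X ν)‖ ≤ I * b.Λ * ‖D - D'‖ := by
  rw [hP.gradDF_eq (hP.setD_subset hD) (b.X_mem_domX hP ν),
    hP.gradDF_eq (hP.setD_subset hD') (b.X_mem_domX hP ν), ← Finset.sum_sub_distrib]
  calc _ ≤ ∑ _i : Fin I, b.Λ * ‖D - D'‖ := norm_sum_le_of_le _ fun i _ => by
        simpa using b.gradD_lip i D hD D' hD' _ (b.X_mem ν i) _ (b.X_mem ν i)
    _ = _ := by simp [mul_assoc]

/-- Accuracy of the tracked gradients. -/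
lemma tracking_le (b : RunBounds P S T) (hI : 0 < I) (hP : P.Standing L) (hT : IsGenerated P S T)
    (hA : AdmissibleWeights S.E S.A κ) (ν : ℕ) (j : Fin I) {D' : Mat M K} (hD' : D' ∈ P.setD)
    (h : ∀ i, ‖T.D ν i - D'‖ ≤ spread (T.D ν)) :
    ‖P.gradDF D' (T.X ν) - (I : ℝ) • T.Θ ν j‖ ≤
      I * (spread (T.Θ ν) + b.Λ * spread (T.D ν)) := by
  have hI0 : (I : ℝ) ≠ 0 := by exact_mod_cast hI.ne'
  have h1 : ‖T.Θ ν j - ∑ i, (T.φ ν i / I) • T.Θ ν i‖ ≤ spread (T.Θ ν) :=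
    norm_sub_average_le (b.weight_nonneg ν) (sum_weight hI hT hA ν) fun i =>
      norm_sub_le_spread (T.Θ ν) j i
  have h2 : (I : ℝ) • ∑ i, (T.φ ν i / I) • T.Θ ν i = ∑ i, P.gradD i (T.D ν i) (T.X ν i) := by
    rw [← sum_φ_smul_Θ hT hA b.φ_pos, Finset.smul_sum]
    refine Finset.sum_congr rfl fun i _ => ?_
    rw [smul_smul, mul_div_cancel₀ _ hI0]
  have h3 : ‖P.gradDF D' (T.X ν) - ∑ i, P.gradD i (T.D ν i) (T.X ν i)‖ ≤
      I * (b.Λ * spread (T.D ν)) := by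
    rw [hP.gradDF_eq (hP.setD_subset hD') (b.X_mem_domX hP ν), ← Finset.sum_sub_distrib]
    calc _ ≤ ∑ _i : Fin I, b.Λ * spread (T.D ν) := norm_sum_le_of_le _ fun i _ => by
          have := b.gradD_lip i D' hD' _ (b.D_mem ν i) _ (b.X_mem ν i) _ (b.X_mem ν i)
          rw [sub_self, norm_zero, add_zero, norm_sub_rev D'] at this
          exact this.trans (mul_le_mul_of_nonneg_left (h i) b.Λ_nonneg)
      _ = _ := by simp
  have e : P.gradDF D' (T.X ν) - (I : ℝ) • T.Θ ν j =
      (P.gradDF D' (T.X ν) - ∑ i, P.gradD i (T.D ν i) (T.X ν i)) -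
        (I : ℝ) • (T.Θ ν j - ∑ i, (T.φ ν i / I) • T.Θ ν i) := by
    rw [smul_sub, h2]; abel
  rw [e]
  refine (norm_sub_le _ _).trans ?_
  rw [norm_smul, Real.norm_of_nonneg (Nat.cast_nonneg _)]
  have := mul_le_mul_of_nonneg_left h1 (Nat.cast_nonneg (α := ℝ) I)
  linarith

lemma norm_innovation_le (b : RunBounds P S T) (hT : IsGenerated P S T)
    (hA : AdmissibleWeights S.E S.A κ) (hγ : AdmissibleStep S.γ) (ν : ℕ) (i : Fin I) :
    ‖innovation P T ν i‖ ≤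
      b.Λ / b.c * (spread (T.D ν) + S.γ ν * b.d + √(changeX T ν)) := by
  have h1 := b.gradD_lip i _ (b.D_mem (ν + 1) i) _ (b.D_mem ν i) _ (b.X_mem (ν + 1) i) _
    (b.X_mem ν i)
  have h2 : 1 / T.φ (ν + 1) i ≤ 1 / b.c := one_div_le_one_div_of_le b.c_pos (b.φ_ge _ _)
  rw [innovation, norm_smul, Real.norm_of_nonneg (one_div_nonneg.2 (b.φ_pos _ _).le)]
  calc _ ≤ 1 / b.c * (b.Λ * (spread (T.D ν) + S.γ ν * b.d + √(changeX T ν))) := by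
        refine mul_le_mul h2 (h1.trans ?_) (norm_nonneg _) (one_div_nonneg.2 b.c_pos.le)
        exact mul_le_mul_of_nonneg_left
          (add_le_add (b.D_succ_sub_le hT hA hγ ν i) (norm_X_sub_le_sqrt T ν i)) b.Λ_nonneg
    _ = _ := by ring

lemma slopeD_sub_le (b : RunBounds P S T) (hT : IsGenerated P S T) (s : Surrogate) (ν : ℕ)
    (i : Fin I) :
    ‖slopeD P s i (T.D ν i) (T.X ν i) (T.Dt ν i) - P.gradD i (T.D ν i) (T.X ν i)‖ ≤
      b.Λ * ‖T.Dt ν i - T.D ν i‖ := by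
  cases s
  · simpa [slopeD] using b.gradD_lip i _ (Dt_mem hT ν i) _ (b.D_mem ν i) _ (b.X_mem ν i) _
      (b.X_mem ν i)
  · simpa [slopeD] using mul_nonneg b.Λ_nonneg (norm_nonneg _)

lemma slopeX_sub_le (b : RunBounds P S T) (s : Surrogate) (ν : ℕ) (i : Fin I) {D : Mat M K}
    (hD : D ∈ P.setD) :
    ‖P.gradX i D (T.X ν i) - slopeX P s i (T.U ν i) (T.X ν i) (T.X (ν + 1) i)‖ ≤
      b.Λ * (‖D - T.U ν i‖ + ‖T.X (ν + 1) i - T.X ν i‖) := by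
  cases s
  · have := b.gradX_lip i _ hD _ (b.U_mem ν i) _ (b.X_mem ν i) _ (b.X_mem (ν + 1) i)
    rwa [norm_sub_rev (T.X ν i)] at this
  · have := b.gradX_lip i _ hD _ (b.U_mem ν i) _ (b.X_mem ν i) _ (b.X_mem ν i)
    rw [sub_self, norm_zero] at this
    exact this.trans (mul_le_mul_of_nonneg_left (by gcongr; positivity) b.Λ_nonneg)

lemma dictionary_optimality (b : RunBounds P S T) (hP : P.Standing L) (hT : IsGenerated P S T)
    (ν : ℕ) (i : Fin I) {y : Mat M K} (hy : y ∈ P.setD) :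
    0 ≤ inner ℝ ((slopeD P (S.kindD ν i) i (T.D ν i) (T.X ν i) (T.Dt ν i)
        - P.gradD i (T.D ν i) (T.X ν i)) + S.τD ν i • (T.Dt ν i - T.D ν i)
        + (I : ℝ) • T.Θ ν i) (y - T.Dt ν i) + (P.G y - P.G (T.Dt ν i)) := by
  have := surrogateD_optimality hP (b.s_subset i (b.X_mem ν i)) (hT.step_Dt ν i) hy
  convert this using 3
  abel

/-- The local dictionary direction is a descent direction, up to the tracking error. -/
lemma dictionary_descent (b : RunBounds P S T) (hP : P.Standing L) (hT : IsGenerated P S T)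
    (ν : ℕ) (i : Fin I) :
    inner ℝ ((I : ℝ) • T.Θ ν i) (T.Dt ν i - T.D ν i) + (P.G (T.Dt ν i) - P.G (T.D ν i)) ≤
      -(b.τ₀ * ‖T.Dt ν i - T.D ν i‖ ^ 2) := by
  have h1 := b.dictionary_optimality hP hT ν i (b.D_mem ν i)
  rw [← neg_sub (T.Dt ν i), inner_neg_right, inner_add_left, inner_add_left,
    real_inner_smul_left (T.Dt ν i - T.D ν i), real_inner_self_eq_norm_sq] at h1
  -- Monotonicity of the gradient for the proximal surrogate, and zero for the linearized one; the
  -- proximal weight alone provides the decrease.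
  have h2 : 0 ≤ inner ℝ (slopeD P (S.kindD ν i) i (T.D ν i) (T.X ν i) (T.Dt ν i)
      - P.gradD i (T.D ν i) (T.X ν i)) (T.Dt ν i - T.D ν i) := by
    cases S.kindD ν i
    · exact gradD_monotone hP (hP.setD_subset (Dt_mem hT ν i)) (hP.setD_subset (b.D_mem ν i))
        (b.X_mem_domX hP ν i)
    · simp [slopeD]
  have h3 := mul_le_mul_of_nonneg_right (b.τD_ge ν i) (sq_nonneg ‖T.Dt ν i - T.D ν i‖)
  linarith

end RunBounds

/-! ### The potential and its decrease. -/

/-- The average of the nonsmooth dictionary terms, weighted by the push-sum masses. -/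
def averageG (P : Problem I M K n) (T : Iterates I M K n) (ν : ℕ) : ℝ :=
  ∑ i, T.φ ν i / I * P.G (T.D ν i)

/-- The potential that decreases along the iterations, up to summable errors. -/
def potential (P : Problem I M K n) (T : Iterates I M K n) (ν : ℕ) : ℝ :=
  P.F (weightedD T ν) (T.X ν) + ∑ i, P.g i (T.X ν i) + averageG P T ν

namespace RunBounds

/-- Jensen's inequality for the mixing, conservation of the `φ`-average, then convexity along the
step towards `Dt`. The difference `G Dt - G D` survives with its exact weight, so that it can be
paired agent by agent with `dictionary_descent`. -/
lemma averageG_succ_le (b : RunBounds P S T) (hP : P.Standing L) (hT : IsGenerated P S T)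
    (hA : AdmissibleWeights S.E S.A κ) (hγ : AdmissibleStep S.γ) (ν : ℕ) :
    averageG P T (ν + 1) ≤ averageG P T ν +
      ∑ j, T.φ ν j / I * (S.γ ν * (P.G (T.Dt ν j) - P.G (T.D ν j))) := by
  have hG : ConvexOn ℝ P.setD P.G := hP.convex_G.subset hP.setD_subset hP.convex_setD
  have h1 : ∀ i, P.G (T.D (ν + 1) i) ≤ ∑ j, mixing S T ν i j • P.G (T.U ν j) := fun i => by
    rw [D_succ hT hA]
    exact hG.map_sum_le (fun j _ => mixing_nonneg hA b.φ_pos ν i j)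
      (mixing_row_sum hT hA b.φ_pos ν i) fun j _ => b.U_mem ν j
  have h2 : ∀ j, P.G (T.U ν j) ≤
      P.G (T.D ν j) + S.γ ν * (P.G (T.Dt ν j) - P.G (T.D ν j)) := fun j => by
    rw [U_eq hT]
    have := hG.2 (b.D_mem ν j) (Dt_mem hT ν j) (sub_nonneg.2 (hγ.le_one ν)) (hγ.pos ν).le (by ring)
    simp only [smul_eq_mul] at this
    linarith
  calc averageG P T (ν + 1)
      ≤ ∑ i, (T.φ (ν + 1) i / I) • ∑ j, mixing S T ν i j • P.G (T.U ν j) :=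
        Finset.sum_le_sum fun i _ => mul_le_mul_of_nonneg_left (h1 i) (b.weight_nonneg _ i)
    _ = ∑ j, (T.φ ν j / I) • P.G (T.U ν j) := b.sum_weight_succ hA ν _
    _ ≤ ∑ j, T.φ ν j / I * (P.G (T.D ν j) + S.γ ν * (P.G (T.Dt ν j) - P.G (T.D ν j))) :=
        Finset.sum_le_sum fun j _ => mul_le_mul_of_nonneg_left (h2 j) (b.weight_nonneg _ j)
    _ = _ := by simp only [mul_add, Finset.sum_add_distrib, averageG]

/-- Decrease of the potential in the dictionary step. -/
lemma dictionary_step_le (b : RunBounds P S T) (hI : 0 < I) (hP : P.Standing L)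
    (hT : IsGenerated P S T) (hA : AdmissibleWeights S.E S.A κ) (hγ : AdmissibleStep S.γ) (ν : ℕ) :
    P.F (weightedD T (ν + 1)) (T.X ν) + averageG P T (ν + 1) ≤
      P.F (weightedD T ν) (T.X ν) + averageG P T ν
        - b.τ₀ * b.c / I * (S.γ ν * changeD T ν)
        + S.γ ν * (I * (spread (T.Θ ν) + b.Λ * spread (T.D ν)) * b.d)
        + I * b.Λ / 2 * (S.γ ν * b.d) ^ 2 := by
  have hw := b.weightedD_mem hI hP hT hA
  have hsmooth := hP.convex_setD.descent (h := fun D => P.F D (T.X ν))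
    (h' := fun D => P.gradDF D (T.X ν))
    (fun D hD => hP.hasGradientAt_F (hP.setD_subset hD) (b.X_mem_domX hP ν))
    (fun D hD => b.norm_gradDF_sub_le hP ν hD (hw ν)) (hw ν) (hw (ν + 1))
  have hsq : I * b.Λ / 2 * ‖weightedD T (ν + 1) - weightedD T ν‖ ^ 2 ≤
      I * b.Λ / 2 * (S.γ ν * b.d) ^ 2 := by
    have := b.Λ_nonneg
    gcongr
    exact b.weightedD_succ_sub_le hI hT hA hγ ν
  have hG := b.averageG_succ_le hP hT hA hγ ν
  set e := I * (spread (T.Θ ν) + b.Λ * spread (T.D ν)) * b.d with he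
  have hinner : inner ℝ (P.gradDF (weightedD T ν) (T.X ν)) (weightedD T (ν + 1) - weightedD T ν) +
      ∑ j, T.φ ν j / I * (S.γ ν * (P.G (T.Dt ν j) - P.G (T.D ν j))) ≤
      S.γ ν * e - b.τ₀ * b.c / I * (S.γ ν * changeD T ν) := by
    rw [b.weightedD_succ hT hA, inner_sum, ← Finset.sum_add_distrib]
    -- The lower bound `c / I` on the weights is used only for the decrease; the error keeps its
    -- exact weights, which sum to one.
    have hterm : ∀ j, inner ℝ (P.gradDF (weightedD T ν) (T.X ν))
        ((T.φ ν j / I) • (S.γ ν • (T.Dt ν j - T.D ν j))) +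
        T.φ ν j / I * (S.γ ν * (P.G (T.Dt ν j) - P.G (T.D ν j))) ≤
        T.φ ν j / I * (S.γ ν * e) - b.c / I * (S.γ ν * (b.τ₀ * ‖T.Dt ν j - T.D ν j‖ ^ 2)) := by
      intro j
      have h1 := b.dictionary_descent hP hT ν j
      have h2 : inner ℝ (P.gradDF (weightedD T ν) (T.X ν) - (I : ℝ) • T.Θ ν j)
          (T.Dt ν j - T.D ν j) ≤ e := by
        refine (real_inner_le_norm _ _).trans (mul_le_mul ?_ (b.Dt_sub_le hT ν j)
          (norm_nonneg _) ?_)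
        · exact b.tracking_le hI hP hT hA ν j (hw ν) (b.D_sub_weightedD_le hI hT hA ν)
        · have := b.Λ_nonneg
          have := spread_nonneg (T.Θ ν)
          have := spread_nonneg (T.D ν)
          positivity
      rw [inner_sub_left] at h2
      rw [real_inner_smul_right, real_inner_smul_right]
      have h3 : b.c / I ≤ T.φ ν j / I := by
        have := b.φ_ge ν j
        gcongr
      have h4 : 0 ≤ S.γ ν * (b.τ₀ * ‖T.Dt ν j - T.D ν j‖ ^ 2) :=
        mul_nonneg (hγ.pos ν).le (mul_nonneg b.τ₀_pos.le (sq_nonneg _))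
      have h5 := mul_le_mul_of_nonneg_right h3 h4
      have h6 : inner ℝ (P.gradDF (weightedD T ν) (T.X ν)) (T.Dt ν j - T.D ν j)
          + (P.G (T.Dt ν j) - P.G (T.D ν j)) ≤ e - b.τ₀ * ‖T.Dt ν j - T.D ν j‖ ^ 2 := by linarith
      have h7 := mul_le_mul_of_nonneg_left (mul_le_mul_of_nonneg_left h6 (hγ.pos ν).le)
        (b.weight_nonneg ν j)
      linarith
    refine (Finset.sum_le_sum fun j _ => hterm j).trans (le_of_eq ?_)
    rw [Finset.sum_sub_distrib, ← Finset.sum_mul, sum_weight hI hT hA, ← Finset.mul_sum,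
      ← Finset.mul_sum, ← Finset.mul_sum, changeD]
    ring
  linarith

/-- The decrease in the coefficients is insensitive to small changes of the dictionary. -/
lemma mixed_difference_le (b : RunBounds P S T) (hP : P.Standing L) (i : Fin I) {D D' : Mat M K}
    (hD : D ∈ P.setD) (hD' : D' ∈ P.setD) {X X' : Mat K (n i)} (hX : X ∈ b.s i) (hX' : X' ∈ b.s i) :
    (P.f i D' X' - P.f i D' X) - (P.f i D X' - P.f i D X) ≤
      b.Λ * ‖X' - X‖ * ‖D' - D‖ := by
  have hdom : ∀ Y ∈ b.s i, Y ∈ P.domX i := fun Y hY => hP.setX_subset i (b.s_subset i hY)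
  refine (le_abs_self _).trans (hP.convex_setD.abs_sub_le_of_gradient
    (h := fun D => P.f i D X' - P.f i D X) (h' := fun D => P.gradD i D X' - P.gradD i D X)
    (fun z hz => ?_) (fun z hz => ?_) hD hD')
  · rw [hasGradientAt_iff_hasFDerivAt, map_sub]
    exact (hP.hasGradientAt_left (hP.setD_subset hz) (hdom _ hX')).hasFDerivAt.fun_sub
      (hP.hasGradientAt_left (hP.setD_subset hz) (hdom _ hX)).hasFDerivAt
  · simpa using b.gradD_lip i z hz z hz X' hX' X hX

/-- The (unsigned) change of the objective in the coefficient step of the first iteration. -/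
def initialDefect (b : RunBounds P S T) : ℝ :=
  ∑ i, |P.f i (T.U 0 i) (T.X 1 i) + P.g i (T.X 1 i) -
    (P.f i (T.U 0 i) (T.X 0 i) + P.g i (T.X 0 i) - b.ε * ‖T.X 1 i - T.X 0 i‖ ^ 2)|

/-- Decrease of the potential in the coefficient step. -/
lemma coefficient_step_le (b : RunBounds P S T) (hI : 0 < I) (hP : P.Standing L)
    (hT : IsGenerated P S T) (hA : AdmissibleWeights S.E S.A κ) (hγ : AdmissibleStep S.γ) (ν : ℕ) :
    P.F (weightedD T (ν + 1)) (T.X (ν + 1)) + ∑ i, P.g i (T.X (ν + 1) i) ≤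
      P.F (weightedD T (ν + 1)) (T.X ν) + ∑ i, P.g i (T.X ν i) - b.ε / 2 * changeX T ν
        + I * (b.Λ ^ 2 / (2 * b.ε) * (2 * (S.γ ν * b.d) + spread (T.D ν)) ^ 2)
        + Pi.single (M := fun _ => ℝ) 0 b.initialDefect ν := by
  have hw := b.weightedD_mem hI hP hT hA
  -- Decrease is guaranteed only for `ν ≥ 1`; whatever happens at `ν = 0` is charged once to
  -- `initialDefect`.
  have hfirst : ∑ i, (P.f i (T.U ν i) (T.X (ν + 1) i) + P.g i (T.X (ν + 1) i)) ≤
      ∑ i, (P.f i (T.U ν i) (T.X ν i) + P.g i (T.X ν i)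
        - b.ε * ‖T.X (ν + 1) i - T.X ν i‖ ^ 2)
        + Pi.single (M := fun _ => ℝ) 0 b.initialDefect ν := by
    rcases Nat.eq_zero_or_pos ν with rfl | hν
    · rw [Pi.single_eq_same, initialDefect, ← Finset.sum_add_distrib]
      refine Finset.sum_le_sum fun i _ => ?_
      rw [← sub_le_iff_le_add']
      exact le_abs_self _
    · rw [Pi.single_eq_of_ne hν.ne', add_zero]
      exact Finset.sum_le_sum fun i _ => b.decrease ν hν i
  have hdist : ∀ i, ‖weightedD T (ν + 1) - T.U ν i‖ ≤ 2 * (S.γ ν * b.d) + spread (T.D ν) := by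
    intro i
    have e : weightedD T (ν + 1) - T.U ν i = (weightedD T (ν + 1) - weightedD T ν)
        - (T.D ν i - weightedD T ν) - (T.U ν i - T.D ν i) := by abel
    rw [e]
    refine (norm_sub_le _ _).trans ?_
    have h0 := norm_sub_le (weightedD T (ν + 1) - weightedD T ν) (T.D ν i - weightedD T ν)
    linarith [b.weightedD_succ_sub_le hI hT hA hγ ν, b.D_sub_weightedD_le hI hT hA ν i,
      b.U_sub_D_le hT hγ ν i]
  -- The update decreases `f_i` at the agent's own `U`, while the potential evaluates it at
  -- `weightedD`. Young's inequality pays for the change of base point with half of the available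
  -- decrease.
  have hmixed : ∀ i,
      P.f i (weightedD T (ν + 1)) (T.X (ν + 1) i) - P.f i (weightedD T (ν + 1)) (T.X ν i) ≤
      P.f i (T.U ν i) (T.X (ν + 1) i) - P.f i (T.U ν i) (T.X ν i)
        + b.ε / 2 * ‖T.X (ν + 1) i - T.X ν i‖ ^ 2
        + b.Λ ^ 2 / (2 * b.ε) * (2 * (S.γ ν * b.d) + spread (T.D ν)) ^ 2 := by
    intro i
    have h1 := b.mixed_difference_le hP i (b.U_mem ν i) (hw (ν + 1)) (b.X_mem ν i)
      (b.X_mem (ν + 1) i)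
    set r := ‖T.X (ν + 1) i - T.X ν i‖
    set q := 2 * (S.γ ν * b.d) + spread (T.D ν)
    have h2 : b.Λ * r * ‖weightedD T (ν + 1) - T.U ν i‖ ≤ b.Λ * r * q :=
      mul_le_mul_of_nonneg_left (hdist i) (mul_nonneg b.Λ_nonneg (norm_nonneg _))
    have h3 : b.ε / 2 * r ^ 2 + b.Λ ^ 2 / (2 * b.ε) * q ^ 2 - b.Λ * r * q =
        (b.ε * r - b.Λ * q) ^ 2 / (2 * b.ε) := by
      have := b.ε_pos.ne'
      field_simp
      ring
    have h4 : 0 ≤ (b.ε * r - b.Λ * q) ^ 2 / (2 * b.ε) := by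
      have := b.ε_pos
      positivity
    linarith
  have hsum := Finset.sum_le_sum fun i (_ : i ∈ Finset.univ) => hmixed i
  simp only [Finset.sum_sub_distrib, Finset.sum_add_distrib, Finset.sum_const, Finset.card_univ,
    Fintype.card_fin, nsmul_eq_mul, ← Finset.mul_sum] at hsum hfirst
  simp only [Problem.F]
  change _ ≤ _ at hsum
  rw [← changeX] at hsum hfirst
  linarith

lemma potential_succ_le (b : RunBounds P S T) (hI : 0 < I) (hP : P.Standing L)
    (hT : IsGenerated P S T) (hA : AdmissibleWeights S.E S.A κ) (hγ : AdmissibleStep S.γ) (ν : ℕ) :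
    potential P T (ν + 1) + b.ε / 2 * changeX T ν + b.τ₀ * b.c / I * (S.γ ν * changeD T ν) ≤
      potential P T ν + (S.γ ν * (I * (spread (T.Θ ν) + b.Λ * spread (T.D ν)) * b.d)
        + I * b.Λ / 2 * (S.γ ν * b.d) ^ 2
        + I * (b.Λ ^ 2 / (2 * b.ε) * (2 * (S.γ ν * b.d) + spread (T.D ν)) ^ 2)
        + Pi.single (M := fun _ => ℝ) 0 b.initialDefect ν) := by
  have h1 := b.dictionary_step_le hI hP hT hA hγ ν
  have h2 := b.coefficient_step_le hI hP hT hA hγ ν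
  simp only [potential]
  linarith

/-- The potential is bounded below. -/
lemma exists_le_potential (b : RunBounds P S T) (hI : 0 < I) (hP : P.Standing L)
    (hT : IsGenerated P S T) (hA : AdmissibleWeights S.E S.A κ) :
    ∃ m : ℝ, ∀ ν, m ≤ potential P T ν := by
  choose cf hcf using hP.bddBelow_f
  have hg : ∀ i, ∃ m, ∀ X ∈ b.s i, m ≤ P.g i X := fun i => by
    have hc := ((hP.convex_g i).continuousOn (hP.isOpen_domX i)).mono
      ((b.s_subset i).trans (hP.setX_subset i))
    obtain ⟨m, hm⟩ := (b.s_compact i).bddBelow_image hc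
    exact ⟨m, fun X hX => hm ⟨X, hX, rfl⟩⟩
  choose cg hcg using hg
  obtain ⟨cG, hcG⟩ := hP.isCompact_setD.bddBelow_image
    ((hP.convex_G.continuousOn hP.isOpen_domD).mono hP.setD_subset)
  refine ⟨∑ i, cf i + ∑ i, cg i + cG, fun ν => add_le_add (add_le_add ?_ ?_) ?_⟩
  · exact Finset.sum_le_sum fun i _ => hcf i _ (hP.setD_subset (b.weightedD_mem hI hP hT hA ν)) _
      (b.X_mem_domX hP ν i)
  · exact Finset.sum_le_sum fun i _ => hcg i _ (b.X_mem ν i)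
  · calc cG = ∑ i, T.φ ν i / I * cG := by rw [← Finset.sum_mul, sum_weight hI hT hA, one_mul]
      _ ≤ _ := Finset.sum_le_sum fun i _ => mul_le_mul_of_nonneg_left
          (hcG ⟨_, b.D_mem ν i, rfl⟩) (b.weight_nonneg ν i)

end RunBounds

/-! ### Comparison of proximal solutions. -/

lemma maxNorm_nonneg {r c : ℕ} (A : Mat r c) : 0 ≤ maxNorm A := norm_nonneg _

lemma maxNorm_le_norm {r c : ℕ} (A : Mat r c) : maxNorm A ≤ ‖A‖ :=
  (pi_norm_le_iff_of_nonneg (norm_nonneg A)).2 fun p => PiLp.norm_apply_le A p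

/-- Comparison of the solutions of two proximal subproblems. -/
lemma mul_norm_sub_le_of_variational {E : Type*} [NormedAddCommGroup E] [InnerProductSpace ℝ E]
    {τ e : ℝ} {a a' x z w : E} (h1 : 0 ≤ inner ℝ (a + τ • (z - x)) (w - z) + e)
    (h2 : 0 ≤ inner ℝ a' (z - w) - e) : τ * ‖w - z‖ ≤ ‖a - a' + τ • (w - x)‖ := by
  have h3 : τ * ‖w - z‖ ^ 2 ≤ inner ℝ (a - a' + τ • (w - x)) (w - z) := by
    have e1 : a + τ • (z - x) = (a - a' + τ • (w - x)) - τ • (w - z) + a' := by module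
    rw [e1, inner_add_left, inner_sub_left, real_inner_smul_left (w - z),
      real_inner_self_eq_norm_sq] at h1
    rw [← neg_sub w z, inner_neg_right] at h2
    linarith
  have h4 := h3.trans (real_inner_le_norm _ _)
  rcases (norm_nonneg (w - z)).eq_or_lt with h0 | hpos
  · rw [← h0, mul_zero]; exact norm_nonneg _
  · rw [pow_two, ← mul_assoc] at h4
    exact le_of_mul_le_mul_right h4 hpos

/-! ### Hitting times from weighted sums of squares. -/

section Hitting

/-- The first time at which a weighted square-summable sequence is small. -/
lemma exists_isLeast_hitting {a w : ℕ → ℝ} {Q : ℝ} (hw : ∀ ν, 0 ≤ w ν)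
    (htop : Tendsto (fun N => ∑ ν ∈ Finset.range N, w ν) atTop atTop)
    (hQ : ∀ N, ∑ ν ∈ Finset.range N, w ν * a ν ^ 2 ≤ Q) {ε : ℝ} (hε : 0 < ε) :
    ∃ N : ℕ, IsLeast {ν : ℕ | a ν ≤ ε} N ∧ ε ^ 2 * ∑ ν ∈ Finset.range N, w ν ≤ Q := by
  classical
  have key : ∀ N, (∀ ν < N, ε < a ν) → ε ^ 2 * ∑ ν ∈ Finset.range N, w ν ≤ Q := fun N hN => by
    refine le_trans ?_ (hQ N)
    rw [Finset.mul_sum]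
    refine Finset.sum_le_sum fun ν hν => ?_
    rw [mul_comm]
    have := (hN ν (Finset.mem_range.1 hν)).le
    exact mul_le_mul_of_nonneg_left (by gcongr) (hw ν)
  have hex : ∃ N, a N ≤ ε := by
    by_contra! hall
    obtain ⟨N, hN⟩ := (htop.eventually_gt_atTop (Q / ε ^ 2)).exists
    rw [div_lt_iff₀ (by positivity)] at hN
    linarith [key N fun ν _ => hall ν]
  exact ⟨Nat.find hex, ⟨Nat.find_spec hex, fun ν hν => Nat.find_min' hex hν⟩,
    key _ fun ν hν => not_le.1 (Nat.find_min hex hν)⟩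

end Hitting

lemma sq_add_three_le (a b c : ℝ) : (a + b + c) ^ 2 ≤ 3 * (a ^ 2 + b ^ 2 + c ^ 2) := by
  nlinarith [sq_nonneg (a - b), sq_nonneg (b - c), sq_nonneg (a - c)]

/-! ### Merit functions bounded by the algorithm's own changes. -/

namespace RunBounds

/-- `hatX` and the next iterate satisfy variational inequalities with the same `g`, so their
distance is controlled by the mismatch of the slopes: different dictionaries, different
linearization points and different proximal weights. -/
lemma hatX_sub_le (b : RunBounds P S T) (hI : 0 < I) (hP : P.Standing L) (hT : IsGenerated P S T)
    (hγ : AdmissibleStep S.γ) {τ : ℝ} (hτ : 0 < τ) (ν : ℕ) (i : Fin I) :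
    ‖hatX P τ i (T.avgD ν) (T.X ν i) - T.X ν i‖ ≤
      (1 + (b.Λ * (2 + b.d) + b.τ₂ + τ) / τ) * (√(changeX T ν) + spread (T.D ν) + S.γ ν) := by
  have hXs : T.X ν i ∈ P.setX i := b.s_subset i (b.X_mem ν i)
  have hDavg := b.avgD_mem hI hP ν
  have hhat : IsArgmin (P.setX i) _ (hatX P τ i (T.avgD ν) (T.X ν i)) :=
    Classical.epsilon_spec (exists_isArgmin_prox (hP.isClosed_setX i) (hP.isOpen_domX i)
      (hP.setX_subset i) (hP.convex_g i) hτ (P.gradX i (T.avgD ν) (T.X ν i)) hXs)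
  set Xh := hatX P τ i (T.avgD ν) (T.X ν i) with hXh
  have h1 := hhat.2.variational_inequality
    ((hP.convex_g i).subset (hP.setX_subset i) (hP.convex_setX i)) hhat.1 (hT.step_X ν i).1
    ((hasGradientAt_inner_sub (P.gradX i (T.avgD ν) (T.X ν i)) (T.X ν i) Xh).fun_add
      (hasGradientAt_prox τ (T.X ν i) Xh))
  have h2 := surrogateX_optimality hP (b.U_mem ν i) (hT.step_X ν i) hhat.1
  rw [← neg_sub (P.g i (T.X (ν + 1) i)), ← sub_eq_add_neg] at h2
  have h3 := mul_norm_sub_le_of_variational h1 h2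
  set r := ‖T.X (ν + 1) i - T.X ν i‖ with hr
  have hUavg : ‖T.avgD ν - T.U ν i‖ ≤ spread (T.D ν) + S.γ ν * b.d := by
    have e : T.avgD ν - T.U ν i = -((T.D ν i - T.avgD ν) + (T.U ν i - T.D ν i)) := by abel
    rw [e, norm_neg]
    exact (norm_add_le _ _).trans (add_le_add (D_sub_avgD_le hI T ν i) (b.U_sub_D_le hT hγ ν i))
  have h4 := b.slopeX_sub_le (S.kindX ν i) ν i hDavg
  have h5 : ‖P.gradX i (T.avgD ν) (T.X ν i) -
      (slopeX P (S.kindX ν i) i (T.U ν i) (T.X ν i) (T.X (ν + 1) i)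
        + S.τX ν i • (T.X (ν + 1) i - T.X ν i)) + τ • (T.X (ν + 1) i - T.X ν i)‖ ≤
      b.Λ * (spread (T.D ν) + S.γ ν * b.d + r) + b.τ₂ * r + τ * r := by
    rw [← sub_sub]
    refine (norm_add_le _ _).trans (add_le_add ((norm_sub_le _ _).trans (add_le_add ?_ ?_)) ?_)
    · exact h4.trans (mul_le_mul_of_nonneg_left (by linarith) b.Λ_nonneg)
    · rw [norm_smul, Real.norm_of_nonneg (b.τX_pos ν i).le]
      exact mul_le_mul_of_nonneg_right (b.τX_le ν i) (norm_nonneg _)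
    · rw [norm_smul, Real.norm_of_nonneg hτ.le]
  set q := √(changeX T ν) + spread (T.D ν) + S.γ ν with hq
  have hr0 : 0 ≤ r := norm_nonneg _
  have hs0 := spread_nonneg (T.D ν)
  have hg0 := (hγ.pos ν).le
  have hrs : r ≤ √(changeX T ν) := norm_X_sub_le_sqrt T ν i
  have hrq : r ≤ q := by linarith
  have hsq : spread (T.D ν) ≤ q := by linarith [Real.sqrt_nonneg (changeX T ν)]
  have hgq : S.γ ν ≤ q := by linarith [Real.sqrt_nonneg (changeX T ν)]
  have hτ2 : 0 ≤ b.τ₂ := (b.τX_pos ν i).le.trans (b.τX_le ν i)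
  have h6 : τ * ‖T.X (ν + 1) i - Xh‖ ≤ (b.Λ * (2 + b.d) + b.τ₂ + τ) * q := by
    have k1 : S.γ ν * b.d ≤ q * b.d := mul_le_mul_of_nonneg_right hgq b.d_nonneg
    have k2 : b.Λ * (spread (T.D ν) + S.γ ν * b.d + r) ≤ b.Λ * (q + q * b.d + q) :=
      mul_le_mul_of_nonneg_left (by linarith) b.Λ_nonneg
    have k3 := mul_le_mul_of_nonneg_left hrq hτ2
    have k4 := mul_le_mul_of_nonneg_left hrq hτ.le
    linarith
  have h7 : ‖T.X (ν + 1) i - Xh‖ ≤ (b.Λ * (2 + b.d) + b.τ₂ + τ) / τ * q := by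
    rw [div_mul_eq_mul_div, le_div_iff₀ hτ]
    linarith
  have e : Xh - T.X ν i = (T.X (ν + 1) i - T.X ν i) - (T.X (ν + 1) i - Xh) := by abel
  rw [e]
  refine (norm_sub_le _ _).trans ?_
  linarith

lemma meritX_sq_le (b : RunBounds P S T) (hI : 0 < I) (hP : P.Standing L) (hT : IsGenerated P S T)
    (hγ : AdmissibleStep S.γ) {τ : ℝ} (hτ : 0 < τ) :
    ∃ C : ℝ, 0 ≤ C ∧ ∀ ν, meritX P τ (T.avgD ν) (T.X ν) ^ 2 ≤
      C * (changeX T ν + spread (T.D ν) ^ 2 + S.γ ν ^ 2) := by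
  have : Nonempty (Fin I) := ⟨⟨0, hI⟩⟩
  refine ⟨(1 + (b.Λ * (2 + b.d) + b.τ₂ + τ) / τ) ^ 2 * 3, by positivity, fun ν => ?_⟩
  have h0 : 0 ≤ meritX P τ (T.avgD ν) (T.X ν) := Real.iSup_nonneg fun i => maxNorm_nonneg _
  have h1 : meritX P τ (T.avgD ν) (T.X ν) ≤ _ := ciSup_le fun i =>
    (maxNorm_le_norm _).trans (b.hatX_sub_le hI hP hT hγ hτ ν i)
  have h2 := sq_add_three_le (√(changeX T ν)) (spread (T.D ν)) (S.γ ν)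
  rw [Real.sq_sqrt (changeX_nonneg T ν)] at h2
  calc _ ≤ ((1 + (b.Λ * (2 + b.d) + b.τ₂ + τ) / τ) *
        (√(changeX T ν) + spread (T.D ν) + S.γ ν)) ^ 2 := by gcongr
    _ ≤ _ := by
        rw [mul_pow, mul_assoc]
        exact mul_le_mul_of_nonneg_left h2 (sq_nonneg _)

/-- As for the coefficients, with `hatD` compared to the local solution `Dt` of a single agent. Any
agent would do, because each tracks the full gradient up to the spreads. -/
lemma hatD_sub_le (b : RunBounds P S T) (hI : 0 < I) (hP : P.Standing L) (hT : IsGenerated P S T)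
    (hA : AdmissibleWeights S.E S.A κ) {τ : ℝ} (hτ : 0 < τ) (ν : ℕ) :
    ‖hatD P τ (T.avgD ν) (T.X ν) - T.avgD ν‖ ≤
      (2 + (I * (1 + b.Λ) + b.Λ + b.τ₁ + 2 * τ) / τ) *
        (√(changeD T ν) + spread (T.D ν) + spread (T.Θ ν)) := by
  have hDavg := b.avgD_mem hI hP ν
  set i : Fin I := ⟨0, hI⟩
  obtain ⟨D₁, hD₁, hmin⟩ := hP.isCompact_setD.exists_isMinOn ⟨_, hDavg⟩
    (f := fun D' => inner ℝ (P.gradDF (T.avgD ν) (T.X ν)) (D' - T.avgD ν)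
      + τ / 2 * ‖D' - T.avgD ν‖ ^ 2 + P.G D')
    (ContinuousOn.add (by fun_prop)
      ((hP.convex_G.continuousOn hP.isOpen_domD).mono hP.setD_subset))
  have hhat : IsArgmin P.setD _ (hatD P τ (T.avgD ν) (T.X ν)) :=
    Classical.epsilon_spec (p := IsArgmin P.setD (fun D' =>
      inner ℝ (P.gradDF (T.avgD ν) (T.X ν)) (D' - T.avgD ν)
      + τ / 2 * ‖D' - T.avgD ν‖ ^ 2 + P.G D')) ⟨D₁, hD₁, hmin⟩
  set Dh := hatD P τ (T.avgD ν) (T.X ν) with hDh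
  have h1 := hhat.2.variational_inequality
    (hP.convex_G.subset hP.setD_subset hP.convex_setD) hhat.1 (Dt_mem hT ν i)
    ((hasGradientAt_inner_sub (P.gradDF (T.avgD ν) (T.X ν)) (T.avgD ν) Dh).fun_add
      (hasGradientAt_prox τ (T.avgD ν) Dh))
  have h2 := b.dictionary_optimality hP hT ν i hhat.1
  rw [← neg_sub (P.G (T.Dt ν i)), ← sub_eq_add_neg] at h2
  have h3 := mul_norm_sub_le_of_variational h1 h2
  set sl := slopeD P (S.kindD ν i) i (T.D ν i) (T.X ν i) (T.Dt ν i)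
    - P.gradD i (T.D ν i) (T.X ν i) with hsl
  set r := ‖T.Dt ν i - T.D ν i‖ with hr
  have hDtavg : ‖T.Dt ν i - T.avgD ν‖ ≤ r + spread (T.D ν) := by
    rw [← sub_add_sub_cancel _ (T.D ν i)]
    exact (norm_add_le _ _).trans (add_le_add le_rfl (D_sub_avgD_le hI T ν i))
  have h5 : ‖P.gradDF (T.avgD ν) (T.X ν) - (sl + S.τD ν i • (T.Dt ν i - T.D ν i)
      + (I : ℝ) • T.Θ ν i) + τ • (T.Dt ν i - T.avgD ν)‖ ≤
      I * (spread (T.Θ ν) + b.Λ * spread (T.D ν)) + b.Λ * r + b.τ₁ * r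
        + τ * (r + spread (T.D ν)) := by
    have e : P.gradDF (T.avgD ν) (T.X ν) - (sl + S.τD ν i • (T.Dt ν i - T.D ν i)
        + (I : ℝ) • T.Θ ν i) = (P.gradDF (T.avgD ν) (T.X ν) - (I : ℝ) • T.Θ ν i) - sl
        - S.τD ν i • (T.Dt ν i - T.D ν i) := by abel
    rw [e]
    refine (norm_add_le _ _).trans (add_le_add ((norm_sub_le _ _).trans
      (add_le_add ((norm_sub_le _ _).trans (add_le_add ?_ ?_)) ?_)) ?_)
    · exact b.tracking_le hI hP hT hA ν i hDavg (D_sub_avgD_le hI T ν)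
    · exact b.slopeD_sub_le hT _ ν i
    · rw [norm_smul, Real.norm_of_nonneg (b.τ₀_pos.le.trans (b.τD_ge ν i))]
      exact mul_le_mul_of_nonneg_right (b.τD_le ν i) (norm_nonneg _)
    · rw [norm_smul, Real.norm_of_nonneg hτ.le]
      exact mul_le_mul_of_nonneg_left hDtavg hτ.le
  set q := √(changeD T ν) + spread (T.D ν) + spread (T.Θ ν) with hq
  have hs0 := spread_nonneg (T.D ν)
  have ht0 := spread_nonneg (T.Θ ν)
  have hrs : r ≤ √(changeD T ν) := norm_Dt_sub_le_sqrt T ν i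
  have hc0 := Real.sqrt_nonneg (changeD T ν)
  have hrq : r ≤ q := by linarith
  have hsq : spread (T.D ν) ≤ q := by linarith
  have htq : spread (T.Θ ν) ≤ q := by linarith
  have hτ1 : 0 ≤ b.τ₁ := (b.τ₀_pos.le.trans (b.τD_ge ν i)).trans (b.τD_le ν i)
  have h6 : τ * ‖T.Dt ν i - Dh‖ ≤ (I * (1 + b.Λ) + b.Λ + b.τ₁ + 2 * τ) * q := by
    have k1 := mul_le_mul_of_nonneg_left hsq b.Λ_nonneg
    have k2 : I * (spread (T.Θ ν) + b.Λ * spread (T.D ν)) ≤ I * (q + b.Λ * q) :=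
      mul_le_mul_of_nonneg_left (by linarith) (Nat.cast_nonneg _)
    have k3 := mul_le_mul_of_nonneg_left hrq hτ1
    have k4 := mul_le_mul_of_nonneg_left hrq b.Λ_nonneg
    have k5 : τ * (r + spread (T.D ν)) ≤ τ * (q + q) :=
      mul_le_mul_of_nonneg_left (by linarith) hτ.le
    linarith
  have h7 : ‖T.Dt ν i - Dh‖ ≤ (I * (1 + b.Λ) + b.Λ + b.τ₁ + 2 * τ) / τ * q := by
    rw [div_mul_eq_mul_div, le_div_iff₀ hτ]
    linarith
  have e : Dh - T.avgD ν = (T.Dt ν i - T.avgD ν) - (T.Dt ν i - Dh) := by abel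
  rw [e]
  refine (norm_sub_le _ _).trans ?_
  linarith

lemma meritD_sq_le (b : RunBounds P S T) (hI : 0 < I) (hP : P.Standing L) (hT : IsGenerated P S T)
    (hA : AdmissibleWeights S.E S.A κ) {τ : ℝ} (hτ : 0 < τ) :
    ∃ C : ℝ, 0 ≤ C ∧ ∀ ν, meritD P τ (T.avgD ν) (T.X ν) ^ 2 ≤
      C * (changeD T ν + spread (T.D ν) ^ 2 + spread (T.Θ ν) ^ 2) := by
  refine ⟨(2 + (I * (1 + b.Λ) + b.Λ + b.τ₁ + 2 * τ) / τ) ^ 2 * 3, by positivity, fun ν => ?_⟩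
  have h0 : 0 ≤ meritD P τ (T.avgD ν) (T.X ν) := maxNorm_nonneg _
  have h1 : meritD P τ (T.avgD ν) (T.X ν) ≤ _ :=
    (maxNorm_le_norm _).trans (b.hatD_sub_le hI hP hT hA hτ ν)
  have h2 := sq_add_three_le (√(changeD T ν)) (spread (T.D ν)) (spread (T.Θ ν))
  rw [Real.sq_sqrt (changeD_nonneg T ν)] at h2
  calc _ ≤ ((2 + (I * (1 + b.Λ) + b.Λ + b.τ₁ + 2 * τ) / τ) *
        (√(changeD T ν) + spread (T.D ν) + spread (T.Θ ν))) ^ 2 := by gcongr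
    _ ≤ _ := by
        rw [mul_pow, mul_assoc]
        exact mul_le_mul_of_nonneg_left h2 (sq_nonneg _)

end RunBounds

/-! ### Summation and decay of scalar sequences. -/

section Rates

lemma AdmissibleStep.sum_sq_le {γ : ℕ → ℝ} (hγ : AdmissibleStep γ) (N : ℕ) :
    ∑ ν ∈ Finset.range N, γ ν ^ 2 ≤ ∑' ν, γ ν ^ 2 :=
  hγ.summable_sq.sum_le_tsum _ fun _ _ => sq_nonneg _

lemma sum_le_of_potential {W p e : ℕ → ℝ} {m : ℝ} (hm : ∀ ν, m ≤ W ν)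
    (h : ∀ ν, W (ν + 1) + p ν ≤ W ν + e ν) (N : ℕ) :
    ∑ ν ∈ Finset.range N, p ν ≤ W 0 - m + ∑ ν ∈ Finset.range N, e ν := by
  have key : W N + ∑ ν ∈ Finset.range N, p ν ≤ W 0 + ∑ ν ∈ Finset.range N, e ν := by
    induction N with
    | zero => simp
    | succ N ih =>
      rw [Finset.sum_range_succ, Finset.sum_range_succ]
      linarith [h N]
  linarith [hm N]

/-- The disagreement is square summable if the perturbation is. -/
lemma sum_sq_le_of_le_geomFilter {C ρ r : ℝ} {u x : ℕ → ℝ} (hρ : 0 < ρ) (hρ1 : ρ < 1)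
    (hx0 : ∀ ν, 0 ≤ x ν) (hx : ∀ ν, x ν ≤ C * geomFilter ρ r u ν) (N : ℕ) :
    ∑ ν ∈ Finset.range N, x ν ^ 2 ≤
      C ^ 2 * (r ^ 2 / (1 - ρ)) + C ^ 2 / (1 - ρ) ^ 2 * ∑ ν ∈ Finset.range N, u ν ^ 2 := by
  calc ∑ ν ∈ Finset.range N, x ν ^ 2 ≤ ∑ ν ∈ Finset.range N, C ^ 2 * geomFilter ρ r u ν ^ 2 :=
        Finset.sum_le_sum fun ν _ => by
          rw [← mul_pow]
          exact pow_le_pow_left₀ (hx0 ν) (hx ν) 2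
    _ ≤ C ^ 2 * (r ^ 2 / (1 - ρ) + (∑ ν ∈ Finset.range N, u ν ^ 2) / (1 - ρ) ^ 2) := by
        rw [← Finset.mul_sum]
        exact mul_le_mul_of_nonneg_left (sum_geomFilter_sq_le hρ hρ1 N) (sq_nonneg C)
    _ = _ := by ring

/-- A geometric filter of a slowly decaying step size is controlled by the step size at a
fixed fraction of the elapsed time. -/
lemma isBigO_geomFilter_ceil {ρ r c : ℝ} {u γ : ℕ → ℝ} (hρ : 0 < ρ) (hρ1 : ρ < 1) (hr : 0 ≤ r)
    (hc : 0 ≤ c) (hγ0 : ∀ ν, 0 < γ ν) (hγ : Antitone γ) (hu0 : ∀ ν, 0 ≤ u ν)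
    (hu : ∀ ν, u ν ≤ c * γ ν)
    (hslow : ∀ ρ ∈ Set.Ioo (0 : ℝ) 1, (fun ν : ℕ => ρ ^ ν) =o[atTop] γ) {θ : ℝ}
    (hθ : θ ∈ Set.Ioo (0 : ℝ) 1) :
    geomFilter ρ r u =O[atTop] (fun ν : ℕ => γ ⌈θ * (ν : ℝ)⌉₊) := by
  obtain ⟨hθ0, hθ1⟩ := hθ
  have h1ρ : 0 < 1 - ρ := by linarith
  set m : ℕ → ℕ := fun ν => ⌈θ * (ν : ℝ)⌉₊ with hm
  have hmtop : Tendsto m atTop atTop :=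
    tendsto_nat_ceil_atTop.comp (tendsto_natCast_atTop_atTop.const_mul_atTop hθ0)
  have hmle : ∀ ν, m ν ≤ ν := fun ν => Nat.ceil_le.2 (by
    have : (0 : ℝ) ≤ ν := Nat.cast_nonneg ν
    nlinarith)
  have huU : ∀ k ν, k ≤ ν → u ν ≤ c * γ k := fun k ν hν =>
    (hu ν).trans (mul_le_mul_of_nonneg_left (hγ hν) hc)
  have hb0 := geomFilter_nonneg hρ.le hr hu0
  set Gm := r + c * γ 0 / (1 - ρ) with hGm
  have hb : ∀ ν, geomFilter ρ r u ν ≤ Gm := fun ν => by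
    have h1 := geomFilter_add_le (r := r) hρ hρ1 (huU 0) (mul_nonneg hc (hγ0 0).le) ν
    rw [zero_add] at h1
    refine h1.trans (add_le_add ?_ le_rfl)
    exact mul_le_of_le_one_left hr (pow_le_one₀ hρ.le hρ1.le)
  -- From `m ν < θ * ν + 1` one gets `ν - m ν ≥ a * m ν - 1 / θ`; geometric decay over the elapsed
  -- time `ν - m ν` thus becomes geometric decay in `m ν`, where the slow-decay hypothesis applies.
  set a := 1 / θ - 1 with ha
  have ha0 : 0 < a := by rw [ha, sub_pos]; exact (one_lt_div hθ0).2 hθ1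
  set ρ' := ρ ^ a with hρ'
  have hρ'mem : ρ' ∈ Set.Ioo (0 : ℝ) 1 :=
    ⟨Real.rpow_pos_of_pos hρ a, Real.rpow_lt_one hρ.le hρ1 ha0⟩
  have hgeo : ∀ ν, ρ ^ (ν - m ν) ≤ ρ ^ (-(1 / θ)) * ρ' ^ m ν := fun ν => by
    rw [hρ', ← Real.rpow_natCast, ← Real.rpow_natCast, ← Real.rpow_mul hρ.le, ← Real.rpow_add hρ]
    refine Real.rpow_le_rpow_of_exponent_ge hρ hρ1.le ?_
    rw [Nat.cast_sub (hmle ν)]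
    have h1 : (m ν : ℝ) < θ * ν + 1 := Nat.ceil_lt_add_one (by positivity)
    have h2 : ((m ν : ℝ) - 1) / θ ≤ ν := by rw [div_le_iff₀ hθ0]; linarith
    have h3 : ((m ν : ℝ) - 1) / θ = -(1 / θ) + 1 / θ * m ν := by ring
    rw [ha]
    linarith
  have hO1 : (fun ν => ρ' ^ m ν) =O[atTop] (fun ν => γ (m ν)) :=
    ((hslow ρ' hρ'mem).comp_tendsto hmtop).isBigO
  have hO2 : (fun ν => Gm * ρ ^ (-(1 / θ)) * ρ' ^ m ν + c / (1 - ρ) * γ (m ν)) =O[atTop]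
      (fun ν => γ (m ν)) :=
    (hO1.const_mul_left _).add ((isBigO_refl _ _).const_mul_left _)
  refine IsBigO.trans (IsBigO.of_bound 1 (Eventually.of_forall fun ν => ?_)) hO2
  -- Restart at time `m ν`: the bounded past is discounted by `ρ ^ (ν - m ν)`, and later
  -- perturbations are at most `c * γ (m ν)` by monotonicity.
  have h1 := geomFilter_add_le (r := r) hρ hρ1 (huU (m ν)) (mul_nonneg hc (hγ0 _).le) (ν - m ν)
  rw [Nat.add_sub_cancel' (hmle ν)] at h1
  have hGm0 : 0 ≤ Gm := (hb0 0).trans (hb 0)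
  have h2 : ρ ^ (ν - m ν) * geomFilter ρ r u (m ν) ≤ ρ ^ (-(1 / θ)) * ρ' ^ m ν * Gm :=
    mul_le_mul (hgeo ν) (hb _) (hb0 _)
      (mul_nonneg (Real.rpow_nonneg hρ.le _) (pow_nonneg hρ'mem.1.le _))
  rw [one_mul, Real.norm_of_nonneg (hb0 ν)]
  refine le_trans ?_ (le_abs_self _)
  have h3 : c * γ (m ν) / (1 - ρ) = c / (1 - ρ) * γ (m ν) := by ring
  linarith

end Rates

/-! ### Summability of disagreements and changes. -/

namespace RunBounds

/-- The perturbation of the dictionary consensus caused by the local updates. -/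
lemma exists_D_perturbation (b : RunBounds P S T) (hT : IsGenerated P S T)
    (hA : AdmissibleWeights S.E S.A κ) (hγ : AdmissibleStep S.γ) :
    ∃ v : ℕ → Fin I → Mat M K, (∀ ν, T.D (ν + 1) = act (mixing S T ν) (T.D ν) + v ν) ∧
      ∀ ν, spread (v ν) ≤ 2 * b.d * S.γ ν := by
  refine ⟨fun ν => act (mixing S T ν) (T.U ν - T.D ν), fun ν => ?_, fun ν => ?_⟩
  · rw [D_succ hT hA, ← act_add, add_sub_cancel]
  · have h1 := spread_act_le (β := 0) (mixing_nonneg hA b.φ_pos ν)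
      (mixing_row_sum hT hA b.φ_pos ν) (by simp) (T.U ν - T.D ν)
    have h2 := spread_le_two_mul (x := T.U ν - T.D ν)
      (mul_nonneg (hγ.pos ν).le b.d_nonneg) fun i => b.U_sub_D_le hT hγ ν i
    simp only [mul_zero, sub_zero, one_mul] at h1
    linarith

/-- The agents' dictionaries differ by a geometrically filtered multiple of the step size. -/
lemma exists_spread_D_le (b : RunBounds P S T) (hI : 0 < I) (hT : IsGenerated P S T)
    (hA : AdmissibleWeights S.E S.A κ) {B : ℕ} (hB : 0 < B) (hconn : StronglyConnected S.E B)
    (hγ : AdmissibleStep S.γ) :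
    ∃ (C ρ : ℝ) (u : ℕ → ℝ), 0 < C ∧ 0 < ρ ∧ ρ < 1 ∧ (∀ ν, 0 ≤ u ν) ∧
      (∀ ν, u ν ≤ 2 * b.d * S.γ ν) ∧
      ∀ ν, spread (T.D ν) ≤ C * geomFilter ρ (spread (T.D 0)) u ν := by
  obtain ⟨v, hv, hvle⟩ := b.exists_D_perturbation hT hA hγ
  have hI0 : (0 : ℝ) < I := by exact_mod_cast hI
  obtain ⟨C, ρ, hC, hρ, hρ1, h⟩ := exists_spread_le_geomFilter hI hB hconn
    (div_pos (mul_pos hA.pos b.c_pos) hI0) (mixing_nonneg hA b.φ_pos)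
    (mixing_row_sum hT hA b.φ_pos)
    (fun ν i => le_mixing hT hA b.c_pos b.φ_ge (hA.diag ν i))
    (fun ν i j hij => le_mixing hT hA b.c_pos b.φ_ge (hA.edge ν i j hij)) (Mat M K)
  exact ⟨C, ρ, fun ν => spread (v ν), hC, hρ, hρ1, fun ν => spread_nonneg _, hvle, h T.D v hv⟩

lemma exists_sum_spread_D_sq_le (b : RunBounds P S T) (hI : 0 < I) (hT : IsGenerated P S T)
    (hA : AdmissibleWeights S.E S.A κ) {B : ℕ} (hB : 0 < B) (hconn : StronglyConnected S.E B)
    (hγ : AdmissibleStep S.γ) :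
    ∃ Q : ℝ, 0 ≤ Q ∧ ∀ N, ∑ ν ∈ Finset.range N, spread (T.D ν) ^ 2 ≤ Q := by
  obtain ⟨C, ρ, u, hC, hρ, hρ1, hu0, hu, h⟩ := b.exists_spread_D_le hI hT hA hB hconn hγ
  have h1 : 0 < 1 - ρ := by linarith
  refine ⟨C ^ 2 * (spread (T.D 0) ^ 2 / (1 - ρ)) +
    C ^ 2 / (1 - ρ) ^ 2 * ((2 * b.d) ^ 2 * ∑' ν, S.γ ν ^ 2), ?_, fun N => ?_⟩
  · have : 0 ≤ ∑' ν, S.γ ν ^ 2 := tsum_nonneg fun _ => sq_nonneg _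
    positivity
  · refine (sum_sq_le_of_le_geomFilter hρ hρ1 (fun ν => spread_nonneg _) h N).trans ?_
    have : ∑ ν ∈ Finset.range N, u ν ^ 2 ≤ (2 * b.d) ^ 2 * ∑' ν, S.γ ν ^ 2 := by
      calc _ ≤ ∑ ν ∈ Finset.range N, (2 * b.d) ^ 2 * S.γ ν ^ 2 :=
            Finset.sum_le_sum fun ν _ => by
              rw [← mul_pow]
              exact pow_le_pow_left₀ (hu0 ν) (hu ν) 2
        _ ≤ _ := by
            rw [← Finset.mul_sum]
            exact mul_le_mul_of_nonneg_left (hγ.sum_sq_le N) (sq_nonneg _)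
    gcongr

/-- The innovation contains the change of the coefficients, whose summability is still open; the
estimate is therefore relative, and the potential argument closes the loop. -/
lemma exists_sum_spread_Θ_sq_le (b : RunBounds P S T) (hI : 0 < I) (hT : IsGenerated P S T)
    (hA : AdmissibleWeights S.E S.A κ) {B : ℕ} (hB : 0 < B) (hconn : StronglyConnected S.E B)
    (hγ : AdmissibleStep S.γ) :
    ∃ Q R : ℝ, 0 ≤ Q ∧ 0 ≤ R ∧ ∀ N, ∑ ν ∈ Finset.range N, spread (T.Θ ν) ^ 2 ≤
      Q + R * ∑ ν ∈ Finset.range N, changeX T ν := by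
  have hI0 : (0 : ℝ) < I := by exact_mod_cast hI
  obtain ⟨C, ρ, hC, hρ, hρ1, h⟩ := exists_spread_le_geomFilter hI hB hconn
    (div_pos (mul_pos hA.pos b.c_pos) hI0) (mixing_nonneg hA b.φ_pos)
    (mixing_row_sum hT hA b.φ_pos)
    (fun ν i => le_mixing hT hA b.c_pos b.φ_ge (hA.diag ν i))
    (fun ν i j hij => le_mixing hT hA b.c_pos b.φ_ge (hA.edge ν i j hij)) (Mat M K)
  have hΘ := h T.Θ (innovation P T) (Θ_succ hT hA)
  obtain ⟨QD, hQD0, hQD⟩ := b.exists_sum_spread_D_sq_le hI hT hA hB hconn hγ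
  have h1 : 0 < 1 - ρ := by linarith
  set k := (2 * (b.Λ / b.c)) ^ 2 * 3 with hk
  have hk0 : 0 ≤ k := by positivity
  set Γ := ∑' ν, S.γ ν ^ 2 with hΓ
  have hΓ0 : 0 ≤ Γ := tsum_nonneg fun _ => sq_nonneg _
  have hinn : ∀ ν, spread (innovation P T ν) ^ 2 ≤
      k * (spread (T.D ν) ^ 2 + b.d ^ 2 * S.γ ν ^ 2 + changeX T ν) := fun ν => by
    have hnn : 0 ≤ b.Λ / b.c * (spread (T.D ν) + S.γ ν * b.d + √(changeX T ν)) :=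
      mul_nonneg (div_nonneg b.Λ_nonneg b.c_pos.le) (add_nonneg (add_nonneg (spread_nonneg _)
        (mul_nonneg (hγ.pos ν).le b.d_nonneg)) (Real.sqrt_nonneg _))
    have h2 := spread_le_two_mul hnn (b.norm_innovation_le hT hA hγ ν)
    have h3 := sq_add_three_le (spread (T.D ν)) (S.γ ν * b.d) (√(changeX T ν))
    rw [Real.sq_sqrt (changeX_nonneg T ν), mul_pow (S.γ ν), mul_comm (S.γ ν ^ 2)] at h3
    calc _ ≤ (2 * (b.Λ / b.c * (spread (T.D ν) + S.γ ν * b.d + √(changeX T ν)))) ^ 2 :=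
          pow_le_pow_left₀ (spread_nonneg _) h2 2
      _ ≤ _ := by
          rw [← mul_assoc, mul_pow, hk, mul_assoc _ (3 : ℝ)]
          exact mul_le_mul_of_nonneg_left h3 (sq_nonneg _)
  set a := C ^ 2 / (1 - ρ) ^ 2 with ha
  have ha0 : 0 ≤ a := by positivity
  refine ⟨C ^ 2 * (spread (T.Θ 0) ^ 2 / (1 - ρ)) + a * (k * (QD + b.d ^ 2 * Γ)), a * k,
    by positivity, by positivity, fun N => ?_⟩
  refine (sum_sq_le_of_le_geomFilter hρ hρ1 (fun ν => spread_nonneg _) hΘ N).trans ?_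
  have hsum : ∑ ν ∈ Finset.range N, spread (innovation P T ν) ^ 2 ≤
      k * (QD + b.d ^ 2 * Γ + ∑ ν ∈ Finset.range N, changeX T ν) := by
    refine (Finset.sum_le_sum fun ν _ => hinn ν).trans ?_
    rw [← Finset.mul_sum, Finset.sum_add_distrib, Finset.sum_add_distrib, ← Finset.mul_sum]
    refine mul_le_mul_of_nonneg_left ?_ hk0
    have := mul_le_mul_of_nonneg_left (hγ.sum_sq_le N) (sq_nonneg b.d)
    linarith [hQD N]
  have := mul_le_mul_of_nonneg_left hsum ha0
  linarith

/-- The decrease of the potential with its errors separated. -/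
lemma exists_potential_succ_le (b : RunBounds P S T) (hI : 0 < I) (hP : P.Standing L)
    (hT : IsGenerated P S T) (hA : AdmissibleWeights S.E S.A κ) (hγ : AdmissibleStep S.γ)
    {ζ : ℝ} (hζ : 0 < ζ) :
    ∃ k₁ k₂ : ℝ, 0 ≤ k₁ ∧ 0 ≤ k₂ ∧ ∀ ν, potential P T (ν + 1) + (b.ε / 2 * changeX T ν
      + b.τ₀ * b.c / I * (S.γ ν * changeD T ν)) ≤ potential P T ν +
        (ζ * spread (T.Θ ν) ^ 2 + k₁ * S.γ ν ^ 2 + k₂ * spread (T.D ν) ^ 2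
          + Pi.single (M := fun _ => ℝ) 0 b.initialDefect ν) := by
  have hε := b.ε_pos
  have hd := b.d_nonneg
  have hΛ := b.Λ_nonneg
  refine ⟨(I * b.d) ^ 2 / (4 * ζ) + (I * b.Λ * b.d) ^ 2 + I * b.Λ / 2 * b.d ^ 2
    + I * (b.Λ ^ 2 / (2 * b.ε)) * (8 * b.d ^ 2), 1 + I * (b.Λ ^ 2 / (2 * b.ε)) * 2,
    by positivity, by positivity, fun ν => ?_⟩
  have h1 := b.potential_succ_le hI hP hT hA hγ ν
  -- Young's inequality with a free weight: `ζ` can be made small at the cost of a larger multiple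
  -- of the summable `γ ^ 2`.
  have h2 : S.γ ν * (I * spread (T.Θ ν) * b.d) ≤
      ζ * spread (T.Θ ν) ^ 2 + (I * b.d) ^ 2 / (4 * ζ) * S.γ ν ^ 2 := by
    have e : ζ * spread (T.Θ ν) ^ 2 + (I * b.d) ^ 2 / (4 * ζ) * S.γ ν ^ 2
        - S.γ ν * (I * spread (T.Θ ν) * b.d) =
        (2 * ζ * spread (T.Θ ν) - I * b.d * S.γ ν) ^ 2 / (4 * ζ) := by
      field_simp
      ring
    have : 0 ≤ (2 * ζ * spread (T.Θ ν) - I * b.d * S.γ ν) ^ 2 / (4 * ζ) := by positivity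
    linarith
  have h3 : S.γ ν * (I * (b.Λ * spread (T.D ν)) * b.d) ≤
      (I * b.Λ * b.d) ^ 2 * S.γ ν ^ 2 + spread (T.D ν) ^ 2 := by
    nlinarith [sq_nonneg (I * b.Λ * b.d * S.γ ν - spread (T.D ν)),
      sq_nonneg (I * b.Λ * b.d * S.γ ν), sq_nonneg (spread (T.D ν))]
  have h4 : (2 * (S.γ ν * b.d) + spread (T.D ν)) ^ 2 ≤
      8 * b.d ^ 2 * S.γ ν ^ 2 + 2 * spread (T.D ν) ^ 2 := by
    nlinarith [sq_nonneg (2 * (S.γ ν * b.d) - spread (T.D ν))]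
  have h5 := mul_le_mul_of_nonneg_left h4
    (show 0 ≤ I * (b.Λ ^ 2 / (2 * b.ε)) by positivity)
  linarith

/-- The summability estimates that drive all the rates. -/
lemma exists_sum_bounds (b : RunBounds P S T) (hI : 0 < I) (hP : P.Standing L)
    (hT : IsGenerated P S T) (hA : AdmissibleWeights S.E S.A κ) {B : ℕ} (hB : 0 < B)
    (hconn : StronglyConnected S.E B) (hγ : AdmissibleStep S.γ) :
    ∃ Q : ℝ, 0 ≤ Q ∧ ∀ N,
      ∑ ν ∈ Finset.range N, changeX T ν ≤ Q ∧
      ∑ ν ∈ Finset.range N, S.γ ν * changeD T ν ≤ Q ∧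
      ∑ ν ∈ Finset.range N, spread (T.D ν) ^ 2 ≤ Q ∧
      ∑ ν ∈ Finset.range N, spread (T.Θ ν) ^ 2 ≤ Q := by
  have hI0 : (0 : ℝ) < I := by exact_mod_cast hI
  obtain ⟨QD, hQD0, hQD⟩ := b.exists_sum_spread_D_sq_le hI hT hA hB hconn hγ
  obtain ⟨QΘ, R, hQΘ0, hR0, hQΘ⟩ := b.exists_sum_spread_Θ_sq_le hI hT hA hB hconn hγ
  obtain ⟨m, hm⟩ := b.exists_le_potential hI hP hT hA
  have hε := b.ε_pos
  -- With `ζ * R ≤ ε / 4`, the tracking error consumes at most half of the decrease `ε / 2 *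
  -- changeX`; a coefficient `ε / 4` survives.
  obtain ⟨ζ, hζ0, hζR⟩ : ∃ ζ : ℝ, 0 < ζ ∧ ζ * R ≤ b.ε / 4 := by
    refine ⟨b.ε / (4 * (R + 1)), by positivity, ?_⟩
    rw [div_mul_eq_mul_div, div_le_div_iff₀ (by positivity) (by norm_num)]
    nlinarith
  obtain ⟨k₁, k₂, hk₁0, hk₂0, hstep⟩ := b.exists_potential_succ_le hI hP hT hA hγ hζ0
  have hc₁0 : 0 < b.τ₀ * b.c / I := div_pos (mul_pos b.τ₀_pos b.c_pos) hI0
  generalize b.τ₀ * b.c / I = c₁ at hstep hc₁0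
  have hdef0 : 0 ≤ b.initialDefect := Finset.sum_nonneg fun _ _ => abs_nonneg _
  have hzsum : ∀ N, ∑ ν ∈ Finset.range N, Pi.single (M := fun _ => ℝ) 0 b.initialDefect ν ≤
      b.initialDefect := fun N => by
    rcases N with - | N
    · simpa using hdef0
    · rw [Finset.sum_range_succ']
      simp
  obtain ⟨A, hmain⟩ : ∃ A, ∀ N, b.ε / 4 * ∑ ν ∈ Finset.range N, changeX T ν
      + c₁ * ∑ ν ∈ Finset.range N, S.γ ν * changeD T ν ≤ A := by
    refine ⟨potential P T 0 - m + (ζ * QΘ + k₁ * ∑' ν, S.γ ν ^ 2 + k₂ * QD + b.initialDefect),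
      fun N => ?_⟩
    have h0 := sum_le_of_potential hm hstep N
    simp only [Finset.sum_add_distrib, ← Finset.mul_sum] at h0
    have h1 := mul_le_mul_of_nonneg_left (hQΘ N) hζ0.le
    have h2 := mul_le_mul_of_nonneg_left (hγ.sum_sq_le N) hk₁0
    have h3 := mul_le_mul_of_nonneg_left (hQD N) hk₂0
    have h5 := mul_le_mul_of_nonneg_right hζR
      (Finset.sum_nonneg fun ν (_ : ν ∈ Finset.range N) => changeX_nonneg T ν)
    linarith [hzsum N]
  have hX0 : ∀ N, 0 ≤ ∑ ν ∈ Finset.range N, changeX T ν := fun N =>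
    Finset.sum_nonneg fun ν _ => changeX_nonneg T ν
  have hD0 : ∀ N, 0 ≤ ∑ ν ∈ Finset.range N, S.γ ν * changeD T ν := fun N =>
    Finset.sum_nonneg fun ν _ => mul_nonneg (hγ.pos ν).le (changeD_nonneg T ν)
  have hA0 : 0 ≤ A := by simpa using hmain 0
  have hXQ : ∀ N, ∑ ν ∈ Finset.range N, changeX T ν ≤ A / (b.ε / 4) := fun N => by
    rw [le_div_iff₀' (by positivity)]
    linarith [hmain N, mul_nonneg hc₁0.le (hD0 N)]
  have hDQ : ∀ N, ∑ ν ∈ Finset.range N, S.γ ν * changeD T ν ≤ A / c₁ := fun N => by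
    rw [le_div_iff₀' hc₁0]
    have : 0 ≤ b.ε / 4 * ∑ ν ∈ Finset.range N, changeX T ν :=
      mul_nonneg (by positivity) (hX0 N)
    linarith [hmain N]
  have q1 : 0 ≤ A / (b.ε / 4) := by positivity
  have q2 : 0 ≤ A / c₁ := by positivity
  have q3 : 0 ≤ R * (A / (b.ε / 4)) := by positivity
  refine ⟨A / (b.ε / 4) + A / c₁ + QD + (QΘ + R * (A / (b.ε / 4))), by linarith, fun N =>
    ⟨by linarith [hXQ N], by linarith [hDQ N], by linarith [hQD N], ?_⟩⟩
  linarith [hQΘ N, mul_le_mul_of_nonneg_left (hXQ N) hR0]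

lemma consensusError_le (hI : 0 < I) (T : Iterates I M K n) (ν : ℕ) :
    T.consensusError ν ≤ spread (T.D ν) := by
  have : Nonempty (Fin I) := ⟨⟨0, hI⟩⟩
  exact ciSup_le fun i => (maxNorm_le_norm _).trans (D_sub_avgD_le hI T ν i)

end RunBounds

lemma consensusError_nonneg (T : Iterates I M K n) (ν : ℕ) : 0 ≤ T.consensusError ν :=
  Real.iSup_nonneg fun _ => maxNorm_nonneg _

end D4L

end

/-! ### The three rates. -/

theorem theorem2 {I M K : ℕ} (hI : 0 < I) {n : Fin I → ℕ}
    (P : D4L.Problem I M K n) (L : Fin I → D4L.Mat M K → ℝ≥0) (hP : P.Standing L)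
    (S : D4L.Parameters I) (T : D4L.Iterates I M K n) (hT : D4L.IsGenerated P S T)
    (hconn : ∃ B : ℕ, 0 < B ∧ D4L.StronglyConnected S.E B)
    (hA : ∃ κ : ℝ, D4L.AdmissibleWeights S.E S.A κ)
    (hτ : D4L.AdmissibleProx L S T)
    (hγ : D4L.AdmissibleStep S.γ) (hγ_anti : Antitone S.γ)
    (τD τX : ℝ) (hτD : 0 < τD) (hτX : 0 < τX) :
    -- rate of the consensus error
    ((∀ ρ ∈ Set.Ioo (0 : ℝ) 1, (fun ν : ℕ => ρ ^ ν) =o[atTop] S.γ) →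
      ∀ θ ∈ Set.Ioo (0 : ℝ) 1,
        T.consensusError =O[atTop] (fun ν : ℕ => S.γ ⌈θ * (ν : ℝ)⌉₊)) ∧
    -- rate of the optimization error in `X`
    (∃ C : ℝ, ∀ ε : ℝ, 0 < ε → ∃ N : ℕ,
      IsLeast {ν : ℕ | D4L.meritX P τX (T.avgD ν) (T.X ν) ≤ ε} N ∧
        (N : ℝ) ≤ C / ε ^ 2) ∧
    -- rate of the optimization error in `D`
    (∀ k p : ℝ, 0 < k → p ∈ Set.Ioo (1 / 2 : ℝ) 1 →
      (∀ ν : ℕ, 1 ≤ ν → S.γ ν = k / (ν : ℝ) ^ p) →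
      ∃ C : ℝ, ∀ ε : ℝ, 0 < ε → ∃ N : ℕ,
        IsLeast {ν : ℕ | D4L.meritD P τD (T.avgD ν) (T.X ν) ≤ ε} N ∧
          (N : ℝ) ≤ C / ε ^ (2 / (1 - p))) := by
  open D4L in
  obtain ⟨B, hB, hconn⟩ := hconn
  obtain ⟨κ, hA⟩ := hA
  obtain ⟨b⟩ := nonempty_runBounds hI hP hT hA hB hconn hτ hγ
  obtain ⟨Q, hQ0, hQ⟩ := b.exists_sum_bounds hI hP hT hA hB hconn hγ
  refine ⟨fun hslow θ hθ => ?_, ?_, fun k p hk hp hγk => ?_⟩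
  · obtain ⟨C, ρ, u, hC, hρ, hρ1, hu0, hu, h⟩ := b.exists_spread_D_le hI hT hA hB hconn hγ
    have hO := isBigO_geomFilter_ceil (r := spread (T.D 0)) hρ hρ1 (spread_nonneg _)
      (mul_nonneg two_pos.le b.d_nonneg) hγ.pos hγ_anti hu0 hu hslow hθ
    refine IsBigO.trans (IsBigO.of_bound C (Eventually.of_forall fun ν => ?_)) hO
    rw [Real.norm_of_nonneg (consensusError_nonneg T ν),
      Real.norm_of_nonneg (geomFilter_nonneg hρ.le (spread_nonneg _) hu0 ν)]
    exact (RunBounds.consensusError_le hI T ν).trans (h ν)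
  · obtain ⟨C, hC0, hC⟩ := b.meritX_sq_le hI hP hT hγ hτX
    refine ⟨C * (Q + Q + ∑' ν, S.γ ν ^ 2), fun ε hε => ?_⟩
    obtain ⟨N, hN, hle⟩ := exists_isLeast_hitting (w := fun _ => 1)
      (a := fun ν => meritX P τX (T.avgD ν) (T.X ν)) (Q := C * (Q + Q + ∑' ν, S.γ ν ^ 2))
      (fun _ => zero_le_one) (by simpa using tendsto_natCast_atTop_atTop) (fun N => by
        simp only [one_mul]
        refine (Finset.sum_le_sum fun ν _ => hC ν).trans ?_
        rw [← Finset.mul_sum, Finset.sum_add_distrib, Finset.sum_add_distrib]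
        refine mul_le_mul_of_nonneg_left ?_ hC0
        linarith [(hQ N).1, (hQ N).2.2.1, hγ.sum_sq_le N]) hε
    refine ⟨N, hN, ?_⟩
    rw [le_div_iff₀' (by positivity)]
    simpa using hle
  · obtain ⟨C, hC0, hC⟩ := b.meritD_sq_le hI hP hT hA hτD
    set R := C * (Q + Q + Q) with hR
    have hR0 : 0 ≤ R := by positivity
    have hp1 : 0 < 1 - p := by linarith [hp.2]
    refine ⟨(R / k) ^ (1 / (1 - p)), fun ε hε => ?_⟩
    obtain ⟨N, hN, hle⟩ := exists_isLeast_hitting (w := S.γ)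
      (a := fun ν => meritD P τD (T.avgD ν) (T.X ν)) (Q := R)
      (fun ν => (hγ.pos ν).le) hγ.sum_eq_top (fun N => by
        -- The factor `γ` is needed only in front of `changeD`; on the spreads, which are square
        -- summable by themselves, it is dropped because `γ ≤ 1`.
        have hterm : ∀ ν, S.γ ν * meritD P τD (T.avgD ν) (T.X ν) ^ 2 ≤
            C * (S.γ ν * changeD T ν + spread (T.D ν) ^ 2 + spread (T.Θ ν) ^ 2) := fun ν => by
          refine (mul_le_mul_of_nonneg_left (hC ν) (hγ.pos ν).le).trans ?_
          rw [mul_left_comm, mul_add (S.γ ν), mul_add (S.γ ν)]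
          refine mul_le_mul_of_nonneg_left (add_le_add (add_le_add le_rfl ?_) ?_) hC0
          · exact mul_le_of_le_one_left (sq_nonneg _) (hγ.le_one ν)
          · exact mul_le_of_le_one_left (sq_nonneg _) (hγ.le_one ν)
        refine (Finset.sum_le_sum fun ν _ => hterm ν).trans ?_
        rw [← Finset.mul_sum, Finset.sum_add_distrib, Finset.sum_add_distrib]
        refine mul_le_mul_of_nonneg_left ?_ hC0
        linarith [(hQ N).2.1, (hQ N).2.2.1, (hQ N).2.2.2]) hε
    refine ⟨N, hN, ?_⟩
    -- The explicit step size is prescribed only from index `1`, so `N = 0` is treated apart.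
    rcases Nat.eq_zero_or_pos N with rfl | hNpos
    · rw [Nat.cast_zero]; positivity
    have hN0 : (0 : ℝ) < N := by exact_mod_cast hNpos
    -- Each of the `N` terms is at least `γ N = k / N ^ p`; monotonicity thus gives the growth order
    -- without an integral comparison.
    have hsum : k * (N : ℝ) ^ (1 - p) ≤ ∑ ν ∈ Finset.range N, S.γ ν := by
      calc k * (N : ℝ) ^ (1 - p) = ∑ _ν ∈ Finset.range N, S.γ N := by
            rw [Finset.sum_const, Finset.card_range, nsmul_eq_mul, hγk N hNpos,
              Real.rpow_sub hN0, Real.rpow_one]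
            ring
        _ ≤ _ := Finset.sum_le_sum fun ν hν => hγ_anti (Finset.mem_range.1 hν).le
    have hpow : (N : ℝ) ^ (1 - p) ≤ R / k / ε ^ 2 := by
      rw [div_div, le_div_iff₀ (by positivity)]
      have := mul_le_mul_of_nonneg_left hsum (sq_nonneg ε)
      linarith
    have hroot : (N : ℝ) = ((N : ℝ) ^ (1 - p)) ^ (1 / (1 - p)) := by
      rw [← Real.rpow_mul hN0.le, mul_one_div_cancel hp1.ne', Real.rpow_one]
    rw [hroot]
    refine (Real.rpow_le_rpow (by positivity) hpow (by positivity)).trans (le_of_eq ?_)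
    rw [Real.div_rpow (by positivity) (by positivity), ← Real.rpow_natCast ε 2,
      ← Real.rpow_mul hε.le]
    congr 2
    push_cast
    ring
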